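/- Conventions: $\hat g(\omega)=\int_{\mathbb R} g(t)e^{-2\pi i\omega t}\,dt$ and $(f\star g)(t)=\int_{\mathbb R} f(s)g(t-s)\,ds$. Let $\psi\in L^1\cap L^2(\mathbb R)$ be complex-valued with $\int_{\mathbb R}\psi=0$, and for $j\in\mathbb Z$ put $\psi_j(t)=2^{-j}\psi(2^{-j}t)$. Assume: 1. $\frac12\sum_{j\in\mathbb Z}\left(|\hat\psi_j(\omega)|^2+|\hat\psi_j(-\omega)|^2\right)\le 1$ for all $\omega\in\mathbb R$; 2. $|\hat\psi_j(-\omega)|\le|\hat\psi_j(\omega)|$ for all $j\in\mathbb Z$ and $\omega>0$, and for each $\omega>0$ the inequality is strict for at least one $j$; 3. for some $\epsilon>0$, $\hat\psi(\omega)=O(|\omega|^{1+\epsilon})$ as $\omega\to0$. For $a>0$ let $\chi_a(t)=\sqrt\pi\,a\exp(-(\pi a)^2t^2)$, so that $\hat\chi_a(\omega)=\exp(-(\omega/a)^2)$. For a path $p=(j_1,\dots,j_n)\in\mathbb Z^n$ of length $|p|=n$, define $U[\varnothing]X=X$ and $U[(j_1,\dots,j_n)]X=\big|U[(j_1,\dots,j_{n-1})]X\star\psi_{j_n}\big|$,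 sample path by sample path. For $J\in\mathbb Z$ let $\mathcal P_J$ be the set of finite paths all of whose entries are $\le J$. Then for every $J\in\mathbb Z$ there exist $r>0$ and $a>1$ (depending only on $\psi$ and $J$) such that the following holds for every real-valued, measurable, strictly stationary process $X=(X(t))_{t\in\mathbb R}$ with finite second moments, whose autocovariance $R_X(\tau)=\mathrm{Cov}(X(\tau),X(0))$ is continuous and integrable. For every path $p$ and every $t\in\mathbb R$, the convolutions defining $U[p]X(t)$ converge absolutely almost surely and $\mathbb E|U[p]X(t)|^2<\infty$. Moreover, for all $n\ge2$ and all $t\in\mathbb R$, the convolution $X\star\chi_{ra^n}(t)$ converges absolutely almost surely and has finite second moment, the function $\hat R_X\,(1-|\hat\chi_{ra^n}|^2)$ is integrable, and $$\sum_{p\in\mathcal P_J,\ |p|=n}\mathbb E\big(|U[p]X(t)|^2\big)\ \le\ \mathbb E\big(|X(t)|^2\big)-\mathbb E\big(|X\star\chi_{ra^n}(t)|^2\big)=\int_{\mathbb R}\hat R_X(\omega)\left(1-|\hat\chi_{ra^n}(\omega)|^2\right)d\omega .$$ -/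

import Mathlib

open MeasureTheory ProbabilityTheory
open scoped FourierTransform Convolution ENNReal Topology

/-- A mother wavelet: a complex-valued function in `L¹ ∩ L²` of the real line with zero mean. -/
structure IsMotherWavelet (ψ : ℝ → ℂ) : Prop where
  integrable : Integrable ψ
  memLp_two : MemLp ψ 2
  integral_eq_zero : ∫ t, ψ t = 0

/-- The dilated wavelet `ψ_j(t) = 2^{-j} ψ(2^{-j} t)`. -/
noncomputable def wavelet (ψ : ℝ → ℂ) (j : ℤ) (t : ℝ) : ℂ :=
  ((2 : ℝ) ^ (-j)) • ψ ((2 : ℝ) ^ (-j) * t)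

/-- The convolution `(f ⋆ g)(t) = ∫ f(s) g(t - s) ds` of a real signal with a real or complex
filter. -/
noncomputable def conv {E : Type*} [NormedAddCommGroup E] [NormedSpace ℝ E]
    (f : ℝ → ℝ) (g : ℝ → E) : ℝ → E :=
  f ⋆[ContinuousLinearMap.lsmul ℝ ℝ, volume] g

/-- The defining integral of `(f ⋆ g)(t)` converges absolutely. -/
def ConvExistsAt {E : Type*} [NormedAddCommGroup E] [NormedSpace ℝ E]
    (f : ℝ → ℝ) (g : ℝ → E) (t : ℝ) : Prop :=
  ConvolutionExistsAt f g t (ContinuousLinearMap.lsmul ℝ ℝ) volume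

/-- The cascade `U[(j₁, …, jₙ)] f = | U[(j₁, …, jₙ₋₁)] f ⋆ ψ_{jₙ} |`, `U[∅] f = f`,
a path being the list `[j₁, …, jₙ]`. -/
noncomputable def scatU (ψ : ℝ → ℂ) (p : List ℤ) (f : ℝ → ℝ) : ℝ → ℝ :=
  p.foldl (fun g j t => ‖conv g (wavelet ψ j) t‖) f

/-- The paths of length `n` with all scales at most `J`. -/
abbrev ScatPath (J : ℤ) (n : ℕ) : Type :=
  {p : List ℤ // p.length = n ∧ ∀ j ∈ p, j ≤ J}

/-- The Gaussian `χ_a(t) = √π a exp(-(π a)² t²)`. -/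
noncomputable def gaussFilter (a t : ℝ) : ℝ :=
  √Real.pi * a * Real.exp (-(Real.pi * a) ^ 2 * t ^ 2)

/-- The Fourier transform, with kernel `e^{-2πi t ω}`, of a real-valued function. -/
noncomputable def fourierReal (f : ℝ → ℝ) : ℝ → ℂ :=
  𝓕 (fun t => (f t : ℂ))

/-- Strict stationarity: the finite-dimensional laws are invariant under time shifts. -/
def IsStationaryProcess {Ω : Type*} [MeasurableSpace Ω] (P : Measure Ω) (X : ℝ → Ω → ℝ) : Prop :=
  ∀ (m : ℕ) (t : Fin m → ℝ) (h : ℝ),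
    P.map (fun ω i => X (t i + h) ω) = P.map (fun ω i => X (t i) ω)

/-- The autocovariance `R_X(τ) = Cov(X(τ), X(0))`, which for a stationary process is
`Cov(X(s + τ), X(s))` for every `s`. -/
noncomputable def autocov {Ω : Type*} [MeasurableSpace Ω] (P : Measure Ω) (X : ℝ → Ω → ℝ)
    (τ : ℝ) : ℝ :=
  covariance (X τ) (X 0) P

/-- A real-valued (jointly measurable, second-order, strictly) stationary process with continuous
and integrable autocovariance. -/
structure IsAdmissibleProcess {Ω : Type*} [MeasurableSpace Ω] (P : Measure Ω)
    (X : ℝ → Ω → ℝ) : Prop where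
  measurable : Measurable (fun z : ℝ × Ω => X z.1 z.2)
  memLp_two : ∀ t, MemLp (X t) 2 P
  stationary : IsStationaryProcess P X
  continuous_autocov : Continuous (autocov P X)
  integrable_autocov : Integrable (autocov P X)

/-!
The energy inequality is first proved for a deterministic real signal `f ∈ L¹ ∩ L²` and then
transferred to the process by averaging over long time windows.

*Deterministic signals.* By Plancherel, the energy of the layer of length `n` is compared with
`∫ |𝓕 f|² (1 - |𝓕 φ|²)` for a nonnegative low-pass filter `φ`. For `φ ≥ 0` one has
`| |h| ⋆ φ | ≥ | h ⋆ φ_η |` pointwise for every modulation `φ_η` of `φ`. Hence the energy that `φ`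
removes from `|h|` is at most the energy that `φ_η` removes from `h`, for any centre frequency `η`
(`IsSignal.lintegral_modulus_le`). Peeling off one wavelet layer therefore reduces the bound to an
inequality between multipliers, symmetrized in `ω` because `f` is real
(`IsSignal.tsum_layer_le`).

For Gaussians the inequality says that a low-pass filter of width `x` may be replaced by one of
width `a x` (`IsWaveletProfile.exists_gaussian_step`). By concavity of `u ↦ 1 - exp (-u)` and the
Littlewood–Paley bound it suffices that the mean square distance of `ω` to the centre frequencies
`δ 2⁻ʲ`, weighted by the wavelets, is below `ω² / a²`
(`IsWaveletProfile.exists_variance_bound`). To first order in `δ` the distance decreases because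
positive frequencies predominate, uniformly in `ω` by compactness and dyadic scaling; the second
order is bounded thanks to the decay of `𝓕 ψ` at the origin.

The induction starts at `n = 2` (`IsWaveletProfile.exists_base_step`). Since only the scales `j ≤ J`
occur, the multiplier of the first layer is `O(ω²)` at the origin, so a triangular low-pass filter
of compact frequency support serves there. Averaging its modulations over a grid with about `2⁻ʲ`
points at the scale `j` gains a term of order `1 / ω` at high frequencies, which dominates the
Gaussian. The result is `exists_cascadeEnergy_le`.

*Processes.* Mean square boundedness and uniform continuity together with joint measurability and
stationarity form a class that is stable under the layers of the cascade
(`IsRegularProcess.norm_conv`); stationarity passes to the layers by discretizing the convolutions.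
Cutting `X` off outside `[-N, N]` gives paths that are almost surely signals, and the cascade of the
cut-off process agrees in mean square with that of `X` far inside the window. Dividing the
deterministic inequality by the length `2 N` and letting `N` tend to infinity gives the inequality
between second moments (`sum_lintegral_sq_le_of_isLocalApprox`).

*Spectral identity.* The periodograms of the centred process show that the transform `R̂` of the
autocovariance is nonnegative. Its integrals against the multipliers `|𝓕 χ|²` of wide Gaussians are
bounded by the variance, so `R̂` is integrable by Fatou's lemma, and Fourier inversion at `0`
identifies its integral with the variance. Parseval's identity for the low-pass filtered process
then gives `IsAdmissibleProcess.integral_sq_sub_integral_conv_sq`.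
-/

/-! ### Second moments and the Fourier transform on `L¹ ∩ L²` -/

theorem lintegral_enorm_sq_eq {α E : Type*} [MeasurableSpace α] {μ : Measure α}
    [NormedAddCommGroup E] (f : α → E) : ∫⁻ x, ‖f x‖ₑ ^ 2 ∂μ = eLpNorm f 2 μ ^ 2 := by
  have := eLpNorm_nnreal_pow_eq_lintegral (μ := μ) (f := f) (p := 2) (by norm_num)
  simpa using this.symm

theorem memLp_two_iff_lintegral {α E : Type*} [MeasurableSpace α] {μ : Measure α}
    [NormedAddCommGroup E] {f : α → E} (hf : AEStronglyMeasurable f μ) :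
    MemLp f 2 μ ↔ ∫⁻ x, ‖f x‖ₑ ^ 2 ∂μ < ∞ := by
  rw [lintegral_enorm_sq_eq, MemLp, and_iff_right hf]
  simp [ENNReal.pow_lt_top_iff]

theorem lintegral_enorm_sq_eq_ofReal {Ω : Type*} [MeasurableSpace Ω] {P : Measure Ω} {x : Ω → ℝ}
    (hx : MemLp x 2 P) : ∫⁻ ω, ‖x ω‖ₑ ^ 2 ∂P = ENNReal.ofReal (∫ ω, x ω ^ 2 ∂P) := by
  rw [ofReal_integral_eq_lintegral_ofReal hx.integrable_sq
    (Filter.Eventually.of_forall fun ω => sq_nonneg _)]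
  refine lintegral_congr fun ω => ?_
  rw [← ofReal_norm, ← ENNReal.ofReal_pow (norm_nonneg _), Real.norm_eq_abs, sq_abs]

/-- Cauchy–Schwarz for the measure with density `k`. -/
theorem sq_lintegral_mul_le {α : Type*} [MeasurableSpace α] {μ : Measure α}
    {k H : α → ℝ≥0∞} (hk : AEMeasurable k μ) (hH : AEMeasurable H μ) :
    (∫⁻ a, k a * H a ∂μ) ^ 2 ≤ (∫⁻ a, k a ∂μ) * ∫⁻ a, k a * H a ^ 2 ∂μ := by
  have hac : μ.withDensity k ≪ μ := withDensity_absolutelyContinuous μ k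
  have h := ENNReal.lintegral_mul_le_Lp_mul_Lq (μ.withDensity k) Real.HolderConjugate.two_two
    (f := fun _ => 1) (g := H) aemeasurable_const (hH.mono_ac hac)
  have e1 : ∫⁻ a, H a ∂(μ.withDensity k) = ∫⁻ a, k a * H a ∂μ := by
    simpa using lintegral_withDensity_eq_lintegral_mul₀ hk hH
  have e2 : ∫⁻ a, H a ^ 2 ∂(μ.withDensity k) = ∫⁻ a, k a * H a ^ 2 ∂μ := by
    simpa using lintegral_withDensity_eq_lintegral_mul₀ hk (hH.pow_const 2)
  have e3 : (μ.withDensity k) Set.univ = ∫⁻ a, k a ∂μ := by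
    simp [withDensity_apply]
  simp only [Pi.mul_apply, one_mul, one_pow, lintegral_one, ENNReal.rpow_two] at h
  rw [e1, e2, e3] at h
  calc _ ≤ _ := pow_le_pow_left₀ (zero_le) h 2
    _ = _ := by
      rw [mul_pow, ← ENNReal.rpow_natCast, ← ENNReal.rpow_natCast, ← ENNReal.rpow_mul,
        ← ENNReal.rpow_mul]
      simp

/-- Minkowski's integral inequality in its weighted `L²` form. -/
theorem lintegral_sq_lintegral_mul_le {α Ω : Type*} [MeasurableSpace α] [MeasurableSpace Ω]
    {μ : Measure α} {P : Measure Ω} [SFinite μ] [SFinite P]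
    {k : α → ℝ≥0∞} {H : α → Ω → ℝ≥0∞} (hk : AEMeasurable k μ)
    (hH : Measurable (Function.uncurry H)) :
    ∫⁻ ω, (∫⁻ a, k a * H a ω ∂μ) ^ 2 ∂P ≤
      (∫⁻ a, k a ∂μ) * ∫⁻ a, k a * ∫⁻ ω, H a ω ^ 2 ∂P ∂μ := by
  calc ∫⁻ ω, (∫⁻ a, k a * H a ω ∂μ) ^ 2 ∂P
      ≤ ∫⁻ ω, (∫⁻ a, k a ∂μ) * ∫⁻ a, k a * H a ω ^ 2 ∂μ ∂P := by
        refine lintegral_mono fun ω => sq_lintegral_mul_le hk ?_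
        exact (hH.comp (measurable_id.prodMk measurable_const)).aemeasurable
    _ ≤ (∫⁻ a, k a ∂μ) * ∫⁻ ω, ∫⁻ a, k a * H a ω ^ 2 ∂μ ∂P := by
        by_cases hT : ∫⁻ a, k a ∂μ = ∞
        · rw [hT]
          by_cases h0 : ∫⁻ ω, ∫⁻ a, k a * H a ω ^ 2 ∂μ ∂P = 0
          · have hk0 : AEMeasurable (fun p : Ω × α => k p.2 * H p.2 p.1 ^ 2) (P.prod μ) :=
              (hk.comp_quasiMeasurePreserving Measure.quasiMeasurePreserving_snd).mul
                ((hH.comp measurable_swap).pow_const 2).aemeasurable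
            have h1 := (lintegral_eq_zero_iff' hk0.lintegral_prod_right').1 h0
            refine le_of_eq_of_le (lintegral_congr_ae (g := 0) ?_) (by simp)
            filter_upwards [h1] with ω hω
            simp only [Pi.zero_apply] at hω ⊢
            rw [hω, mul_zero]
          · rw [ENNReal.top_mul h0]; exact le_top
        · rw [lintegral_const_mul' _ _ hT]
    _ = _ := by
        congr 1
        rw [lintegral_lintegral_swap]
        · refine lintegral_congr fun a => ?_
          rw [lintegral_const_mul]
          exact (hH.comp (measurable_const.prodMk measurable_id)).pow_const 2
        · exact (hk.comp_quasiMeasurePreserving Measure.quasiMeasurePreserving_snd).mul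
                ((hH.comp measurable_swap).pow_const 2).aemeasurable

/-- The `L²` extension of the Fourier transform agrees almost everywhere with the Fourier integral
on `L¹ ∩ L²`: both represent the same tempered distribution. -/
theorem fourier_toLp_ae_eq {f : ℝ → ℂ} (hf : Integrable f) (hf2 : MemLp f 2) :
    (𝓕 (hf2.toLp f) : Lp ℂ 2 (volume : Measure ℝ)) =ᵐ[volume] 𝓕 f := by
  refine ae_eq_of_integral_contDiff_smul_eq
    ((Lp.memLp _).locallyIntegrable (by norm_num)) ?_ ?_
  · exact (VectorFourier.fourierIntegral_continuous Real.continuous_fourierChar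
      (by exact continuous_inner) hf).locallyIntegrable
  · intro g hg hgc
    have h1 : HasCompactSupport (Complex.ofRealCLM ∘ g) := hgc.comp_left rfl
    have h2 : ContDiff ℝ (⊤ : ℕ∞) (Complex.ofRealCLM ∘ g) := by fun_prop
    set G : SchwartzMap ℝ ℂ := h1.toSchwartzMap h2
    have key := congrArg (fun T => T G) (Lp.fourier_toTemperedDistribution_eq (hf2.toLp f))
    simp only [TemperedDistribution.fourier_apply, Lp.toTemperedDistribution_apply] at key
    have e1 : ∫ x, (𝓕 G) x • (hf2.toLp f) x = ∫ x, 𝓕 (G : ℝ → ℂ) x • f x := by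
      refine integral_congr_ae ?_
      filter_upwards [hf2.coeFn_toLp] with x hx
      rw [hx, SchwartzMap.fourier_coe]
    have e2 : ∫ x, 𝓕 (G : ℝ → ℂ) x • f x = ∫ x, G x • 𝓕 f x := by
      simpa using! (VectorFourier.integral_fourierIntegral_smul_eq_flip (L := innerₗ ℝ)
        Real.continuous_fourierChar continuous_inner G.integrable hf)
    rw [e1, e2] at key
    simpa [G] using key.symm

theorem memLp_two_fourier {f : ℝ → ℂ} (hf : Integrable f) (hf2 : MemLp f 2) :
    MemLp (𝓕 f) 2 :=
  (memLp_congr_ae (fourier_toLp_ae_eq hf hf2)).1 (Lp.memLp _)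

/-- Parseval's identity for Fourier integrals. -/
theorem integral_conj_fourier_mul {f g : ℝ → ℂ} (hf : Integrable f) (hf2 : MemLp f 2)
    (hg : Integrable g) (hg2 : MemLp g 2) :
    ∫ x, 𝓕 g x * (starRingEnd ℂ) (𝓕 f x) = ∫ x, g x * (starRingEnd ℂ) (f x) := by
  have h := Lp.inner_fourier_eq (hf2.toLp f) (hg2.toLp g)
  rw [L2.inner_def, L2.inner_def] at h
  refine Eq.trans (integral_congr_ae ?_) (h.trans (integral_congr_ae ?_))
  · filter_upwards [fourier_toLp_ae_eq hf hf2, fourier_toLp_ae_eq hg hg2] with x h1 h2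
    simp [h1, h2]
  · filter_upwards [hf2.coeFn_toLp, hg2.coeFn_toLp] with x h1 h2
    simp [h1, h2]

/-- Plancherel's identity for Fourier integrals. -/
theorem lintegral_enorm_fourier_sq {f : ℝ → ℂ} (hf : Integrable f) (hf2 : MemLp f 2) :
    ∫⁻ x, ‖𝓕 f x‖ₑ ^ 2 = ∫⁻ x, ‖f x‖ₑ ^ 2 := by
  have h : eLpNorm (𝓕 f) 2 volume = eLpNorm f 2 volume := by
    rw [← eLpNorm_congr_ae (fourier_toLp_ae_eq hf hf2), ← eLpNorm_congr_ae hf2.coeFn_toLp]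
    have := Lp.norm_fourier_eq (hf2.toLp f)
    rw [Lp.norm_def, Lp.norm_def] at this
    exact (ENNReal.toReal_eq_toReal_iff' (Lp.memLp _).2.ne (Lp.memLp _).2.ne).1 this
  rw [lintegral_enorm_sq_eq, lintegral_enorm_sq_eq, h]

/-! ### Convolutions and signals -/

theorem conv_apply {E : Type*} [NormedAddCommGroup E] [NormedSpace ℝ E]
    (f : ℝ → ℝ) (g : ℝ → E) (t : ℝ) : conv f g t = ∫ s, f (t - s) • g s :=
  convolution_lsmul_swap

theorem convExistsAt_iff {E : Type*} [NormedAddCommGroup E] [NormedSpace ℝ E]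
    (f : ℝ → ℝ) (g : ℝ → E) (t : ℝ) :
    ConvExistsAt f g t ↔ Integrable (fun s => f (t - s) • g s) :=
  convolutionExistsAt_iff_integrable_swap

theorem conv_eq_mul_convolution (f : ℝ → ℝ) (g : ℝ → ℂ) :
    conv f g = (fun t => (f t : ℂ)) ⋆[ContinuousLinearMap.mul ℂ ℂ, volume] g := by
  ext t
  simp [conv, convolution_def]

/-- Joint measurability, in time and in the random parameter, of a filtered process. -/
theorem stronglyMeasurable_conv {Ω E : Type*} [MeasurableSpace Ω] [NormedAddCommGroup E]
    [NormedSpace ℝ E] {X : ℝ → Ω → ℝ} (hX : Measurable (fun z : ℝ × Ω => X z.1 z.2))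
    {g : ℝ → E} (hg : AEStronglyMeasurable g) :
    StronglyMeasurable (fun z : ℝ × Ω => conv (fun s => X s z.2) g z.1) := by
  have e : ∀ z : ℝ × Ω, conv (fun s => X s z.2) g z.1 =
      ∫ s, X (z.1 - s) z.2 • hg.mk g s := by
    intro z
    rw [conv_apply]
    refine integral_congr_ae ?_
    filter_upwards [hg.ae_eq_mk] with s hs
    rw [hs]
  simp only [e]
  refine StronglyMeasurable.integral_prod_right' (f := fun q : (ℝ × Ω) × ℝ =>
    X (q.1.1 - q.2) q.1.2 • hg.mk g q.2) ?_
  refine StronglyMeasurable.smul (Measurable.stronglyMeasurable ?_)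
    (hg.stronglyMeasurable_mk.comp_measurable measurable_snd)
  exact hX.comp ((measurable_fst.fst.sub measurable_snd).prodMk measurable_fst.snd)

/-- Young's inequality `L² ⋆ L¹ ⊆ L²`. -/
theorem memLp_two_convolution {u v : ℝ → ℂ} (hu : Measurable u) (hu1 : Integrable u)
    (hu2 : MemLp u 2) (hv : Integrable v) :
    MemLp (u ⋆[ContinuousLinearMap.mul ℂ ℂ, volume] v) 2 := by
  rw [memLp_two_iff_lintegral (hu1.integrable_convolution _ hv).aestronglyMeasurable]
  have h := lintegral_sq_lintegral_mul_le (P := (volume : Measure ℝ)) (k := fun s => ‖v s‖ₑ)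
    (H := fun s t => ‖u (t - s)‖ₑ) hv.aestronglyMeasurable.enorm
    (hu.comp (measurable_snd.sub measurable_fst)).enorm
  have e : ∀ s, ∫⁻ t, ‖u (t - s)‖ₑ ^ 2 = ∫⁻ t, ‖u t‖ₑ ^ 2 := fun s =>
    lintegral_sub_right_eq_self (fun t => ‖u t‖ₑ ^ 2) s
  simp only [e] at h
  refine lt_of_le_of_lt (lintegral_mono fun t => ?_) (h.trans_lt ?_)
  · refine pow_le_pow_left₀ zero_le ?_ 2
    rw [convolution_eq_swap]
    refine (enorm_integral_le_lintegral_enorm _).trans (le_of_eq ?_)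
    refine lintegral_congr fun s => ?_
    simp [mul_comm]
  · rw [lintegral_mul_const'' _ hv.aestronglyMeasurable.enorm]
    have h1 : ∫⁻ s, ‖v s‖ₑ < ∞ := hv.2
    have h2 := (memLp_two_iff_lintegral hu2.1).1 hu2
    exact ENNReal.mul_lt_top h1 (ENNReal.mul_lt_top h1 h2)

/-- A real signal that is Borel measurable and belongs to `L¹ ∩ L²`. -/
structure IsSignal (f : ℝ → ℝ) : Prop where
  measurable : Measurable f
  integrable : Integrable f
  memLp_two : MemLp f 2

theorem IsSignal.measurable_conv {f : ℝ → ℝ} (hf : IsSignal f) {g : ℝ → ℂ}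
    (hg : Integrable g) : Measurable (conv f g) :=
  ((stronglyMeasurable_conv (Ω := Unit) (X := fun t _ => f t) (hf.measurable.comp measurable_fst)
    hg.aestronglyMeasurable).comp_measurable
      (measurable_id.prodMk (measurable_const (a := ())))).measurable

theorem IsSignal.integrable_conv {f : ℝ → ℝ} (hf : IsSignal f) {g : ℝ → ℂ}
    (hg : Integrable g) : Integrable (conv f g) := by
  rw [conv_eq_mul_convolution]
  exact hf.integrable.ofReal.integrable_convolution _ hg

theorem IsSignal.memLp_two_conv {f : ℝ → ℝ} (hf : IsSignal f) {g : ℝ → ℂ}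
    (hg : Integrable g) : MemLp (conv f g) 2 := by
  rw [conv_eq_mul_convolution]
  exact memLp_two_convolution (Complex.measurable_ofReal.comp hf.measurable) hf.integrable.ofReal
    hf.memLp_two.ofReal hg

theorem IsSignal.norm_conv {f : ℝ → ℝ} (hf : IsSignal f) {g : ℝ → ℂ}
    (hg : Integrable g) : IsSignal (fun t => ‖conv f g t‖) :=
  ⟨(hf.measurable_conv hg).norm, (hf.integrable_conv hg).norm, (hf.memLp_two_conv hg).norm⟩

theorem IsSignal.fourier_conv {f : ℝ → ℝ} (hf : IsSignal f) {g : ℝ → ℂ}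
    (hg : Integrable g) (ω : ℝ) : 𝓕 (conv f g) ω = fourierReal f ω * 𝓕 g ω := by
  have hf' : Integrable (fun t => (f t : ℂ)) := hf.integrable.ofReal
  rw [conv_eq_mul_convolution, Real.fourier_mul_convolution_eq hf' hg]
  rfl

/-! ### Modulations and the modulus -/

theorem fourier_modulation (φ : ℝ → ℂ) (η ω : ℝ) :
    𝓕 (fun t => Real.fourierChar (t * η) • φ t) ω = 𝓕 φ (ω - η) := by
  rw [Real.fourier_real_eq, Real.fourier_real_eq]
  refine integral_congr_ae (Filter.Eventually.of_forall fun t => ?_)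
  simp only [smul_smul]
  rw [← AddChar.map_add_eq_mul]
  ring_nf

theorem continuous_fourier {f : ℝ → ℂ} (hf : Integrable f) : Continuous (𝓕 f) :=
  VectorFourier.fourierIntegral_continuous Real.continuous_fourierChar
      (by exact continuous_inner) hf

theorem norm_fourierReal_neg (f : ℝ → ℝ) (ω : ℝ) : ‖fourierReal f (-ω)‖ = ‖fourierReal f ω‖ := by
  have : fourierReal f (-ω) = starRingEnd ℂ (fourierReal f ω) := by
    rw [fourierReal, Real.fourier_real_eq, Real.fourier_real_eq, ← integral_conj]
    refine integral_congr_ae (Filter.Eventually.of_forall fun t => ?_)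
    simp [Circle.smul_def, Real.fourierChar_apply, ← Complex.exp_conj, Complex.conj_ofNat]
  rw [this, RCLike.norm_conj]

/-- Taking the modulus moves energy towards the frequency zero: for a nonnegative low-pass filter
`φ`, filtering `|h|` by `φ` retains at least the energy of `h` filtered by any modulation of `φ`. -/
theorem lintegral_fourier_modulus_ge {h : ℝ → ℂ} (hm : Measurable h) (h1 : Integrable h)
    (h2 : MemLp h 2) {φ : ℝ → ℝ} (hφ : Integrable φ) (hφ0 : ∀ t, 0 ≤ φ t) (η : ℝ) :
    ∫⁻ ω, ‖𝓕 h ω‖ₑ ^ 2 * ‖fourierReal φ (ω - η)‖ₑ ^ 2 ≤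
      ∫⁻ ω, ‖fourierReal (fun t => ‖h t‖) ω‖ₑ ^ 2 * ‖fourierReal φ ω‖ₑ ^ 2 := by
  have hφc : Integrable (fun t => (φ t : ℂ)) := hφ.ofReal
  set φη : ℝ → ℂ := fun t => Real.fourierChar (t * η) • (φ t : ℂ)
  have hφη : Integrable φη := by
    refine Integrable.mono' hφ.norm ?_ (Filter.Eventually.of_forall fun t => by simp [φη])
    exact (Continuous.aestronglyMeasurable (by fun_prop)).smul
      hφc.aestronglyMeasurable
  have hmod : IsSignal (fun t => ‖h t‖) := ⟨hm.norm, h1.norm, h2.norm⟩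
  have e1 : ∫⁻ ω, ‖𝓕 h ω‖ₑ ^ 2 * ‖fourierReal φ (ω - η)‖ₑ ^ 2 =
      ∫⁻ t, ‖(h ⋆[ContinuousLinearMap.mul ℂ ℂ, volume] φη) t‖ₑ ^ 2 := by
    rw [← lintegral_enorm_fourier_sq (h1.integrable_convolution _ hφη)
      (memLp_two_convolution hm h1 h2 hφη)]
    refine lintegral_congr fun ω => ?_
    rw [Real.fourier_mul_convolution_eq h1 hφη, fourier_modulation, enorm_mul, mul_pow]
    rfl
  have e2 : ∫⁻ ω, ‖fourierReal (fun t => ‖h t‖) ω‖ₑ ^ 2 * ‖fourierReal φ ω‖ₑ ^ 2 =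
      ∫⁻ t, ‖conv (fun t => ‖h t‖) (fun t => (φ t : ℂ)) t‖ₑ ^ 2 := by
    rw [← lintegral_enorm_fourier_sq (hmod.integrable_conv hφc)
      (hmod.memLp_two_conv hφc)]
    refine lintegral_congr fun ω => ?_
    rw [hmod.fourier_conv hφc, enorm_mul, mul_pow]
    rfl
  -- after Plancherel the inequality holds pointwise in time
  rw [e1, e2]
  refine lintegral_mono fun t => pow_le_pow_left₀ zero_le ?_ 2
  rw [enorm_le_iff_norm_le, convolution_eq_swap, conv_apply]
  calc _ ≤ ∫ s, ‖h (t - s)‖ * φ s := by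
        refine (norm_integral_le_integral_norm _).trans (le_of_eq ?_)
        refine integral_congr_ae (Filter.Eventually.of_forall fun s => ?_)
        simp [φη, abs_of_nonneg (hφ0 s)]
    _ = ‖((∫ s, ‖h (t - s)‖ * φ s : ℝ) : ℂ)‖ := by
        rw [Complex.norm_real, Real.norm_of_nonneg]
        exact integral_nonneg fun s => mul_nonneg (norm_nonneg _) (hφ0 s)
    _ = _ := by
        rw [← integral_complex_ofReal]
        simp

/-! ### Gaussian and triangular low-pass filters -/

theorem fourierReal_gaussFilter {a : ℝ} (ha : 0 < a) (ω : ℝ) :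
    fourierReal (gaussFilter a) ω = (Real.exp (-(ω / a) ^ 2) : ℝ) := by
  have hb : 0 < ((Real.pi * a ^ 2 : ℝ) : ℂ).re := by
    rw [Complex.ofReal_re]; positivity
  have hs : ((Real.pi * a ^ 2 : ℝ) : ℂ) ^ (1 / 2 : ℂ) = ((√Real.pi * a : ℝ) : ℂ) := by
    have : (1 / 2 : ℂ) = ((1 / 2 : ℝ) : ℂ) := by push_cast; rfl
    rw [this, ← Complex.ofReal_cpow (by positivity), ← Real.sqrt_eq_rpow,
      Real.sqrt_mul Real.pi_pos.le, Real.sqrt_sq ha.le]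
  have h := congrFun (fourier_gaussian_pi hb) ω
  have e : (fun t => (gaussFilter a t : ℂ)) = fun t : ℝ => ((√Real.pi * a : ℝ) : ℂ) •
      Complex.exp (-Real.pi * ((Real.pi * a ^ 2 : ℝ) : ℂ) * t ^ 2) := by
    ext t
    simp only [gaussFilter, smul_eq_mul]
    push_cast
    ring_nf
  have h0 : ((√Real.pi * a : ℝ) : ℂ) ≠ 0 := by
    rw [Complex.ofReal_ne_zero]; positivity
  rw [fourierReal, e, Real.fourier_real_eq]
  simp_rw [smul_comm _ (((√Real.pi * a : ℝ) : ℂ)), integral_smul]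
  rw [← Real.fourier_real_eq, h, hs, smul_eq_mul, ← mul_assoc, mul_one_div_cancel h0, one_mul]
  push_cast
  congr 1
  have : (a : ℂ) ≠ 0 := by exact_mod_cast ha.ne'
  have : (Real.pi : ℂ) ≠ 0 := by exact_mod_cast Real.pi_ne_zero
  field_simp

theorem norm_fourierReal_gaussFilter_sq {a : ℝ} (ha : 0 < a) (ω : ℝ) :
    ‖fourierReal (gaussFilter a) ω‖ ^ 2 = Real.exp (-(2 * ω ^ 2 / a ^ 2)) := by
  rw [fourierReal_gaussFilter ha, Complex.norm_real, Real.norm_of_nonneg (Real.exp_pos _).le,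
    ← Real.exp_nat_mul]
  congr 1
  push_cast
  ring

theorem integrable_gaussFilter {a : ℝ} (ha : 0 < a) : Integrable (gaussFilter a) := by
  have : Integrable fun t : ℝ => Real.exp (-(Real.pi * a) ^ 2 * t ^ 2) :=
    integrable_exp_neg_mul_sq (by positivity)
  exact this.const_mul _

theorem gaussFilter_nonneg {a : ℝ} (ha : 0 < a) (t : ℝ) : 0 ≤ gaussFilter a t := by
  unfold gaussFilter; positivity

theorem fourier_translate (f : ℝ → ℂ) (v w : ℝ) :
    𝓕 (fun t => f (t - v)) w = Real.fourierChar (-(v * w)) • 𝓕 f w := by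
  have := congrFun (VectorFourier.fourierIntegral_comp_add_right Real.fourierChar volume
    (innerₗ ℝ) f (-v)) w
  simp only [Function.comp_def, ← sub_eq_add_neg] at this
  refine Eq.trans ?_ (this.trans ?_)
  · rfl
  · simp [mul_comm]; rfl

/-- Autocorrelation: the Fourier transform of `|𝓕 θ|²`. -/
theorem fourier_norm_sq_fourier {θ : ℝ → ℂ} (h1 : Integrable θ) (h2 : MemLp θ 2) (ω : ℝ) :
    𝓕 (fun t => ((‖𝓕 θ t‖ ^ 2 : ℝ) : ℂ)) ω = ∫ s, θ (s - ω) * (starRingEnd ℂ) (θ s) := by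
  rw [← integral_conj_fourier_mul h1 h2 (h1.comp_sub_right ω)
    (h2.comp_measurePreserving (measurePreserving_sub_right volume ω)), Real.fourier_real_eq]
  refine integral_congr_ae (Filter.Eventually.of_forall fun t => ?_)
  simp only [fourier_translate]
  rw [smul_mul_assoc, Complex.mul_conj, Complex.normSq_eq_norm_sq, mul_comm]

/-- The autocorrelation of the indicator of `[0, c]` is a triangle. -/
theorem integral_indicator_Icc_autocorrelation {c : ℝ} (ω : ℝ) :
    ∫ s, (Set.Icc 0 c).indicator (fun _ => (1 : ℂ)) (s - ω) *
      (starRingEnd ℂ) ((Set.Icc 0 c).indicator (fun _ => (1 : ℂ)) s) =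
      ((max 0 (c - |ω|) : ℝ) : ℂ) := by
  have e : (fun s => (Set.Icc 0 c).indicator (fun _ => (1 : ℂ)) (s - ω) *
      (starRingEnd ℂ) ((Set.Icc 0 c).indicator (fun _ => (1 : ℂ)) s)) =
      (Set.Icc (max 0 ω) (min c (c + ω))).indicator (fun _ => (1 : ℂ)) := by
    ext s
    simp only [Set.indicator_apply, Set.mem_Icc, max_le_iff, le_min_iff]
    split_ifs with h1 h2 h3 h3 h3 h3 <;> simp
    all_goals (exfalso; grind)
  rw [e, integral_indicator measurableSet_Icc]
  simp only [integral_const, MeasurableSet.univ, measureReal_restrict_apply, Set.univ_inter,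
    Real.volume_real_Icc, Complex.real_smul, mul_one]
  congr 1
  grind

/-- A nonnegative integrable kernel whose Fourier transform is a triangle supported in `[-c, c]`. -/
theorem exists_triangle_kernel {c : ℝ} (hc : 0 < c) :
    ∃ φ : ℝ → ℝ, Integrable φ ∧ (∀ t, 0 ≤ φ t) ∧
      ∀ ω, fourierReal φ ω = ((max 0 (c - |ω|) / (2 * c) : ℝ) : ℂ) := by
  set θ : ℝ → ℂ := (Set.Icc 0 c).indicator (fun _ => (1 : ℂ))
  have h1 : Integrable θ := (integrable_indicator_iff measurableSet_Icc).2 (by simp)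
  have h2 : MemLp θ 2 := memLp_indicator_const 2 measurableSet_Icc 1 (Or.inr (by simp))
  refine ⟨fun t => ‖𝓕 θ t‖ ^ 2 / (2 * c), ?_, fun t => by positivity, fun ω => ?_⟩
  · exact ((memLp_two_fourier h1 h2).integrable_norm_pow (by norm_num)).div_const _
  · have h := fourier_norm_sq_fourier h1 h2 ω
    rw [integral_indicator_Icc_autocorrelation] at h
    rw [Complex.ofReal_div, ← h, fourierReal, Real.fourier_real_eq, Real.fourier_real_eq,
      ← integral_div]
    refine integral_congr_ae (Filter.Eventually.of_forall fun t => ?_)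
    simp only [Circle.smul_def, smul_eq_mul]
    push_cast
    ring

/-! ### Littlewood–Paley sums -/

theorem exists_zpow_neg_mul_mem_Icc {ω : ℝ} (hω : 0 < ω) :
    ∃ m : ℤ, 2 ^ (-m) * ω ∈ Set.Icc (1 : ℝ) 2 := by
  obtain ⟨m, hm1, hm2⟩ := exists_mem_Ico_zpow hω (one_lt_two)
  have hp : (0 : ℝ) < 2 ^ m := by positivity
  refine ⟨m, ?_⟩
  rw [zpow_neg, Set.mem_Icc, ← div_eq_inv_mul, le_div_iff₀ hp, div_le_iff₀ hp]
  rw [zpow_add₀ two_ne_zero, zpow_one] at hm2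
  constructor <;> linarith

/-- The properties of `b = |ψ̂|²` on which the scattering decay rests: continuity, the
Littlewood–Paley bound, the (somewhere strict) predominance of positive frequencies, and a decay
at the origin that is faster than quadratic. -/
structure IsWaveletProfile (b : ℝ → ℝ) : Prop where
  continuous : Continuous b
  nonneg : ∀ u, 0 ≤ b u
  tsum_le : ∀ ω, ∑' j : ℤ, (ENNReal.ofReal (b (2 ^ j * ω)) + ENNReal.ofReal (b (-(2 ^ j * ω)))) ≤ 2
  neg_le : ∀ u, 0 < u → b (-u) ≤ b u
  exists_lt : ∀ ω, 0 < ω → ∃ j : ℤ, b (-(2 ^ j * ω)) < b (2 ^ j * ω)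
  decay : ∃ ε C : ℝ, 0 < ε ∧ 0 < C ∧ ∀ u, |u| ≤ 1 → b u ≤ C * u ^ 2 * |u| ^ ε

namespace IsWaveletProfile

variable {b : ℝ → ℝ}

/-- By compactness of a fundamental domain of the dyadic dilations, the strict predominance of
positive frequencies is uniform. -/
theorem exists_uniform_gap (hb : IsWaveletProfile b) :
    ∃ κ K : ℝ, 0 < κ ∧ 1 ≤ K ∧ ∀ ω, 0 < ω →
      ∃ j : ℤ, K⁻¹ ≤ 2 ^ j * ω ∧ 2 ^ j * ω ≤ K ∧ κ ≤ b (2 ^ j * ω) - b (-(2 ^ j * ω)) := by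
  have hcpt : ∃ κ K : ℝ, 0 < κ ∧ 1 ≤ K ∧ ∀ ω ∈ Set.Icc (1 : ℝ) 2,
      ∃ j : ℤ, K⁻¹ ≤ 2 ^ j * ω ∧ 2 ^ j * ω ≤ K ∧ κ ≤ b (2 ^ j * ω) - b (-(2 ^ j * ω)) := by
    refine isCompact_Icc.induction_on (p := fun S => ∃ κ K : ℝ, 0 < κ ∧ 1 ≤ K ∧ ∀ ω ∈ S,
      ∃ j : ℤ, K⁻¹ ≤ 2 ^ j * ω ∧ 2 ^ j * ω ≤ K ∧ κ ≤ b (2 ^ j * ω) - b (-(2 ^ j * ω)))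
      ⟨1, 1, one_pos, le_rfl, by simp⟩ ?_ ?_ ?_
    · rintro S T hST ⟨κ, K, h1, h2, h⟩
      exact ⟨κ, K, h1, h2, fun ω hω => h ω (hST hω)⟩
    · rintro S T ⟨κ, K, h1, h2, h⟩ ⟨κ', K', h1', h2', h'⟩
      refine ⟨min κ κ', max K K', lt_min h1 h1', h2.trans (le_max_left _ _), ?_⟩
      rintro ω (hω | hω)
      · obtain ⟨j, hj1, hj2, hj3⟩ := h ω hω
        refine ⟨j, le_trans ?_ hj1, hj2.trans (le_max_left _ _), (min_le_left _ _).trans hj3⟩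
        exact inv_anti₀ (by linarith) (le_max_left _ _)
      · obtain ⟨j, hj1, hj2, hj3⟩ := h' ω hω
        refine ⟨j, le_trans ?_ hj1, hj2.trans (le_max_right _ _), (min_le_right _ _).trans hj3⟩
        exact inv_anti₀ (by linarith) (le_max_right _ _)
    · -- near a single frequency, continuity turns strictness into half of the gap
      intro x hx
      obtain ⟨j, hj⟩ := hb.exists_lt x (by linarith [hx.1])
      have hcont : Continuous fun ω => b (2 ^ j * ω) - b (-(2 ^ j * ω)) :=
        (hb.continuous.comp (by fun_prop)).sub (hb.continuous.comp (by fun_prop))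
      have hev : ∀ᶠ ω in 𝓝 x, (b (2 ^ j * x) - b (-(2 ^ j * x))) / 2 <
          b (2 ^ j * ω) - b (-(2 ^ j * ω)) :=
        hcont.continuousAt.eventually (lt_mem_nhds (by linarith))
      have h2 : (0 : ℝ) < 2 ^ j := by positivity
      refine ⟨_, inter_mem_nhdsWithin _ hev, (b (2 ^ j * x) - b (-(2 ^ j * x))) / 2,
        max (2 ^ j * 2) (2 ^ j)⁻¹ + 1, by linarith, ?_, ?_⟩
      · have : (0 : ℝ) < 2 ^ j * 2 := by positivity
        linarith [le_max_left ((2 : ℝ) ^ j * 2) (2 ^ j)⁻¹]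
      · rintro ω ⟨hω, hω'⟩
        refine ⟨j, ?_, ?_, le_of_lt hω'⟩
        · refine (inv_anti₀ (b := (2 ^ j)⁻¹) (by positivity) ?_).trans ?_
          · linarith [le_max_right ((2 : ℝ) ^ j * 2) (2 ^ j)⁻¹]
          · rw [inv_inv]; nlinarith [hω.1]
        · have : (2 : ℝ) ^ j * ω ≤ 2 ^ j * 2 := by nlinarith [hω.2]
          linarith [le_max_left ((2 : ℝ) ^ j * 2) (2 ^ j)⁻¹]
  obtain ⟨κ, K, h1, h2, h⟩ := hcpt
  refine ⟨κ, K, h1, h2, fun ω hω => ?_⟩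
  obtain ⟨m, hmem⟩ := exists_zpow_neg_mul_mem_Icc hω
  obtain ⟨j, hj⟩ := h _ hmem
  refine ⟨j + -m, ?_⟩
  rw [zpow_add₀ two_ne_zero, mul_assoc]
  exact hj

theorem summable (hb : IsWaveletProfile b) (ω : ℝ) :
    Summable fun j : ℤ => b (2 ^ j * ω) + b (-(2 ^ j * ω)) := by
  have h : ∑' j : ℤ, ENNReal.ofReal (b (2 ^ j * ω) + b (-(2 ^ j * ω))) ≤ 2 := by
    simpa only [ENNReal.ofReal_add (hb.nonneg _) (hb.nonneg _)] using hb.tsum_le ω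
  have := ENNReal.summable_toReal (h.trans_lt (by norm_num)).ne
  simpa only [ENNReal.toReal_ofReal (add_nonneg (hb.nonneg _) (hb.nonneg _))] using this

theorem tsum_real_le (hb : IsWaveletProfile b) (ω : ℝ) :
    ∑' j : ℤ, (b (2 ^ j * ω) + b (-(2 ^ j * ω))) ≤ 2 := by
  have h : ∑' j : ℤ, ENNReal.ofReal (b (2 ^ j * ω) + b (-(2 ^ j * ω))) ≤ 2 := by
    simpa only [ENNReal.ofReal_add (hb.nonneg _) (hb.nonneg _)] using hb.tsum_le ω
  rw [← ENNReal.ofReal_tsum_of_nonneg (fun j => add_nonneg (hb.nonneg _) (hb.nonneg _))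
    (hb.summable ω)] at h
  exact (ENNReal.ofReal_le_ofReal_iff (by norm_num)).1 (by simpa using h)

/-- The second moments `∑ⱼ (b(uⱼ) + b(-uⱼ)) / uⱼ²`, `uⱼ = 2ʲ ω`, are bounded: the decay of `b` at
the origin controls the small `uⱼ` and the Littlewood–Paley bound the large ones. -/
theorem exists_second_moment_bound (hb : IsWaveletProfile b) :
    ∃ C : ℝ, 1 ≤ C ∧ ∀ ω, 0 < ω →
      Summable (fun j : ℤ => (b (2 ^ j * ω) + b (-(2 ^ j * ω))) / (2 ^ j * ω) ^ 2) ∧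
      ∑' j : ℤ, (b (2 ^ j * ω) + b (-(2 ^ j * ω))) / (2 ^ j * ω) ^ 2 ≤ C := by
  obtain ⟨ε, C, hε, hC, hdec⟩ := hb.decay
  set q : ℝ := 2 ^ (-ε)
  have hq0 : 0 < q := by positivity
  have hq1 : q < 1 := Real.rpow_lt_one_of_one_lt_of_neg one_lt_two (by linarith)
  have hqs : Summable fun j : ℤ => q ^ j.natAbs :=
    Summable.of_nat_of_neg (by simpa using summable_geometric_of_lt_one hq0.le hq1)
      (by simpa using summable_geometric_of_lt_one hq0.le hq1)
  -- the sums are invariant under `ω ↦ 2 ω`, so that it suffices to consider `ω ∈ [1, 2]`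
  have main : ∀ ω ∈ Set.Icc (1 : ℝ) 2, ∀ j : ℤ,
      (b (2 ^ j * ω) + b (-(2 ^ j * ω))) / (2 ^ j * ω) ^ 2 ≤
        (b (2 ^ j * ω) + b (-(2 ^ j * ω))) + 2 * C * q⁻¹ * q ^ j.natAbs := by
    intro ω hω j
    have hu : 0 < 2 ^ j * ω := mul_pos (by positivity) (by linarith [hω.1])
    have hs : 0 ≤ b (2 ^ j * ω) + b (-(2 ^ j * ω)) := add_nonneg (hb.nonneg _) (hb.nonneg _)
    rcases le_or_gt 0 j with hj | hj
    · have h1 : 1 ≤ 2 ^ j * ω := by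
        have : (1 : ℝ) ≤ 2 ^ j := one_le_zpow₀ one_le_two hj
        nlinarith [hω.1]
      refine (div_le_self hs (by nlinarith)).trans ?_
      have : 0 ≤ 2 * C * q⁻¹ * q ^ j.natAbs := by positivity
      linarith
    · have h2 : 2 ^ j * ω ≤ (2 : ℝ) ^ (j + 1) := by
        rw [zpow_add₀ two_ne_zero, zpow_one]
        exact mul_le_mul_of_nonneg_left hω.2 (by positivity)
      have h3 : (2 : ℝ) ^ (j + 1) ≤ 1 := zpow_le_one_of_nonpos₀ one_le_two (by omega)
      have hb1 := hdec (2 ^ j * ω) (by rw [abs_of_pos hu]; linarith)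
      have hb2 := hdec (-(2 ^ j * ω)) (by rw [abs_neg, abs_of_pos hu]; linarith)
      rw [abs_neg, neg_sq] at hb2
      rw [abs_of_pos hu] at hb1 hb2
      have h4 : (2 ^ j * ω) ^ ε ≤ q⁻¹ * q ^ j.natAbs := by
        refine (Real.rpow_le_rpow hu.le h2 hε.le).trans (le_of_eq ?_)
        have hn : (j.natAbs : ℝ) = -(j : ℝ) := by
          rw [Nat.cast_natAbs, abs_of_neg hj, Int.cast_neg]
        rw [← Real.rpow_intCast, ← Real.rpow_mul zero_le_two, ← Real.rpow_neg_one q,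
          ← Real.rpow_natCast, ← Real.rpow_mul zero_le_two, ← Real.rpow_mul zero_le_two,
          ← Real.rpow_add two_pos, hn]
        push_cast
        ring_nf
      have h5 : (b (2 ^ j * ω) + b (-(2 ^ j * ω))) / (2 ^ j * ω) ^ 2 ≤ 2 * C * (2 ^ j * ω) ^ ε := by
        rw [div_le_iff₀ (by positivity)]; linarith
      nlinarith
  have hsum : ∀ ω ∈ Set.Icc (1 : ℝ) 2,
      Summable (fun j : ℤ => (b (2 ^ j * ω) + b (-(2 ^ j * ω))) / (2 ^ j * ω) ^ 2) ∧
      ∑' j : ℤ, (b (2 ^ j * ω) + b (-(2 ^ j * ω))) / (2 ^ j * ω) ^ 2 ≤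
        2 + 2 * C * q⁻¹ * ∑' j : ℤ, q ^ j.natAbs := by
    intro ω hω
    have hS := (hb.summable ω).add (hqs.mul_left (2 * C * q⁻¹))
    have hS' := Summable.of_nonneg_of_le
      (fun j => div_nonneg (add_nonneg (hb.nonneg _) (hb.nonneg _)) (sq_nonneg _)) (main ω hω) hS
    refine ⟨hS', (hS'.tsum_le_tsum (main ω hω) hS).trans ?_⟩
    rw [(hb.summable ω).tsum_add (hqs.mul_left _), tsum_mul_left]
    linarith [hb.tsum_real_le ω]
  refine ⟨2 + 2 * C * q⁻¹ * ∑' j : ℤ, q ^ j.natAbs, ?_, fun ω hω => ?_⟩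
  · have : 0 ≤ 2 * C * q⁻¹ * ∑' j : ℤ, q ^ j.natAbs :=
      mul_nonneg (by positivity) (tsum_nonneg fun j => by positivity)
    linarith
  · obtain ⟨m, hmem⟩ := exists_zpow_neg_mul_mem_Icc hω
    have h := hsum _ hmem
    have e : (fun j : ℤ => (b (2 ^ j * (2 ^ (-m) * ω)) + b (-(2 ^ j * (2 ^ (-m) * ω)))) /
        (2 ^ j * (2 ^ (-m) * ω)) ^ 2) = (fun j : ℤ => (b (2 ^ j * ω) + b (-(2 ^ j * ω))) /
        (2 ^ j * ω) ^ 2) ∘ (Equiv.subRight m) := by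
      ext j
      have : (2 : ℝ) ^ j * (2 ^ (-m) * ω) = 2 ^ (j - m) * ω := by
        rw [← mul_assoc, ← zpow_add₀ two_ne_zero, sub_eq_add_neg]
      simp only [this, Function.comp_apply, Equiv.subRight_apply]
    rw [e, Equiv.summable_iff] at h
    refine ⟨h.1, le_of_eq_of_le ?_ h.2⟩
    exact ((Equiv.subRight m).tsum_eq
      (fun j : ℤ => (b (2 ^ j * ω) + b (-(2 ^ j * ω))) / (2 ^ j * ω) ^ 2)).symm

end IsWaveletProfile

/-! ### The multiplier inequality for Gaussian filters -/

theorem le_of_even_of_forall_pos {F G : ℝ → ℝ≥0∞} (hF : ∀ ω, F (-ω) = F ω) (hG : ∀ ω, G (-ω) = G ω)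
    (h : ∀ ω, 0 < ω → F ω ≤ G ω) {ω : ℝ} (hω : ω ≠ 0) : F ω ≤ G ω := by
  rcases lt_or_gt_of_ne hω with h0 | h0
  · rw [← hF, ← hG]; exact h _ (by linarith)
  · exact h _ h0

namespace IsWaveletProfile

variable {b : ℝ → ℝ}

/-- With centre frequencies `δ 2⁻ʲ`, the mean square distance of `ω` to the centre frequencies,
weighted by the Littlewood–Paley weights, is smaller than `ω²` by a fixed factor. -/
theorem exists_variance_bound (hb : IsWaveletProfile b) :
    ∃ δ a : ℝ, 0 < δ ∧ 1 < a ∧ ∀ ω, 0 < ω →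
      Summable (fun j : ℤ => b (2 ^ j * ω) * (1 - δ / (2 ^ j * ω)) ^ 2 +
        b (-(2 ^ j * ω)) * (1 + δ / (2 ^ j * ω)) ^ 2) ∧
      ∑' j : ℤ, (b (2 ^ j * ω) * (1 - δ / (2 ^ j * ω)) ^ 2 +
        b (-(2 ^ j * ω)) * (1 + δ / (2 ^ j * ω)) ^ 2) ≤ 2 / a ^ 2 := by
  obtain ⟨κ, K, hκ, hK, hgap⟩ := hb.exists_uniform_gap
  obtain ⟨C, hC, hsec⟩ := hb.exists_second_moment_bound
  set γ : ℝ := min (κ / K) 1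
  have hγ0 : 0 < γ := lt_min (by positivity) one_pos
  have hγ1 : γ ≤ 1 := min_le_right _ _
  have hC0 : 0 < C := by linarith
  have hθ : 0 < 1 - γ ^ 2 / (2 * C) := by
    rw [sub_pos, div_lt_one (by positivity)]; nlinarith
  have hθ1 : 1 - γ ^ 2 / (2 * C) < 1 := by
    have : 0 < γ ^ 2 / (2 * C) := by positivity
    linarith
  -- `δ = γ / C` minimizes the bound `2 - 2 δ γ + δ² C` of the sum
  refine ⟨γ / C, (√(1 - γ ^ 2 / (2 * C)))⁻¹, by positivity, ?_, fun ω hω => ?_⟩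
  · refine (one_lt_inv₀ (Real.sqrt_pos.2 hθ)).2 ?_
    rw [Real.sqrt_lt' one_pos]; simpa using hθ1
  have hu : ∀ j : ℤ, 0 < 2 ^ j * ω := fun j => by positivity
  have hS := hb.summable ω
  obtain ⟨hS2, hS2C⟩ := hsec ω hω
  have hd0 : ∀ j : ℤ, 0 ≤ (b (2 ^ j * ω) - b (-(2 ^ j * ω))) / (2 ^ j * ω) := fun j =>
    div_nonneg (sub_nonneg.2 (hb.neg_le _ (hu j))) (hu j).le
  have hS1 : Summable fun j : ℤ => (b (2 ^ j * ω) - b (-(2 ^ j * ω))) / (2 ^ j * ω) := by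
    refine Summable.of_nonneg_of_le hd0 (fun j => ?_) (hS.add hS2)
    set u := 2 ^ j * ω with hudef
    have hup : 0 < u := hu j
    have h1 : 1 / u ≤ 1 + 1 / u ^ 2 := by
      rw [← one_div_pow]
      nlinarith [sq_nonneg (1 / u - 1), sq_nonneg (1 / u)]
    calc (b u - b (-u)) / u ≤ (b u + b (-u)) * (1 / u) := by
          rw [div_eq_mul_one_div]
          exact mul_le_mul_of_nonneg_right (by linarith [hb.nonneg (-u)]) (by positivity)
      _ ≤ (b u + b (-u)) * (1 + 1 / u ^ 2) :=
          mul_le_mul_of_nonneg_left h1 (add_nonneg (hb.nonneg _) (hb.nonneg _))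
      _ = _ := by ring
  have hS1κ : γ ≤ ∑' j : ℤ, (b (2 ^ j * ω) - b (-(2 ^ j * ω))) / (2 ^ j * ω) := by
    obtain ⟨j, -, hj2, hj3⟩ := hgap ω hω
    refine le_trans ?_ (hS1.le_tsum j fun i _ => hd0 i)
    refine (min_le_left _ _).trans ?_
    exact div_le_div₀ (hκ.le.trans hj3) hj3 (hu j) hj2
  have e : (fun j : ℤ => b (2 ^ j * ω) * (1 - γ / C / (2 ^ j * ω)) ^ 2 +
        b (-(2 ^ j * ω)) * (1 + γ / C / (2 ^ j * ω)) ^ 2) = fun j : ℤ =>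
      (b (2 ^ j * ω) + b (-(2 ^ j * ω))) -
        2 * (γ / C) * ((b (2 ^ j * ω) - b (-(2 ^ j * ω))) / (2 ^ j * ω)) +
        (γ / C) ^ 2 * ((b (2 ^ j * ω) + b (-(2 ^ j * ω))) / (2 ^ j * ω) ^ 2) := by
    ext j
    have := (hu j).ne'
    field_simp
    ring
  rw [e]
  refine ⟨(hS.sub (hS1.mul_left _)).add (hS2.mul_left _), ?_⟩
  rw [(hS.sub (hS1.mul_left _)).tsum_add (hS2.mul_left _), hS.tsum_sub (hS1.mul_left _),
    tsum_mul_left, tsum_mul_left, inv_pow, Real.sq_sqrt hθ.le]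
  have h1 : 2 * (γ / C) * γ ≤ 2 * (γ / C) *
      ∑' j : ℤ, (b (2 ^ j * ω) - b (-(2 ^ j * ω))) / (2 ^ j * ω) :=
    mul_le_mul_of_nonneg_left hS1κ (by positivity)
  have h2 : (γ / C) ^ 2 * ∑' j : ℤ, (b (2 ^ j * ω) + b (-(2 ^ j * ω))) / (2 ^ j * ω) ^ 2 ≤
      (γ / C) ^ 2 * C := mul_le_mul_of_nonneg_left hS2C (by positivity)
  have h3 := hb.tsum_real_le ω
  have h4 : 2 / (1 - γ ^ 2 / (2 * C))⁻¹ = 2 - 2 * (γ / C) * γ + (γ / C) ^ 2 * C := by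
    rw [div_inv_eq_mul]
    field_simp
    ring
  rw [h4]
  linarith

/-- The multiplier inequality behind the induction on the length of the paths: filtering by
Gaussians centred at the frequencies `δ 2⁻ʲ` after the wavelets costs at most a Gaussian low-pass
filter that is wider by the factor `a`. -/
theorem exists_gaussian_step (hb : IsWaveletProfile b) :
    ∃ δ a : ℝ, 1 < a ∧ ∀ x, 0 < x → ∀ ω, ω ≠ 0 →
      ∑' j : ℤ, (ENNReal.ofReal (b (2 ^ j * ω) *
          (1 - Real.exp (-(2 * (ω - δ * 2 ^ (-j)) ^ 2 / x ^ 2)))) +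
        ENNReal.ofReal (b (-(2 ^ j * ω)) *
          (1 - Real.exp (-(2 * (-ω - δ * 2 ^ (-j)) ^ 2 / x ^ 2))))) ≤
      2 * ENNReal.ofReal (1 - Real.exp (-(2 * ω ^ 2 / (x * a) ^ 2))) := by
  obtain ⟨δ, a, hδ, ha, hvar⟩ := hb.exists_variance_bound
  refine ⟨δ, a, ha, fun x hx ω hω => ?_⟩
  refine le_of_even_of_forall_pos (F := fun ω => ∑' j : ℤ, (ENNReal.ofReal (b (2 ^ j * ω) *
          (1 - Real.exp (-(2 * (ω - δ * 2 ^ (-j)) ^ 2 / x ^ 2)))) +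
        ENNReal.ofReal (b (-(2 ^ j * ω)) *
          (1 - Real.exp (-(2 * (-ω - δ * 2 ^ (-j)) ^ 2 / x ^ 2))))))
      (G := fun ω => 2 * ENNReal.ofReal (1 - Real.exp (-(2 * ω ^ 2 / (x * a) ^ 2))))
      (fun ω => ?_) (fun ω => ?_) (fun ω hω => ?_) hω
  · refine tsum_congr fun j => ?_
    rw [mul_neg, neg_neg, neg_neg, add_comm]
  · simp only [neg_sq]
  obtain ⟨hq, hqle⟩ := hvar ω hω
  have hs := hb.summable ω
  set v : ℝ := 2 * ω ^ 2 / (x * a) ^ 2 with hv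
  have hv0 : 0 ≤ v := by positivity
  set B : ℝ := Real.exp (-v)
  have hB : 0 < B := Real.exp_pos _
  have hA : 0 ≤ 1 - B - v * B := by
    have h1 : B * Real.exp v = 1 := by rw [← Real.exp_add]; simp
    nlinarith [Real.add_one_le_exp v]
  -- the tangent line to the concave function `1 - exp (-u)` at `v`
  have htan : ∀ u : ℝ, 1 - Real.exp (-u) ≤ (1 - B - v * B) + B * u := by
    intro u
    have h1 : Real.exp (-u) = B * Real.exp (v - u) := by
      rw [← Real.exp_add]; ring_nf
    have h2 := Real.add_one_le_exp (v - u)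
    rw [h1]
    nlinarith
  have hterm : ∀ j : ℤ, ENNReal.ofReal (b (2 ^ j * ω) *
          (1 - Real.exp (-(2 * (ω - δ * 2 ^ (-j)) ^ 2 / x ^ 2)))) +
        ENNReal.ofReal (b (-(2 ^ j * ω)) *
          (1 - Real.exp (-(2 * (-ω - δ * 2 ^ (-j)) ^ 2 / x ^ 2)))) ≤
      ENNReal.ofReal ((1 - B - v * B) * (b (2 ^ j * ω) + b (-(2 ^ j * ω))) +
        B * v * a ^ 2 * (b (2 ^ j * ω) * (1 - δ / (2 ^ j * ω)) ^ 2 +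
        b (-(2 ^ j * ω)) * (1 + δ / (2 ^ j * ω)) ^ 2)) := by
    intro j
    have hj : (0 : ℝ) < 2 ^ j := by positivity
    have e1 : 2 * (ω - δ * 2 ^ (-j)) ^ 2 / x ^ 2 = v * a ^ 2 * (1 - δ / (2 ^ j * ω)) ^ 2 := by
      rw [hv, zpow_neg]; field_simp
    have e2 : 2 * (-ω - δ * 2 ^ (-j)) ^ 2 / x ^ 2 = v * a ^ 2 * (1 + δ / (2 ^ j * ω)) ^ 2 := by
      rw [hv, zpow_neg]; field_simp; ring
    have hpos : ∀ u : ℝ, 0 ≤ u → 0 ≤ 1 - Real.exp (-u) := fun u hu => by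
      rw [sub_nonneg, Real.exp_le_one_iff]; linarith
    rw [e1, e2, ← ENNReal.ofReal_add (mul_nonneg (hb.nonneg _) (hpos _ (by positivity)))
      (mul_nonneg (hb.nonneg _) (hpos _ (by positivity)))]
    refine ENNReal.ofReal_le_ofReal ?_
    have h1 := mul_le_mul_of_nonneg_left (htan (v * a ^ 2 * (1 - δ / (2 ^ j * ω)) ^ 2))
      (hb.nonneg (2 ^ j * ω))
    have h2 := mul_le_mul_of_nonneg_left (htan (v * a ^ 2 * (1 + δ / (2 ^ j * ω)) ^ 2))
      (hb.nonneg (-(2 ^ j * ω)))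
    refine (add_le_add h1 h2).trans (le_of_eq ?_)
    ring
  refine (ENNReal.tsum_le_tsum hterm).trans ?_
  rw [← ENNReal.ofReal_tsum_of_nonneg (fun j => ?_) ((hs.mul_left _).add (hq.mul_left _)),
    ← ENNReal.ofReal_ofNat 2, ← ENNReal.ofReal_mul two_pos.le]
  · refine ENNReal.ofReal_le_ofReal ?_
    rw [(hs.mul_left _).tsum_add (hq.mul_left _), tsum_mul_left, tsum_mul_left]
    have h1 := mul_le_mul_of_nonneg_left (hb.tsum_real_le ω) hA
    have h2 := mul_le_mul_of_nonneg_left hqle (show 0 ≤ B * v * a ^ 2 by positivity)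
    have h3 : B * v * a ^ 2 * (2 / a ^ 2) = 2 * (v * B) := by field_simp
    linarith
  · refine add_nonneg (mul_nonneg hA (add_nonneg (hb.nonneg _) (hb.nonneg _)))
      (mul_nonneg (by positivity) (add_nonneg ?_ ?_)) <;>
    exact mul_nonneg (hb.nonneg _) (sq_nonneg _)

end IsWaveletProfile

/-! ### The multiplier inequalities for paths of length two -/

/-- The triangle of height `1 / 2` supported in `[-c, c]`. As its height is less than `1`, the
multiplier `1 - triangle c ω ^ 2` is bounded below. -/
noncomputable def triangle (c ω : ℝ) : ℝ := max 0 (c - |ω|) / (2 * c)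

theorem triangle_nonneg {c : ℝ} (hc : 0 < c) (ω : ℝ) : 0 ≤ triangle c ω := by
  unfold triangle; positivity

theorem triangle_le {c : ℝ} (hc : 0 < c) (ω : ℝ) : triangle c ω ≤ 1 / 2 := by
  unfold triangle
  rw [div_le_div_iff₀ (by positivity) two_pos]
  have : max 0 (c - |ω|) ≤ c := max_le hc.le (by linarith [abs_nonneg ω])
  linarith

theorem triangle_sq_le {c : ℝ} (hc : 0 < c) (ω : ℝ) : triangle c ω ^ 2 ≤ 1 / 4 := by
  have := triangle_le hc ω
  have := triangle_nonneg hc ω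
  nlinarith

/-- The average of the squares of `n` triangles centred at `c / 2, 3 c / 2, 5 c / 2, …`. -/
noncomputable def triangleAverage (c : ℝ) (n : ℕ) (ω : ℝ) : ℝ :=
  (∑ k ∈ Finset.range n, triangle c (ω - (k + 1 / 2) * c) ^ 2) / n

theorem triangleAverage_nonneg (c : ℝ) (n : ℕ) (ω : ℝ) : 0 ≤ triangleAverage c n ω :=
  div_nonneg (Finset.sum_nonneg fun _ _ => sq_nonneg _) n.cast_nonneg

theorem triangleAverage_le {c : ℝ} (hc : 0 < c) {n : ℕ} (hn : 0 < n) (ω : ℝ) :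
    triangleAverage c n ω ≤ 1 / 4 := by
  have hn' : (0 : ℝ) < n := by exact_mod_cast hn
  unfold triangleAverage
  rw [div_le_iff₀ hn']
  refine (Finset.sum_le_card_nsmul _ _ (1 / 4) fun k _ => triangle_sq_le hc _).trans ?_
  simp [mul_comm]

/-- A grid that extends beyond `ω` has a centre within `c / 2` of `ω`, where the triangle is at least
`1 / 4`. -/
theorem le_triangleAverage {c : ℝ} (hc : 0 < c) {n : ℕ} {ω : ℝ} (hω : 0 ≤ ω) (hn : ω / c < n) :
    1 / (16 * n) ≤ triangleAverage c n ω := by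
  have hn' : (0 : ℝ) < n := lt_of_le_of_lt (by positivity) hn
  set k := ⌊ω / c⌋₊
  have hk1 : (k : ℝ) ≤ ω / c := Nat.floor_le (by positivity)
  have hk2 : ω / c < k + 1 := Nat.lt_floor_add_one _
  have hkn : k < n := by
    have : (k : ℝ) < n := hk1.trans_lt hn
    exact_mod_cast this
  rw [le_div_iff₀ hc] at hk1
  rw [div_lt_iff₀ hc] at hk2
  have habs : |ω - (k + 1 / 2) * c| ≤ c / 2 := by
    rw [abs_le]; constructor <;> nlinarith
  have htri : 1 / 4 ≤ triangle c (ω - (k + 1 / 2) * c) := by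
    unfold triangle
    rw [div_le_div_iff₀ (by norm_num) (by positivity)]
    have := le_max_right 0 (c - |ω - (k + 1 / 2) * c|)
    linarith
  have hsum : triangle c (ω - (k + 1 / 2) * c) ^ 2 ≤
      ∑ k ∈ Finset.range n, triangle c (ω - (k + 1 / 2) * c) ^ 2 :=
    Finset.single_le_sum (f := fun k : ℕ => triangle c (ω - (k + 1 / 2) * c) ^ 2)
      (fun _ _ => sq_nonneg _) (Finset.mem_range.2 hkn)
  unfold triangleAverage
  have h16 : 1 / 16 ≤ ∑ k ∈ Finset.range n, triangle c (ω - (k + 1 / 2) * c) ^ 2 := by nlinarith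
  calc 1 / (16 * (n : ℝ)) = 1 / 16 / n := by rw [div_div]
    _ ≤ _ := by gcongr

namespace IsWaveletProfile

variable {b : ℝ → ℝ}

/-- The total weight of the scales at most `J` is quadratically small at low frequencies. -/
theorem exists_low_frequency_bound (hb : IsWaveletProfile b) (J : ℤ) :
    ∃ C ρ : ℝ, 0 < C ∧ 0 < ρ ∧ C * ρ ^ 2 ≤ 1 ∧ ∀ ω, |ω| ≤ ρ →
      ∑' j : {j : ℤ // j ≤ J}, (ENNReal.ofReal (b (2 ^ j.1 * ω)) +
        ENNReal.ofReal (b (-(2 ^ j.1 * ω)))) ≤ ENNReal.ofReal (C * ω ^ 2) := by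
  obtain ⟨ε, C, hε, hC, hdec⟩ := hb.decay
  have hdec' : ∀ u, |u| ≤ 1 → b u ≤ C * u ^ 2 := fun u hu => by
    refine (hdec u hu).trans (mul_le_of_le_one_right (by positivity) ?_)
    exact Real.rpow_le_one (abs_nonneg u) hu hε.le
  have hS : Summable fun j : {j : ℤ // j ≤ J} => ((2 : ℝ) ^ j.1) ^ 2 := by
    let e : ℕ ≃ {j : ℤ // j ≤ J} :=
      { toFun := fun k => ⟨J - k, by omega⟩
        invFun := fun j => (J - j.1).toNat
        left_inv := fun k => by simp
        right_inv := fun j => by ext; have := j.2; simp; omega }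
    refine (e.summable_iff).1 ?_
    have : (fun j : {j : ℤ // j ≤ J} => ((2 : ℝ) ^ j.1) ^ 2) ∘ e =
        fun k : ℕ => ((2 : ℝ) ^ J) ^ 2 * (1 / 4) ^ k := by
      ext k
      simp only [Function.comp_apply, e, Equiv.coe_fn_mk]
      rw [zpow_sub₀ two_ne_zero, zpow_natCast, div_pow, ← pow_mul, mul_comm k 2, pow_mul,
        one_div, inv_pow, div_eq_mul_inv]
      norm_num
    rw [this]
    exact (summable_geometric_of_lt_one (by norm_num) (by norm_num)).mul_left _
  set T := ∑' j : {j : ℤ // j ≤ J}, ((2 : ℝ) ^ j.1) ^ 2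
  have hT : 0 ≤ T := tsum_nonneg fun j => sq_nonneg _
  set D : ℝ := 2 * C * (T + 1)
  have hD : 0 < D := by positivity
  refine ⟨D, min (2 ^ (-J)) (√D)⁻¹, hD, by positivity, ?_, fun ω hω => ?_⟩
  · calc D * min (2 ^ (-J)) (√D)⁻¹ ^ 2 ≤ D * (√D)⁻¹ ^ 2 := by
          gcongr; exact min_le_right _ _
      _ = 1 := by rw [inv_pow, Real.sq_sqrt hD.le, mul_inv_cancel₀ hD.ne']
  · have hω' : |ω| ≤ 2 ^ (-J) := hω.trans (min_le_left _ _)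
    have hterm : ∀ j : {j : ℤ // j ≤ J}, ENNReal.ofReal (b (2 ^ j.1 * ω)) +
        ENNReal.ofReal (b (-(2 ^ j.1 * ω))) ≤
        ENNReal.ofReal (2 * C * ω ^ 2 * ((2 : ℝ) ^ j.1) ^ 2) := by
      intro j
      have hu : |2 ^ j.1 * ω| ≤ 1 := by
        rw [abs_mul, abs_of_pos (by positivity)]
        calc (2 : ℝ) ^ j.1 * |ω| ≤ 2 ^ J * 2 ^ (-J) := by
              gcongr
              · exact one_le_two
              · exact j.2
          _ = 1 := by rw [← zpow_add₀ two_ne_zero]; simp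
      rw [← ENNReal.ofReal_add (hb.nonneg _) (hb.nonneg _)]
      refine ENNReal.ofReal_le_ofReal ?_
      have h1 := hdec' _ hu
      have h2 := hdec' (-(2 ^ j.1 * ω)) (by rwa [abs_neg])
      rw [neg_sq] at h2
      nlinarith
    refine (ENNReal.tsum_le_tsum hterm).trans ?_
    rw [← ENNReal.ofReal_tsum_of_nonneg (fun j => by positivity) (hS.mul_left _), tsum_mul_left]
    refine ENNReal.ofReal_le_ofReal ?_
    have : 0 ≤ 2 * C * ω ^ 2 := by positivity
    calc 2 * C * ω ^ 2 * T ≤ 2 * C * ω ^ 2 * (T + 1) := by gcongr; linarith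
      _ = _ := by ring

/-- If the terms at the scales at most `J` are dominated by the Littlewood–Paley terms, then a gain
`γ` at a single scale, be it one that is larger than `J`, is a gain for the sum. -/
theorem tsum_add_gain_le (hb : IsWaveletProfile b) {J : ℤ} {ω : ℝ} {t : ℤ → ℝ≥0∞} {γ : ℝ≥0∞}
    (ht : ∀ j, t j ≤ ENNReal.ofReal (b (2 ^ j * ω)) + ENNReal.ofReal (b (-(2 ^ j * ω)))) (j₀ : ℤ)
    (h1 : j₀ ≤ J → t j₀ + γ ≤
      ENNReal.ofReal (b (2 ^ j₀ * ω)) + ENNReal.ofReal (b (-(2 ^ j₀ * ω))))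
    (h2 : γ ≤ ENNReal.ofReal (b (2 ^ j₀ * ω)) + ENNReal.ofReal (b (-(2 ^ j₀ * ω)))) :
    ∑' j : {j : ℤ // j ≤ J}, t j + γ ≤ 2 := by
  refine le_trans ?_ (hb.tsum_le ω)
  have e1 : ∑' j : {j : ℤ // j ≤ J}, t j = ∑' j : ℤ, {j : ℤ | j ≤ J}.indicator t j :=
    tsum_subtype {j : ℤ | j ≤ J} t
  have e2 : γ = ∑' j : ℤ, Pi.single (M := fun _ => ℝ≥0∞) j₀ γ j := (tsum_pi_single j₀ γ).symm
  rw [e1, e2, ← ENNReal.tsum_add]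
  refine ENNReal.tsum_le_tsum fun j => ?_
  by_cases hj : j = j₀
  · subst hj
    rw [Pi.single_eq_same]
    by_cases hJ : j ≤ J
    · rw [Set.indicator_of_mem (by exact hJ)]; exact h1 hJ
    · rw [Set.indicator_of_notMem (by exact hJ), zero_add]; exact h2
  · rw [Pi.single_eq_of_ne hj, add_zero]
    exact (Set.indicator_le_self' (by simp) j).trans (ht j)

/-- Multipliers of the form `1 - E` with `E ≥ 0` do not increase the Littlewood–Paley terms. -/
theorem weighted_term_le (hb : IsWaveletProfile b) {E : ℝ → ℝ} (hE : ∀ ω, 0 ≤ E ω) (u ω : ℝ) :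
    ENNReal.ofReal (b u * (1 - E ω)) + ENNReal.ofReal (b (-u) * (1 - E (-ω))) ≤
      ENNReal.ofReal (b u) + ENNReal.ofReal (b (-u)) :=
  add_le_add
    (ENNReal.ofReal_le_ofReal (mul_le_of_le_one_right (hb.nonneg _) (by linarith [hE ω])))
    (ENNReal.ofReal_le_ofReal (mul_le_of_le_one_right (hb.nonneg _) (by linarith [hE (-ω)])))

/-- At high frequencies, averaging over a grid of centre frequencies at each scale, which has about
`2⁻ʲ` points at the scale `j`, yields a gain of order `1 / ω ≥ R / ω²`: either the scale at which
positive frequencies strictly predominate is at most `J`, and then the grid comes close to `ω`,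
or this scale does not take part in the sum. -/
theorem exists_grid_gain (hb : IsWaveletProfile b) (J : ℤ) {ρ : ℝ} (hρ : 0 < ρ) :
    ∃ (N : ℤ → ℕ) (R : ℝ), (∀ j, 0 < N j) ∧ 0 < R ∧ ∀ ω : ℝ, ρ < ω →
      ∑' j : {j : ℤ // j ≤ J},
        (ENNReal.ofReal (b (2 ^ j.1 * ω) * (1 - triangleAverage ρ (N j.1) ω)) +
        ENNReal.ofReal (b (-(2 ^ j.1 * ω)) * (1 - triangleAverage ρ (N j.1) (-ω)))) +
        ENNReal.ofReal (R / ω ^ 2) ≤ 2 := by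
  obtain ⟨κ, K, hκ, hK, hgap⟩ := hb.exists_uniform_gap
  have hK0 : 0 < K := by linarith
  set N : ℤ → ℕ := fun j => ⌊K * 2 ^ (-j) / ρ⌋₊ + 1 with hNdef
  have hN : ∀ j, 0 < N j := fun j => Nat.succ_pos _
  set M : ℝ := K ^ 2 / ρ + 1 / ρ with hMdef
  have hM : 0 < M := by positivity
  -- `R / ω²` is at most the gain `κ / (16 N)` of the grid, and at most the gain `κ` of omission
  refine ⟨N, min (κ * ρ / (16 * M)) (κ * ρ ^ 2), hN, by positivity, fun ω hωρ => ?_⟩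
  set R : ℝ := min (κ * ρ / (16 * M)) (κ * ρ ^ 2)
  have hR : 0 < R := by positivity
  have hω : 0 < ω := hρ.trans hωρ
  obtain ⟨j₀, hj1, hj2, hj3⟩ := hgap ω hω
  have hjb : κ ≤ b (2 ^ j₀ * ω) := by linarith [hb.nonneg (-(2 ^ j₀ * ω))]
  have hγ1 : R / ω ^ 2 ≤ κ := by
    rw [div_le_iff₀ (by positivity)]
    have h1 : R ≤ κ * ρ ^ 2 := min_le_right _ _
    have h2 : ρ ^ 2 ≤ ω ^ 2 := by gcongr
    exact h1.trans (mul_le_mul_of_nonneg_left h2 hκ.le)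
  have hinv : (2 : ℝ) ^ (-j₀) ≤ K * ω := by
    have hp : (0 : ℝ) < 2 ^ j₀ := by positivity
    rw [zpow_neg, inv_le_iff_one_le_mul₀ hp]
    rw [inv_le_iff_one_le_mul₀ hK0] at hj1
    linarith
  have hNle : (N j₀ : ℝ) ≤ M * ω := by
    have h1 : (⌊K * 2 ^ (-j₀) / ρ⌋₊ : ℝ) ≤ K * 2 ^ (-j₀) / ρ := Nat.floor_le (by positivity)
    have h2 : K * 2 ^ (-j₀) / ρ ≤ K * (K * ω) / ρ := by gcongr
    have h3 : 1 ≤ ω / ρ := (one_le_div hρ).2 hωρ.le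
    simp only [hNdef, hMdef]
    push_cast
    calc _ ≤ K * (K * ω) / ρ + ω / ρ := by linarith
      _ = _ := by ring
  have hNlt : ω / ρ < N j₀ := by
    have h1 : K * 2 ^ (-j₀) / ρ < N j₀ := by
      simp only [hNdef]; push_cast; exact Nat.lt_floor_add_one _
    refine lt_of_le_of_lt ?_ h1
    refine div_le_div_of_nonneg_right ?_ hρ.le
    rw [zpow_neg, ← div_eq_mul_inv, le_div_iff₀ (by positivity)]
    linarith
  have hNpos : (0 : ℝ) < N j₀ := by exact_mod_cast hN j₀
  have hγ2 : R / ω ^ 2 ≤ κ * triangleAverage ρ (N j₀) ω := by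
    have h1 : R ≤ κ * ρ / (16 * M) := min_le_left _ _
    have h2 := le_triangleAverage hρ hω.le hNlt
    have h3 : 1 / (16 * (M * ω)) ≤ 1 / (16 * (N j₀ : ℝ)) := by gcongr
    have h4 : R ≤ κ * ω / (16 * M) := h1.trans (by gcongr)
    calc R / ω ^ 2 ≤ κ * ω / (16 * M) / ω ^ 2 := div_le_div_of_nonneg_right h4 (sq_nonneg _)
      _ = κ * (1 / (16 * (M * ω))) := by
        clear_value M
        field_simp
      _ ≤ _ := mul_le_mul_of_nonneg_left (h3.trans h2) hκ.le
  have hγ0 : 0 ≤ R / ω ^ 2 := by positivity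
  clear_value R N M
  refine hb.tsum_add_gain_le (t := fun j =>
    ENNReal.ofReal (b (2 ^ j * ω) * (1 - triangleAverage ρ (N j) ω)) +
        ENNReal.ofReal (b (-(2 ^ j * ω)) * (1 - triangleAverage ρ (N j) (-ω))))
    (fun j => hb.weighted_term_le (triangleAverage_nonneg ρ (N j)) _ ω) j₀ (fun _ => ?_) ?_
  · have h6 : 0 ≤ b (2 ^ j₀ * ω) * (1 - triangleAverage ρ (N j₀) ω) :=
      mul_nonneg (hb.nonneg _) (by linarith [triangleAverage_le hρ (hN j₀) ω])
    rw [add_right_comm, ← ENNReal.ofReal_add h6 hγ0]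
    refine add_le_add (ENNReal.ofReal_le_ofReal ?_) (ENNReal.ofReal_le_ofReal ?_)
    · have := mul_le_mul_of_nonneg_right hjb (triangleAverage_nonneg ρ (N j₀) ω)
      linarith
    · exact mul_le_of_le_one_right (hb.nonneg _)
        (by linarith [triangleAverage_nonneg ρ (N j₀) (-ω)])
  · exact (ENNReal.ofReal_le_ofReal (hγ1.trans hjb)).trans le_self_add

/-- The multiplier inequalities behind the energy bound for the paths of length two. After one
wavelet the energy is bounded by a high-pass multiplier that is trivial outside `[-c, c]`; after
two, the gain of order `1 / ω` at high frequencies is more than the Gaussian multiplier requires. -/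
theorem exists_base_step (hb : IsWaveletProfile b) (J : ℤ) :
    ∃ (c : ℝ) (N : ℤ → ℕ) (r : ℝ), 0 < c ∧ (∀ j, 0 < N j) ∧ 0 < r ∧
      (∀ ω : ℝ, ω ≠ 0 → ∑' j : {j : ℤ // j ≤ J}, (ENNReal.ofReal (b (2 ^ j.1 * ω)) +
        ENNReal.ofReal (b (-(2 ^ j.1 * ω)))) ≤ 2 * ENNReal.ofReal (1 - triangle c ω ^ 2)) ∧
      ∀ ω : ℝ, ω ≠ 0 → ∑' j : {j : ℤ // j ≤ J},
        (ENNReal.ofReal (b (2 ^ j.1 * ω) * (1 - triangleAverage c (N j.1) ω)) +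
        ENNReal.ofReal (b (-(2 ^ j.1 * ω)) * (1 - triangleAverage c (N j.1) (-ω)))) ≤
        2 * ENNReal.ofReal (1 - Real.exp (-(2 * ω ^ 2 / r ^ 2))) := by
  obtain ⟨C, ρ, hC, hρ, hCρ, hlow⟩ := hb.exists_low_frequency_bound J
  obtain ⟨N, R₀, hN, hR₀, hhigh⟩ := hb.exists_grid_gain J hρ
  set R : ℝ := min (2 / C) R₀
  have hR : 0 < R := by positivity
  have hRC : R * C ≤ 2 := (le_div_iff₀ hC).1 (min_le_left _ _)
  have hRR₀ : R ≤ R₀ := min_le_right _ _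
  clear_value R
  refine ⟨ρ, N, √R, hρ, hN, Real.sqrt_pos.2 hR, fun ω _ => ?_, fun ω hω => ?_⟩
  · by_cases hωρ : |ω| ≤ ρ
    · refine (hlow ω hωρ).trans ?_
      rw [← ENNReal.ofReal_ofNat 2, ← ENNReal.ofReal_mul two_pos.le]
      refine ENNReal.ofReal_le_ofReal ?_
      have h1 : ω ^ 2 ≤ ρ ^ 2 :=
        sq_le_sq' (by linarith [neg_abs_le ω]) (by linarith [le_abs_self ω])
      have h2 := triangle_sq_le hρ ω
      nlinarith
    · have : triangle ρ ω = 0 := by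
        unfold triangle
        rw [max_eq_left (by linarith), zero_div]
      rw [this]
      simp only [ne_eq, OfNat.ofNat_ne_zero, not_false_eq_true, zero_pow, sub_zero,
        ENNReal.ofReal_one, mul_one]
      exact (ENNReal.tsum_comp_le_tsum_of_injective Subtype.val_injective
        fun j : ℤ => ENNReal.ofReal (b (2 ^ j * ω)) + ENNReal.ofReal (b (-(2 ^ j * ω)))).trans
        (hb.tsum_le ω)
  · refine le_of_even_of_forall_pos (F := fun ω => ∑' j : {j : ℤ // j ≤ J},
        (ENNReal.ofReal (b (2 ^ j.1 * ω) * (1 - triangleAverage ρ (N j.1) ω)) +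
        ENNReal.ofReal (b (-(2 ^ j.1 * ω)) * (1 - triangleAverage ρ (N j.1) (-ω)))))
        (G := fun ω => 2 * ENNReal.ofReal (1 - Real.exp (-(2 * ω ^ 2 / √R ^ 2))))
        (fun ω => ?_) (fun ω => ?_) (fun ω hω => ?_) hω
    · refine tsum_congr fun j => ?_
      rw [mul_neg, neg_neg, neg_neg, add_comm]
    · simp only [neg_sq]
    rw [Real.sq_sqrt hR.le]
    rcases le_or_gt ω ρ with hωρ | hωρ
    · refine (ENNReal.tsum_le_tsum fun j : {j : ℤ // j ≤ J} =>
        hb.weighted_term_le (triangleAverage_nonneg ρ (N j.1)) (2 ^ j.1 * ω) ω).trans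
        ((hlow ω (by rwa [abs_of_pos hω])).trans ?_)
      rw [← ENNReal.ofReal_ofNat 2, ← ENNReal.ofReal_mul two_pos.le]
      refine ENNReal.ofReal_le_ofReal ?_
      set z := C * ω ^ 2
      have hz0 : 0 ≤ z := by positivity
      have hz1 : z ≤ 1 := le_trans (mul_le_mul_of_nonneg_left (by gcongr) hC.le) hCρ
      have hzy : z ≤ 2 * ω ^ 2 / R := by
        rw [le_div_iff₀ hR]
        nlinarith [sq_nonneg ω]
      have h1 : Real.exp (-(2 * ω ^ 2 / R)) ≤ Real.exp (-z) := Real.exp_le_exp.2 (by linarith)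
      have h2 : Real.exp (-z) * (z + 1) ≤ 1 := by
        calc Real.exp (-z) * (z + 1) ≤ Real.exp (-z) * Real.exp z :=
              mul_le_mul_of_nonneg_left (Real.add_one_le_exp z) (Real.exp_pos _).le
          _ = 1 := by rw [← Real.exp_add]; simp
      nlinarith [Real.exp_pos (-z)]
    · have hexp : 2 * Real.exp (-(2 * ω ^ 2 / R)) ≤ R₀ / ω ^ 2 := by
        have hy : 0 < 2 * ω ^ 2 / R := by positivity
        have h1 := Real.add_one_le_exp (2 * ω ^ 2 / R)
        have h2 : Real.exp (-(2 * ω ^ 2 / R)) ≤ (2 * ω ^ 2 / R)⁻¹ := by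
          rw [Real.exp_neg]; exact inv_anti₀ hy (by linarith)
        calc 2 * Real.exp (-(2 * ω ^ 2 / R)) ≤ 2 * (2 * ω ^ 2 / R)⁻¹ := by gcongr
          _ = R / ω ^ 2 := by field_simp
          _ ≤ R₀ / ω ^ 2 := by gcongr
      refine (ENNReal.le_sub_of_add_le_right ENNReal.ofReal_ne_top (hhigh ω hωρ)).trans ?_
      rw [← ENNReal.ofReal_ofNat 2, ← ENNReal.ofReal_sub _ (by positivity),
        ← ENNReal.ofReal_mul two_pos.le]
      exact ENNReal.ofReal_le_ofReal (by linarith)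

end IsWaveletProfile

/-! ### The profile of a wavelet -/

theorem fourier_wavelet (ψ : ℝ → ℂ) (j : ℤ) (ω : ℝ) : 𝓕 (wavelet ψ j) ω = 𝓕 ψ (2 ^ j * ω) := by
  have hp : (0 : ℝ) < 2 ^ (-j) := by positivity
  rw [Real.fourier_real_eq, Real.fourier_real_eq]
  have h := Measure.integral_comp_mul_left
    (fun v : ℝ => Real.fourierChar (-(v * (2 ^ j * ω))) • ψ v) ((2 : ℝ) ^ (-j))
  rw [abs_of_pos (inv_pos.2 hp), eq_inv_smul_iff₀ hp.ne', ← integral_smul] at h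
  rw [← h]
  refine integral_congr_ae (Filter.Eventually.of_forall fun t => ?_)
  have : (2 : ℝ) ^ (-j) * t * (2 ^ j * ω) = t * ω := by
    rw [mul_mul_mul_comm, ← zpow_add₀ two_ne_zero]; simp
  simp only [wavelet, this]
  rw [smul_comm]

theorem integrable_wavelet {ψ : ℝ → ℂ} (hψ : Integrable ψ) (j : ℤ) : Integrable (wavelet ψ j) :=
  (hψ.comp_mul_left' (by positivity : (2 : ℝ) ^ (-j) ≠ 0)).smul ((2 : ℝ) ^ (-j))

/-- The hypotheses on the wavelets, in terms of the single function `|𝓕 ψ|²`. The decay at the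
origin extends to all of `[-1, 1]` because the Littlewood–Paley condition bounds `|𝓕 ψ|²` by `2`. -/
theorem isWaveletProfile_norm_sq_fourier {ψ : ℝ → ℂ} (hψ : IsMotherWavelet ψ)
    (hLP : ∀ ω : ℝ, (1 / 2 : ℝ≥0∞) *
      ∑' j : ℤ, (‖𝓕 (wavelet ψ j) ω‖ₑ ^ 2 + ‖𝓕 (wavelet ψ j) (-ω)‖ₑ ^ 2) ≤ 1)
    (hneg : ∀ (j : ℤ) (ω : ℝ), 0 < ω → ‖𝓕 (wavelet ψ j) (-ω)‖ ≤ ‖𝓕 (wavelet ψ j) ω‖)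
    (hstrict : ∀ ω : ℝ, 0 < ω → ∃ j : ℤ, ‖𝓕 (wavelet ψ j) (-ω)‖ < ‖𝓕 (wavelet ψ j) ω‖)
    (hzero : ∃ ε : ℝ, 0 < ε ∧ 𝓕 ψ =O[𝓝 0] (fun ω : ℝ => |ω| ^ (1 + ε))) :
    IsWaveletProfile (fun u => ‖𝓕 ψ u‖ ^ 2) := by
  simp only [fourier_wavelet] at *
  have hof : ∀ u, ENNReal.ofReal (‖𝓕 ψ u‖ ^ 2) = ‖𝓕 ψ u‖ₑ ^ 2 := fun u => by
    rw [ENNReal.ofReal_pow (norm_nonneg _), ofReal_norm]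
  have hLP' : ∀ ω : ℝ, ∑' j : ℤ, (ENNReal.ofReal (‖𝓕 ψ (2 ^ j * ω)‖ ^ 2) +
      ENNReal.ofReal (‖𝓕 ψ (-(2 ^ j * ω))‖ ^ 2)) ≤ 2 := fun ω => by
    have h := mul_le_mul_right (hLP ω) 2
    rw [← mul_assoc, one_div, ENNReal.mul_inv_cancel two_ne_zero ENNReal.ofNat_ne_top, one_mul,
      mul_one] at h
    simpa only [hof, mul_neg] using h
  refine ⟨(continuous_fourier hψ.integrable).norm.pow 2, fun u => by positivity, hLP',
    fun u hu => ?_, fun ω hω => ?_, ?_⟩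
  · have := hneg 0 u hu
    simp only [zpow_zero, one_mul] at this
    gcongr
  · obtain ⟨j, hj⟩ := hstrict ω hω
    refine ⟨j, ?_⟩
    rw [mul_neg] at hj
    gcongr
  · obtain ⟨ε, hε, hO⟩ := hzero
    obtain ⟨C, hC, hO⟩ := hO.exists_pos
    obtain ⟨ρ, hρ, hball⟩ := Metric.eventually_nhds_iff.1 hO.bound
    have hb2 : ∀ u, ‖𝓕 ψ u‖ ^ 2 ≤ 2 := fun u => by
      have h := (ENNReal.le_tsum (f := fun j : ℤ => ENNReal.ofReal (‖𝓕 ψ (2 ^ j * u)‖ ^ 2) +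
      ENNReal.ofReal (‖𝓕 ψ (-(2 ^ j * u))‖ ^ 2)) 0).trans (hLP' u)
      simp only [zpow_zero, one_mul] at h
      have h' := le_self_add.trans h
      rw [← ENNReal.ofReal_ofNat 2] at h'
      exact (ENNReal.ofReal_le_ofReal_iff two_pos.le).1 h'
    refine ⟨2 * ε, C ^ 2 + 2 / (ρ ^ 2 * ρ ^ (2 * ε)), by positivity, by positivity, fun u _ => ?_⟩
    have hD : 0 ≤ 2 / (ρ ^ 2 * ρ ^ (2 * ε)) := by positivity
    have hup : 0 ≤ u ^ 2 * |u| ^ (2 * ε) := by positivity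
    rcases lt_or_ge |u| ρ with hu | hu
    · have h1 := hball (y := u) (by simpa using hu)
      rw [Real.norm_of_nonneg (by positivity)] at h1
      have h2 : (|u| ^ (1 + ε)) ^ 2 = u ^ 2 * |u| ^ (2 * ε) := by
        rw [← Real.rpow_natCast, ← Real.rpow_mul (abs_nonneg u), ← sq_abs, ← Real.rpow_natCast,
          ← Real.rpow_add' (abs_nonneg u) (by positivity)]
        push_cast
        ring_nf
      calc ‖𝓕 ψ u‖ ^ 2 ≤ (C * |u| ^ (1 + ε)) ^ 2 := by gcongr
        _ = C ^ 2 * (u ^ 2 * |u| ^ (2 * ε)) := by rw [mul_pow, h2]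
        _ ≤ _ := by
          rw [mul_assoc]
          exact mul_le_mul_of_nonneg_right (by linarith) hup
    · refine (hb2 u).trans ?_
      have h1 : ρ ^ 2 * ρ ^ (2 * ε) ≤ u ^ 2 * |u| ^ (2 * ε) := by
        rw [← sq_abs u]
        gcongr
      calc (2 : ℝ) = 2 / (ρ ^ 2 * ρ ^ (2 * ε)) * (ρ ^ 2 * ρ ^ (2 * ε)) := by field_simp
        _ ≤ 2 / (ρ ^ 2 * ρ ^ (2 * ε)) * (u ^ 2 * |u| ^ (2 * ε)) := by gcongr
        _ ≤ _ := by
          rw [mul_assoc]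
          refine mul_le_mul_of_nonneg_right ?_ hup
          have := sq_nonneg C
          linarith

/-! ### Energy removed by a low-pass filter -/

/-- Complementary multipliers split the energy. -/
theorem lintegral_mul_compl {F : ℝ → ℝ≥0∞} {z : ℝ → ℂ} (hz : Continuous z) (hF : Measurable F)
    (hz1 : ∀ ω, ‖z ω‖ ≤ 1) :
    (∫⁻ ω, F ω * ENNReal.ofReal (1 - ‖z ω‖ ^ 2)) + ∫⁻ ω, F ω * ‖z ω‖ₑ ^ 2 = ∫⁻ ω, F ω := by
  rw [← lintegral_add_left]
  · refine lintegral_congr fun ω => ?_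
    rw [← mul_add, ← ofReal_norm, ← ENNReal.ofReal_pow (norm_nonneg _),
      ← ENNReal.ofReal_add _ (by positivity)]
    · simp
    · have := hz1 ω
      have := norm_nonneg (z ω)
      nlinarith
  · exact hF.mul (by fun_prop)

theorem continuous_fourierReal {φ : ℝ → ℝ} (hφ : Integrable φ) : Continuous (fourierReal φ) :=
  continuous_fourier hφ.ofReal

/-- The modulus lemma in its complementary form: the energy that a low-pass filter removes from
`|f ⋆ g|` is at most the energy that its modulation removes from `f ⋆ g`. -/
theorem IsSignal.lintegral_modulus_le {f : ℝ → ℝ} (hf : IsSignal f) {g : ℝ → ℂ} (hg : Integrable g)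
    {φ : ℝ → ℝ} (hφ : Integrable φ) (hφ0 : ∀ t, 0 ≤ φ t) (hφ1 : ∀ ω, ‖fourierReal φ ω‖ ≤ 1)
    (η : ℝ) :
    ∫⁻ ω, ‖fourierReal (fun t => ‖conv f g t‖) ω‖ₑ ^ 2 *
        ENNReal.ofReal (1 - ‖fourierReal φ ω‖ ^ 2) ≤
      ∫⁻ ω, ‖fourierReal f ω‖ₑ ^ 2 * (‖𝓕 g ω‖ₑ ^ 2 *
        ENNReal.ofReal (1 - ‖fourierReal φ (ω - η)‖ ^ 2)) := by
  have hm := hf.measurable_conv hg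
  have h1 := hf.integrable_conv hg
  have h2 := hf.memLp_two_conv hg
  have hs := hf.norm_conv hg
  have hA := lintegral_fourier_modulus_ge hm h1 h2 hφ hφ0 η
  have hsc : Integrable fun t => ((‖conv f g t‖ : ℝ) : ℂ) := hs.integrable.ofReal
  have hcφ := continuous_fourierReal hφ
  have e1 := lintegral_mul_compl hcφ
    (F := fun ω => ‖fourierReal (fun t => ‖conv f g t‖) ω‖ₑ ^ 2)
    ((continuous_fourier hsc).measurable.enorm.pow_const 2) hφ1
  have e2 := lintegral_mul_compl (z := fun ω => fourierReal φ (ω - η))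
    (F := fun ω => ‖𝓕 (conv f g) ω‖ₑ ^ 2)
    (hcφ.comp (continuous_id.sub continuous_const))
    ((continuous_fourier h1).measurable.enorm.pow_const 2) (fun ω => hφ1 _)
  have e3 : ∫⁻ ω, ‖fourierReal (fun t => ‖conv f g t‖) ω‖ₑ ^ 2 =
      ∫⁻ ω, ‖𝓕 (conv f g) ω‖ₑ ^ 2 := by
    rw [lintegral_enorm_fourier_sq h1 h2, fourierReal, lintegral_enorm_fourier_sq hsc
      hs.memLp_two.ofReal]
    refine lintegral_congr fun t => ?_
    rw [← ofReal_norm, ← ofReal_norm, Complex.norm_real, norm_norm]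
  have hfin : ∫⁻ ω, ‖𝓕 (conv f g) ω‖ₑ ^ 2 ≠ ∞ := by
    rw [lintegral_enorm_fourier_sq h1 h2]
    exact ((memLp_two_iff_lintegral h2.1).1 h2).ne
  rw [e3, ← e2] at e1
  have hfin2 : ∫⁻ ω, ‖𝓕 (conv f g) ω‖ₑ ^ 2 * ‖fourierReal φ (ω - η)‖ₑ ^ 2 ≠ ∞ := by
    refine ne_top_of_le_ne_top hfin ?_
    rw [← e2]
    exact le_add_self
  have key : ∫⁻ ω, ‖fourierReal (fun t => ‖conv f g t‖) ω‖ₑ ^ 2 *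
        ENNReal.ofReal (1 - ‖fourierReal φ ω‖ ^ 2) ≤
      ∫⁻ ω, ‖𝓕 (conv f g) ω‖ₑ ^ 2 * ENNReal.ofReal (1 - ‖fourierReal φ (ω - η)‖ ^ 2) := by
    refine (ENNReal.add_le_add_iff_right hfin2).1 ?_
    rw [← e1]
    exact add_le_add_right hA _
  refine key.trans (le_of_eq (lintegral_congr fun ω => ?_))
  rw [hf.fourier_conv hg, enorm_mul, mul_pow, mul_assoc]

/-- The modulus lemma averaged over finitely many modulations. -/
theorem IsSignal.lintegral_modulus_le_average {f : ℝ → ℝ} (hf : IsSignal f) {g : ℝ → ℂ}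
    (hg : Integrable g) {φ : ℝ → ℝ} (hφ : Integrable φ) (hφ0 : ∀ t, 0 ≤ φ t)
    (hφ1 : ∀ ω, ‖fourierReal φ ω‖ ≤ 1) {n : ℕ} (hn : 0 < n) (η : ℕ → ℝ) :
    ∫⁻ ω, ‖fourierReal (fun t => ‖conv f g t‖) ω‖ₑ ^ 2 *
        ENNReal.ofReal (1 - ‖fourierReal φ ω‖ ^ 2) ≤
      ∫⁻ ω, ‖fourierReal f ω‖ₑ ^ 2 * (‖𝓕 g ω‖ₑ ^ 2 *
        ENNReal.ofReal (1 - (∑ k ∈ Finset.range n, ‖fourierReal φ (ω - η k)‖ ^ 2) / n)) := by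
  have hn' : (0 : ℝ) < n := by exact_mod_cast hn
  have hcφ := continuous_fourierReal hφ
  have hcf := continuous_fourierReal hf.integrable
  have hcg := continuous_fourier hg
  refine (ENNReal.mul_le_mul_iff_right (a := (n : ℝ≥0∞)) (by exact_mod_cast hn.ne')
    (ENNReal.natCast_ne_top n)).1 ?_
  calc _ = ∑ k ∈ Finset.range n, ∫⁻ ω, ‖fourierReal (fun t => ‖conv f g t‖) ω‖ₑ ^ 2 *
        ENNReal.ofReal (1 - ‖fourierReal φ ω‖ ^ 2) := by simp
    _ ≤ ∑ k ∈ Finset.range n, ∫⁻ ω, ‖fourierReal f ω‖ₑ ^ 2 * (‖𝓕 g ω‖ₑ ^ 2 *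
        ENNReal.ofReal (1 - ‖fourierReal φ (ω - η k)‖ ^ 2)) :=
      Finset.sum_le_sum fun k _ => hf.lintegral_modulus_le hg hφ hφ0 hφ1 (η k)
    _ = ∫⁻ ω, ∑ k ∈ Finset.range n, ‖fourierReal f ω‖ₑ ^ 2 * (‖𝓕 g ω‖ₑ ^ 2 *
        ENNReal.ofReal (1 - ‖fourierReal φ (ω - η k)‖ ^ 2)) := by
      rw [lintegral_finsetSum]
      intro k _
      have hk : Continuous fun ω => fourierReal φ (ω - η k) :=
        hcφ.comp (continuous_id.sub continuous_const)
      exact (hcf.measurable.enorm.pow_const 2).mul ((hcg.measurable.enorm.pow_const 2).mul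
        (ENNReal.measurable_ofReal.comp (continuous_const.sub (hk.norm.pow 2)).measurable))
    _ = ∫⁻ ω, (n : ℝ≥0∞) * (‖fourierReal f ω‖ₑ ^ 2 * (‖𝓕 g ω‖ₑ ^ 2 *
        ENNReal.ofReal (1 - (∑ k ∈ Finset.range n, ‖fourierReal φ (ω - η k)‖ ^ 2) / n))) := by
      refine lintegral_congr fun ω => ?_
      have hS : ∑ k ∈ Finset.range n, ENNReal.ofReal (1 - ‖fourierReal φ (ω - η k)‖ ^ 2) =
          n * ENNReal.ofReal
            (1 - (∑ k ∈ Finset.range n, ‖fourierReal φ (ω - η k)‖ ^ 2) / n) := by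
        rw [← ENNReal.ofReal_sum_of_nonneg, ← ENNReal.ofReal_natCast n,
          ← ENNReal.ofReal_mul hn'.le]
        · congr 1
          rw [Finset.sum_sub_distrib, mul_sub, mul_div_cancel₀ _ hn'.ne']
          simp
        · intro k _
          have := hφ1 (ω - η k)
          have := norm_nonneg (fourierReal φ (ω - η k))
          nlinarith
      rw [← Finset.mul_sum, ← Finset.mul_sum, hS]
      ring
    _ = _ := lintegral_const_mul' _ _ (ENNReal.natCast_ne_top n)

/-! ### The cascade of a deterministic signal -/

/-- Against an even density a multiplier may be replaced by its even part. The frequency `0`, a null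
set, may be excluded. -/
theorem lintegral_symmetrize {F W V : ℝ → ℝ≥0∞} (hF : Measurable F) (hW : Measurable W)
    (hFneg : ∀ ω, F (-ω) = F ω) (h : ∀ ω, ω ≠ 0 → W ω + W (-ω) ≤ 2 * V ω) :
    ∫⁻ ω, F ω * W ω ≤ ∫⁻ ω, F ω * V ω := by
  have e : ∫⁻ ω, F ω * W (-ω) = ∫⁻ ω, F ω * W ω := by
    have := (Measure.measurePreserving_neg (volume : Measure ℝ)).lintegral_comp (hF.mul hW)
    simpa only [hFneg, Pi.mul_apply] using this
  refine (ENNReal.mul_le_mul_iff_right (a := 2) two_ne_zero ENNReal.ofNat_ne_top).1 ?_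
  calc 2 * ∫⁻ ω, F ω * W ω = (∫⁻ ω, F ω * W ω) + ∫⁻ ω, F ω * W (-ω) := by rw [e, two_mul]
    _ = ∫⁻ ω, F ω * (W ω + W (-ω)) := by
      rw [← lintegral_add_left (f := fun ω => F ω * W ω) (hF.mul hW)]
      simp only [mul_add]
    _ ≤ ∫⁻ ω, 2 * (F ω * V ω) := by
      refine lintegral_mono_ae ?_
      filter_upwards [Measure.ae_ne volume (0 : ℝ)] with ω hω
      calc F ω * (W ω + W (-ω)) ≤ F ω * (2 * V ω) := by gcongr; exact h ω hω
        _ = _ := by ring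
    _ = _ := lintegral_const_mul' _ _ ENNReal.ofNat_ne_top

/-- One layer of the cascade. An energy functional `T` that is controlled by a low-pass filter `φ`
becomes, after the layer, a functional controlled by the multiplier `V`, as soon as `V` dominates
the symmetrized sum of the modulated multipliers. -/
theorem IsSignal.tsum_layer_le {ψ : ℝ → ℂ} (hψ : Integrable ψ) {f : ℝ → ℝ} (hf : IsSignal f)
    {J : ℤ} {T : (ℝ → ℝ) → ℝ≥0∞} {φ : ℝ → ℝ} (hφ : Integrable φ) (hφ0 : ∀ t, 0 ≤ φ t)
    (hφ1 : ∀ ω, ‖fourierReal φ ω‖ ≤ 1)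
    (hT : ∀ g, IsSignal g → T g ≤
      ∫⁻ ω, ‖fourierReal g ω‖ₑ ^ 2 * ENNReal.ofReal (1 - ‖fourierReal φ ω‖ ^ 2))
    {N : ℤ → ℕ} (hN : ∀ j, 0 < N j) (η : ℤ → ℕ → ℝ) {E : ℤ → ℝ → ℝ} (hE : ∀ j ω, E j ω =
      (∑ k ∈ Finset.range (N j), ‖fourierReal φ (ω - η j k)‖ ^ 2) / N j)
    {V : ℝ → ℝ} (hV : ∀ ω, ω ≠ 0 → ∑' j : {j : ℤ // j ≤ J},
      (ENNReal.ofReal (‖𝓕 ψ (2 ^ j.1 * ω)‖ ^ 2 * (1 - E j.1 ω)) +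
        ENNReal.ofReal (‖𝓕 ψ (-(2 ^ j.1 * ω))‖ ^ 2 * (1 - E j.1 (-ω)))) ≤
      2 * ENNReal.ofReal (V ω)) :
    ∑' j : {j : ℤ // j ≤ J}, T (fun t => ‖conv f (wavelet ψ j) t‖) ≤
      ∫⁻ ω, ‖fourierReal f ω‖ₑ ^ 2 * ENNReal.ofReal (V ω) := by
  have hcf := continuous_fourierReal hf.integrable
  have hcφ := continuous_fourierReal hφ
  have hcψ := continuous_fourier hψ
  have hEc : ∀ j, Continuous (E j) := fun j => by
    rw [funext (hE j)]
    refine (continuous_finsetSum _ fun k _ => ?_).div_const _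
    exact ((hcφ.comp (continuous_id.sub continuous_const)).norm.pow 2)
  have hWm : ∀ j : ℤ, Measurable fun ω =>
      ENNReal.ofReal (‖𝓕 ψ (2 ^ j * ω)‖ ^ 2 * (1 - E j ω)) := fun j =>
    ENNReal.measurable_ofReal.comp (Continuous.measurable
      (((hcψ.comp (continuous_const.mul continuous_id)).norm.pow 2).mul
        (continuous_const.sub (hEc j))))
  have hFm : Measurable fun ω => ‖fourierReal f ω‖ₑ ^ 2 := hcf.measurable.enorm.pow_const 2
  calc ∑' j : {j : ℤ // j ≤ J}, T (fun t => ‖conv f (wavelet ψ j) t‖)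
      ≤ ∑' j : {j : ℤ // j ≤ J}, ∫⁻ ω, ‖fourierReal f ω‖ₑ ^ 2 *
          ENNReal.ofReal (‖𝓕 ψ (2 ^ j.1 * ω)‖ ^ 2 * (1 - E j.1 ω)) := by
        refine ENNReal.tsum_le_tsum fun j => ?_
        have hw := integrable_wavelet hψ j.1
        refine (hT _ (hf.norm_conv hw)).trans
          ((hf.lintegral_modulus_le_average hw hφ hφ0 hφ1 (hN j.1) (η j.1)).trans (le_of_eq ?_))
        refine lintegral_congr fun ω => ?_
        rw [hE, fourier_wavelet, ENNReal.ofReal_mul (by positivity),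
          ENNReal.ofReal_pow (norm_nonneg _), ofReal_norm]
    _ = ∫⁻ ω, ‖fourierReal f ω‖ₑ ^ 2 * ∑' j : {j : ℤ // j ≤ J},
          ENNReal.ofReal (‖𝓕 ψ (2 ^ j.1 * ω)‖ ^ 2 * (1 - E j.1 ω)) := by
        have hFW : ∀ j : {j : ℤ // j ≤ J}, AEMeasurable fun ω => ‖fourierReal f ω‖ₑ ^ 2 *
            ENNReal.ofReal (‖𝓕 ψ (2 ^ j.1 * ω)‖ ^ 2 * (1 - E j.1 ω)) := fun j =>
          (hFm.mul (hWm j.1)).aemeasurable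
        rw [← lintegral_tsum hFW]
        simp only [ENNReal.tsum_mul_left]
    _ ≤ _ := by
        have hWm' : Measurable fun ω => ∑' j : {j : ℤ // j ≤ J},
            ENNReal.ofReal (‖𝓕 ψ (2 ^ j.1 * ω)‖ ^ 2 * (1 - E j.1 ω)) :=
          Measurable.tsum fun j => hWm j.1
        refine lintegral_symmetrize hFm hWm' (fun ω => ?_) (fun ω hω => ?_)
        · rw [← ofReal_norm, norm_fourierReal_neg, ofReal_norm]
        · rw [← ENNReal.tsum_add]
          simpa only [mul_neg] using hV ω hω

/-- The total energy of the `n`-th layer of the cascade with scales at most `J`. -/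
noncomputable def cascadeEnergy (ψ : ℝ → ℂ) (J : ℤ) : ℕ → (ℝ → ℝ) → ℝ≥0∞
  | 0, f => ∫⁻ t, ‖f t‖ₑ ^ 2
  | n + 1, f => ∑' j : {j : ℤ // j ≤ J}, cascadeEnergy ψ J n (fun t => ‖conv f (wavelet ψ j) t‖)

/-- A path of length `n + 1` is a scale followed by a path of length `n`. -/
def scatPathSuccEquiv (J : ℤ) (n : ℕ) : ScatPath J (n + 1) ≃ {j : ℤ // j ≤ J} × ScatPath J n where
  toFun p := match p with
    | ⟨[], h⟩ => absurd h.1 (by simp)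
    | ⟨j :: q, h⟩ => (⟨j, h.2 j (by simp)⟩,
        ⟨q, by simpa using h.1, fun i hi => h.2 i (List.mem_cons_of_mem j hi)⟩)
  invFun p := ⟨p.1.1 :: p.2.1, by simp [p.2.2.1], by
    intro i hi
    rcases List.mem_cons.1 hi with rfl | hi
    · exact p.1.2
    · exact p.2.2.2 i hi⟩
  left_inv p := match p with
    | ⟨[], h⟩ => absurd h.1 (by simp)
    | ⟨_ :: _, _⟩ => rfl
  right_inv _ := rfl

/-- Summing over the paths of length `n` amounts to summing over the scales one layer at a time. -/
theorem tsum_scatPath_eq_cascadeEnergy (ψ : ℝ → ℂ) (J : ℤ) (n : ℕ) (f : ℝ → ℝ) :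
    ∑' p : ScatPath J n, ∫⁻ t, ‖scatU ψ p.1 f t‖ₑ ^ 2 = cascadeEnergy ψ J n f := by
  induction n generalizing f with
  | zero =>
    have : Unique (ScatPath J 0) :=
      ⟨⟨⟨[], rfl, by simp⟩⟩, fun p => Subtype.ext (List.length_eq_zero_iff.1 p.2.1)⟩
    rw [tsum_eq_single default fun p hp => absurd (Subsingleton.elim p default) hp]
    have e : (default : ScatPath J 0).1 = [] :=
      List.length_eq_zero_iff.1 (default : ScatPath J 0).2.1
    rw [e]
    rfl
  | succ n ih =>
    rw [← (scatPathSuccEquiv J n).symm.tsum_eq, ENNReal.tsum_prod']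
    simp only [cascadeEnergy, ← ih]
    rfl

/-- The energy bound for the cascade of a deterministic signal, by induction on the length. The
first layer is compared with the filter `0`, the second with a triangular one, and all later layers
with Gaussians whose width grows by the factor `a` with each layer. -/
theorem exists_cascadeEnergy_le {ψ : ℝ → ℂ} (hψ : Integrable ψ)
    (hb : IsWaveletProfile (fun u => ‖𝓕 ψ u‖ ^ 2)) (J : ℤ) :
    ∃ r a : ℝ, 0 < r ∧ 1 < a ∧ ∀ n, 2 ≤ n → ∀ f, IsSignal f →
      cascadeEnergy ψ J n f ≤ ∫⁻ ω, ‖fourierReal f ω‖ₑ ^ 2 *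
        ENNReal.ofReal (1 - ‖fourierReal (gaussFilter (r * a ^ n)) ω‖ ^ 2) := by
  obtain ⟨c, N, R, hc, hN, hR, hone, htwo⟩ := hb.exists_base_step J
  obtain ⟨δ, a, ha, hstep⟩ := hb.exists_gaussian_step
  have ha0 : 0 < a := by linarith
  obtain ⟨φ, hφ, hφ0, hφt⟩ := exists_triangle_kernel hc
  have hφn : ∀ ω, ‖fourierReal φ ω‖ = triangle c ω := fun ω => by
    rw [hφt, Complex.norm_real]
    exact Real.norm_of_nonneg (triangle_nonneg hc ω)
  have h1 : ∀ f, IsSignal f → cascadeEnergy ψ J 1 f ≤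
      ∫⁻ ω, ‖fourierReal f ω‖ₑ ^ 2 * ENNReal.ofReal (1 - ‖fourierReal φ ω‖ ^ 2) := by
    intro f hf
    have h0 : ∀ ω, fourierReal (fun _ => 0) ω = 0 := fun ω => by
      simp [fourierReal, Real.fourier_real_eq]
    simp only [hφn]
    refine hf.tsum_layer_le hψ (T := cascadeEnergy ψ J 0) (φ := fun _ => 0) (integrable_zero _ _ _)
      (fun _ => le_rfl) (fun ω => by rw [h0]; simp) (fun g hg => ?_) (N := fun _ => 1)
      (fun _ => one_pos) (fun _ _ => 0) (E := fun _ _ => 0) (fun j ω => by simp [h0])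
      (V := fun ω => 1 - triangle c ω ^ 2) (fun ω hω => ?_)
    · have hgc : Integrable fun t => (g t : ℂ) := hg.integrable.ofReal
      simp only [h0]
      simp only [cascadeEnergy, fourierReal, norm_zero, ne_eq, OfNat.ofNat_ne_zero,
        not_false_eq_true, zero_pow, sub_zero, ENNReal.ofReal_one, mul_one]
      rw [lintegral_enorm_fourier_sq hgc hg.memLp_two.ofReal]
      refine le_of_eq (lintegral_congr fun t => ?_)
      rw [← ofReal_norm, ← ofReal_norm, Complex.norm_real]
    · simpa only [sub_zero, mul_one] using hone ω hω
  have hmain : ∀ n f, IsSignal f → cascadeEnergy ψ J (n + 2) f ≤ ∫⁻ ω, ‖fourierReal f ω‖ₑ ^ 2 *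
        ENNReal.ofReal (1 - ‖fourierReal (gaussFilter (R * a ^ n)) ω‖ ^ 2) := by
    intro n
    induction n with
    | zero =>
      intro f hf
      simp only [pow_zero, mul_one, norm_fourierReal_gaussFilter_sq hR]
      exact hf.tsum_layer_le hψ (T := cascadeEnergy ψ J 1) hφ hφ0
        (fun ω => by rw [hφn]; linarith [triangle_le hc ω]) h1 hN
        (fun _ k => ((k : ℝ) + 1 / 2) * c) (E := fun j => triangleAverage c (N j))
        (fun j ω => by simp only [triangleAverage, hφn])
        (V := fun ω => 1 - Real.exp (-(2 * ω ^ 2 / R ^ 2))) htwo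
    | succ n ih =>
      intro f hf
      have hx : 0 < R * a ^ n := by positivity
      have hx' : 0 < R * a ^ (n + 1) := by positivity
      simp only [norm_fourierReal_gaussFilter_sq hx']
      refine hf.tsum_layer_le hψ (T := cascadeEnergy ψ J (n + 2)) (integrable_gaussFilter hx)
        (gaussFilter_nonneg hx) (fun ω => ?_) ih (N := fun _ => 1) (fun _ => one_pos)
        (fun j _ => δ * 2 ^ (-j))
        (E := fun j ω => Real.exp (-(2 * (ω - δ * 2 ^ (-j)) ^ 2 / (R * a ^ n) ^ 2)))
        (fun j ω => by simp [norm_fourierReal_gaussFilter_sq hx])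
        (V := fun ω => 1 - Real.exp (-(2 * ω ^ 2 / (R * a ^ (n + 1)) ^ 2))) (fun ω hω => ?_)
      · refine (sq_le_one_iff₀ (norm_nonneg _)).1 ?_
        rw [norm_fourierReal_gaussFilter_sq hx, Real.exp_le_one_iff, neg_nonpos]
        positivity
      · rw [pow_succ a n, ← mul_assoc]
        exact (ENNReal.tsum_comp_le_tsum_of_injective (Subtype.val_injective (p := fun j => j ≤ J))
          _).trans (hstep _ hx ω hω)
  -- `R` is the width for the length `n = 2`
  refine ⟨R / a ^ 2, a, by positivity, ha, fun n hn f hf => ?_⟩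
  obtain ⟨m, rfl⟩ := Nat.exists_eq_add_of_le' hn
  have e : R / a ^ 2 * a ^ (m + 2) = R * a ^ m := by
    field_simp
    ring
  rw [e]
  exact hmain m f hf

theorem conv_ofReal (f g : ℝ → ℝ) (t : ℝ) :
    conv f (fun t => (g t : ℂ)) t = ((conv f g t : ℝ) : ℂ) := by
  rw [conv_apply, conv_apply, ← integral_complex_ofReal]
  simp

/-- The cascade and the low-pass filter together do not increase the energy. -/
theorem tsum_scatPath_add_gaussian_le {ψ : ℝ → ℂ} {J : ℤ} {n : ℕ} {x : ℝ} (hx : 0 < x)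
    {f : ℝ → ℝ} (hf : IsSignal f)
    (h : cascadeEnergy ψ J n f ≤ ∫⁻ ω, ‖fourierReal f ω‖ₑ ^ 2 *
        ENNReal.ofReal (1 - ‖fourierReal (gaussFilter x) ω‖ ^ 2)) :
    ∑' p : ScatPath J n, (∫⁻ t, ‖scatU ψ p.1 f t‖ₑ ^ 2) + ∫⁻ t, ‖conv f (gaussFilter x) t‖ₑ ^ 2 ≤
      ∫⁻ t, ‖f t‖ₑ ^ 2 := by
  have hχ := integrable_gaussFilter hx
  have hχc : Integrable fun t => (gaussFilter x t : ℂ) := hχ.ofReal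
  have hfc : Integrable fun t => (f t : ℂ) := hf.integrable.ofReal
  have e1 : ∫⁻ t, ‖conv f (gaussFilter x) t‖ₑ ^ 2 =
      ∫⁻ ω, ‖fourierReal f ω‖ₑ ^ 2 * ‖fourierReal (gaussFilter x) ω‖ₑ ^ 2 := by
    calc _ = ∫⁻ t, ‖conv f (fun t => (gaussFilter x t : ℂ)) t‖ₑ ^ 2 := by
          refine lintegral_congr fun t => ?_
          rw [conv_ofReal, ← ofReal_norm, ← ofReal_norm, Complex.norm_real]
      _ = _ := by
          rw [← lintegral_enorm_fourier_sq (hf.integrable_conv hχc) (hf.memLp_two_conv hχc)]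
          refine lintegral_congr fun ω => ?_
          rw [hf.fourier_conv hχc, enorm_mul, mul_pow]
          rfl
  have e2 : ∫⁻ t, ‖f t‖ₑ ^ 2 = ∫⁻ ω, ‖fourierReal f ω‖ₑ ^ 2 := by
    rw [fourierReal, lintegral_enorm_fourier_sq hfc hf.memLp_two.ofReal]
    refine lintegral_congr fun t => ?_
    rw [← ofReal_norm, ← ofReal_norm, Complex.norm_real]
  rw [tsum_scatPath_eq_cascadeEnergy, e1, e2, ← lintegral_mul_compl
    (continuous_fourierReal hχ)
    ((continuous_fourierReal hf.integrable).measurable.enorm.pow_const 2)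
    (fun ω => ?_)]
  · gcongr
  · refine (sq_le_one_iff₀ (norm_nonneg _)).1 ?_
    rw [norm_fourierReal_gaussFilter_sq hx, Real.exp_le_one_iff, neg_nonpos]
    positivity

/-! ### Weighted time integrals of processes -/

section SecondOrder

variable {Ω : Type*} [MeasurableSpace Ω] {P : Measure Ω} {E : Type*} [NormedAddCommGroup E]
  [NormedSpace ℝ E]

/-- The mean square bound on which all comparisons of filtered processes rest. -/
theorem lintegral_enorm_integral_smul_sq_le [SFinite P] {Z : ℝ → Ω → ℝ}
    (hZ : Measurable (fun z : ℝ × Ω => Z z.1 z.2)) {g : ℝ → E} (hg : AEStronglyMeasurable g) :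
    ∫⁻ ω, ‖∫ s, Z s ω • g s‖ₑ ^ 2 ∂P ≤
      (∫⁻ s, ‖g s‖ₑ) * ∫⁻ s, ‖g s‖ₑ * ∫⁻ ω, ‖Z s ω‖ₑ ^ 2 ∂P := by
  refine le_trans (lintegral_mono fun ω => ?_)
    (lintegral_sq_lintegral_mul_le (k := fun s => ‖g s‖ₑ) (H := fun s ω => ‖Z s ω‖ₑ) hg.enorm
      hZ.enorm)
  refine pow_le_pow_left₀ zero_le ?_ 2
  refine (enorm_integral_le_lintegral_enorm _).trans (le_of_eq (lintegral_congr fun s => ?_))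
  rw [enorm_smul, mul_comm]

theorem ae_integrable_smul [SFinite P] {Z : ℝ → Ω → ℝ}
    (hZ : Measurable (fun z : ℝ × Ω => Z z.1 z.2)) {g : ℝ → E} (hg : Integrable g) {C : ℝ≥0∞}
    (hC : C ≠ ∞) (hZC : ∀ s, ∫⁻ ω, ‖Z s ω‖ₑ ^ 2 ∂P ≤ C) :
    ∀ᵐ ω ∂P, Integrable (fun s => Z s ω • g s) := by
  have h := lintegral_sq_lintegral_mul_le (P := P) (k := fun s => ‖g s‖ₑ)
    (H := fun s ω => ‖Z s ω‖ₑ) hg.aestronglyMeasurable.enorm hZ.enorm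
  have hgf : ∫⁻ s, ‖g s‖ₑ ≠ ∞ := hg.2.ne
  have hfin : ∫⁻ ω, (∫⁻ s, ‖g s‖ₑ * ‖Z s ω‖ₑ) ^ 2 ∂P ≠ ∞ := by
    refine ne_top_of_le_ne_top ?_ (h.trans (mul_le_mul_right
      (lintegral_mono fun s => mul_le_mul_right (hZC s) _) _))
    rw [lintegral_mul_const' _ _ hC]
    exact ENNReal.mul_ne_top hgf (ENNReal.mul_ne_top hgf hC)
  have hm : AEMeasurable (fun ω => (∫⁻ s, ‖g s‖ₑ * ‖Z s ω‖ₑ) ^ 2) P := by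
    refine AEMeasurable.pow_const ?_ 2
    refine AEMeasurable.lintegral_prod_right' (f := fun p : Ω × ℝ => ‖g p.2‖ₑ * ‖Z p.2 p.1‖ₑ) ?_
    exact (hg.aestronglyMeasurable.enorm.comp_quasiMeasurePreserving
      Measure.quasiMeasurePreserving_snd).mul (hZ.comp measurable_swap).enorm.aemeasurable
  filter_upwards [ae_lt_top' hm hfin] with ω hω
  refine ⟨((hZ.comp (measurable_id.prodMk measurable_const)).aestronglyMeasurable).smul
    hg.aestronglyMeasurable, ?_⟩
  rw [hasFiniteIntegral_iff_enorm]
  refine lt_of_le_of_lt (le_of_eq (lintegral_congr fun s => ?_))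
    ((ENNReal.pow_lt_top_iff).1 hω |>.resolve_right two_ne_zero)
  rw [enorm_smul, mul_comm]

theorem enorm_add_sq_le (x y : ℝ) : ‖x + y‖ₑ ^ 2 ≤ 2 * (‖x‖ₑ ^ 2 + ‖y‖ₑ ^ 2) := by
  calc ‖x + y‖ₑ ^ 2 ≤ (‖x‖ₑ + ‖y‖ₑ) ^ 2 := pow_le_pow_left₀ zero_le (enorm_add_le x y) 2
    _ ≤ 2 * (‖x‖ₑ ^ 2 + ‖y‖ₑ ^ 2) := by
      have := ENNReal.rpow_add_le_mul_rpow_add_rpow ‖x‖ₑ ‖y‖ₑ (p := 2) one_le_two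
      norm_num at this
      exact this

theorem lintegral_enorm_sub_sq_le {x y : Ω → ℝ} (hx : Measurable x) {C D : ℝ≥0∞}
    (h1 : ∫⁻ ω, ‖x ω‖ₑ ^ 2 ∂P ≤ C) (h2 : ∫⁻ ω, ‖y ω‖ₑ ^ 2 ∂P ≤ D) :
    ∫⁻ ω, ‖x ω - y ω‖ₑ ^ 2 ∂P ≤ 2 * (C + D) := by
  calc ∫⁻ ω, ‖x ω - y ω‖ₑ ^ 2 ∂P ≤ ∫⁻ ω, 2 * (‖x ω‖ₑ ^ 2 + ‖y ω‖ₑ ^ 2) ∂P := by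
        refine lintegral_mono fun ω => ?_
        rw [sub_eq_add_neg, ← enorm_neg (y ω)]
        exact enorm_add_sq_le _ _
    _ = 2 * (∫⁻ ω, ‖x ω‖ₑ ^ 2 ∂P + ∫⁻ ω, ‖y ω‖ₑ ^ 2 ∂P) := by
        rw [lintegral_const_mul' _ _ ENNReal.ofNat_ne_top,
          lintegral_add_left (hx.enorm.pow_const 2)]
    _ ≤ _ := by gcongr

/-! ### Regular processes -/

/-- Jointly measurable strictly stationary processes that are bounded and uniformly continuous in
mean square. This class is stable under the layers of the cascade, whereas the integrability of
the autocovariance is not. -/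
structure IsRegularProcess (P : Measure Ω) (Y : ℝ → Ω → ℝ) : Prop where
  measurable : Measurable (fun z : ℝ × Ω => Y z.1 z.2)
  bounded : ∃ C : ℝ≥0∞, C ≠ ∞ ∧ ∀ t, ∫⁻ ω, ‖Y t ω‖ₑ ^ 2 ∂P ≤ C
  uniformContinuous : ∀ ε : ℝ≥0∞, ε ≠ 0 → ∃ δ : ℝ, 0 < δ ∧ ∀ s t, |s - t| < δ →
    ∫⁻ ω, ‖Y s ω - Y t ω‖ₑ ^ 2 ∂P ≤ ε
  stationary : IsStationaryProcess P Y

namespace IsRegularProcess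

variable {Y : ℝ → Ω → ℝ}

theorem measurable_apply (hY : IsRegularProcess P Y) (t : ℝ) : Measurable (Y t) :=
  hY.measurable.comp (measurable_const.prodMk measurable_id)

theorem memLp_two (hY : IsRegularProcess P Y) (t : ℝ) : MemLp (Y t) 2 P := by
  obtain ⟨C, hC, h⟩ := hY.bounded
  rw [memLp_two_iff_lintegral (hY.measurable_apply t).aestronglyMeasurable]
  exact (h t).trans_lt hC.lt_top

/-- Stationarity for finite families with an arbitrary index type. -/
theorem map_eq (hY : IsRegularProcess P Y) {ι : Type*} [Fintype ι] (t : ι → ℝ) (h : ℝ) :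
    P.map (fun ω i => Y (t i + h) ω) = P.map (fun ω i => Y (t i) ω) := by
  let e := Fintype.equivFin ι
  have key := hY.stationary (Fintype.card ι) (fun k => t (e.symm k)) h
  have hm : ∀ u : Fin (Fintype.card ι) → ℝ, Measurable fun ω k => Y (u k) ω := fun u =>
    measurable_pi_lambda _ fun k => hY.measurable_apply _
  have hr : Measurable fun (y : Fin (Fintype.card ι) → ℝ) (i : ι) => y (e i) :=
    measurable_pi_lambda _ fun i => measurable_pi_apply _
  have := congrArg (fun μ => Measure.map (fun (y : Fin (Fintype.card ι) → ℝ) (i : ι) => y (e i)) μ)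
    key
  simp only [Measure.map_map hr (hm _)] at this
  simpa [Function.comp_def] using this

theorem lintegral_sq_eq (hY : IsRegularProcess P Y) (t : ℝ) :
    ∫⁻ ω, ‖Y t ω‖ₑ ^ 2 ∂P = ∫⁻ ω, ‖Y 0 ω‖ₑ ^ 2 ∂P := by
  have h := hY.map_eq (ι := Unit) (fun _ => 0) t
  have hm : ∀ u : ℝ, Measurable fun ω (_ : Unit) => Y u ω := fun u =>
    measurable_pi_lambda _ fun k => hY.measurable_apply _
  have h' := congrArg (fun μ => ∫⁻ y : Unit → ℝ, ‖y ()‖ₑ ^ 2 ∂μ) h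
  simp only [zero_add] at h'
  rwa [lintegral_map (by fun_prop) (hm _), lintegral_map (by fun_prop) (hm _)] at h'

theorem ae_convExistsAt [SFinite P] (hY : IsRegularProcess P Y) {g : ℝ → E} (hg : Integrable g)
    (t : ℝ) : ∀ᵐ ω ∂P, ConvExistsAt (fun s => Y s ω) g t := by
  obtain ⟨C, hC, h⟩ := hY.bounded
  have := ae_integrable_smul (P := P) (Z := fun s ω => Y (t - s) ω)
    (hY.measurable.comp ((measurable_const.sub measurable_fst).prodMk measurable_snd)) hg hC
    (fun s => h _)
  filter_upwards [this] with ω hω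
  exact (convExistsAt_iff _ _ _).2 hω

end IsRegularProcess

theorem lintegral_conv_sq_le [SFinite P] {Y : ℝ → Ω → ℝ}
    (hYm : Measurable (fun z : ℝ × Ω => Y z.1 z.2)) {g : ℝ → E} (hg : Integrable g)
    {C : ℝ≥0∞} (hC : C ≠ ∞) (h : ∀ t, ∫⁻ ω, ‖Y t ω‖ₑ ^ 2 ∂P ≤ C) (t : ℝ) :
    ∫⁻ ω, ‖conv (fun s => Y s ω) g t‖ₑ ^ 2 ∂P ≤ (∫⁻ s, ‖g s‖ₑ) ^ 2 * C := by
  simp only [conv_apply]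
  refine (lintegral_enorm_integral_smul_sq_le (P := P) (Z := fun s ω => Y (t - s) ω)
    (hYm.comp ((measurable_const.sub measurable_fst).prodMk measurable_snd))
    hg.aestronglyMeasurable).trans ?_
  calc _ ≤ (∫⁻ s, ‖g s‖ₑ) * ∫⁻ s, ‖g s‖ₑ * C := by gcongr; exact h _
    _ = _ := by rw [lintegral_mul_const' _ _ hC]; ring

/-- Mean square comparison of the convolutions of two processes with the same filter. -/
theorem lintegral_norm_conv_sub_sq_le [SFinite P] {Y Y' : ℝ → Ω → ℝ}
    (hY : Measurable (fun z : ℝ × Ω => Y z.1 z.2)) (hY' : Measurable (fun z : ℝ × Ω => Y' z.1 z.2))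
    {C : ℝ≥0∞} (hC : C ≠ ∞) (hYC : ∀ t, ∫⁻ ω, ‖Y t ω‖ₑ ^ 2 ∂P ≤ C)
    (hYC' : ∀ t, ∫⁻ ω, ‖Y' t ω‖ₑ ^ 2 ∂P ≤ C) {g : ℝ → E} (hg : Integrable g) (t t' : ℝ) :
    ∫⁻ ω, ‖‖conv (fun s => Y s ω) g t‖ - ‖conv (fun s => Y' s ω) g t'‖‖ₑ ^ 2 ∂P ≤
      (∫⁻ s, ‖g s‖ₑ) * ∫⁻ s, ‖g s‖ₑ * ∫⁻ ω, ‖Y (t - s) ω - Y' (t' - s) ω‖ₑ ^ 2 ∂P := by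
  have hm : Measurable fun z : ℝ × Ω => Y (t - z.1) z.2 :=
    hY.comp ((measurable_const.sub measurable_fst).prodMk measurable_snd)
  have hm' : Measurable fun z : ℝ × Ω => Y' (t' - z.1) z.2 :=
    hY'.comp ((measurable_const.sub measurable_fst).prodMk measurable_snd)
  refine le_trans (lintegral_mono_ae ?_) (lintegral_enorm_integral_smul_sq_le (P := P)
    (Z := fun s ω => Y (t - s) ω - Y' (t' - s) ω) (hm.sub hm') hg.aestronglyMeasurable)
  filter_upwards [ae_integrable_smul (P := P) (Z := fun s ω => Y (t - s) ω) hm hg hC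
    fun s => hYC _, ae_integrable_smul (P := P) (Z := fun s ω => Y' (t' - s) ω) hm' hg hC
    fun s => hYC' _] with ω h1 h2
  refine pow_le_pow_left₀ zero_le ?_ 2
  rw [conv_apply, conv_apply]
  simp only [sub_smul]
  rw [integral_sub h1 h2, enorm_le_iff_norm_le]
  exact abs_norm_sub_norm_le _ _

/-- The convolution in which the translation by `s` is rounded to the translation by `σ s`, so that
only finitely many values of `f` enter. -/
noncomputable def discreteConv (σ : SimpleFunc ℝ ℝ) (g : ℝ → E) (f : ℝ → ℝ) (t : ℝ) : E :=
  ∑ v ∈ σ.range, f (t - v) • ∫ s in σ ⁻¹' {v}, g s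

theorem discreteConv_eq_integral (σ : SimpleFunc ℝ ℝ) {g : ℝ → E} (hg : Integrable g) (f : ℝ → ℝ)
    (t : ℝ) : discreteConv σ g f t = ∫ s, f (t - σ s) • g s := by
  have e : ∀ s, f (t - σ s) • g s =
      ∑ v ∈ σ.range, (σ ⁻¹' {v}).indicator (fun s => f (t - v) • g s) s := by
    intro s
    rw [Finset.sum_eq_single (σ s)]
    · rw [Set.indicator_of_mem (by simp)]
    · intro v _ hv
      rw [Set.indicator_of_notMem]
      simpa using hv.symm
    · intro h
      exact absurd (σ.mem_range_self s) h
  simp only [e]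
  rw [integral_finsetSum]
  · refine Finset.sum_congr rfl fun v _ => ?_
    rw [integral_indicator (σ.measurableSet_fiber v), integral_smul]
  · intro v _
    exact (hg.smul _).indicator (σ.measurableSet_fiber v)

end SecondOrder

/-! ### Layers of the cascade of a regular process -/

section SecondOrder

variable {Ω : Type*} [MeasurableSpace Ω] {P : Measure Ω} {E : Type*} [NormedAddCommGroup E]
  [NormedSpace ℝ E]

theorem measurable_norm_conv {Y : ℝ → Ω → ℝ}
    (hY : Measurable (fun z : ℝ × Ω => Y z.1 z.2)) {g : ℝ → E}
    (hg : Integrable g) :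
    Measurable (fun z : ℝ × Ω => ‖conv (fun s => Y s z.2) g z.1‖) :=
  (stronglyMeasurable_conv hY hg.aestronglyMeasurable).norm.measurable

namespace IsRegularProcess

variable {Y : ℝ → Ω → ℝ}

/-- Discretized convolutions converge in mean square, by uniform continuity in mean square. -/
theorem tendsto_discreteConv [SFinite P] (hY : IsRegularProcess P Y) {g : ℝ → E}
    (hg : Integrable g) {σ : ℕ → SimpleFunc ℝ ℝ}
    (hσ : ∀ s, Filter.Tendsto (fun k => σ k s) Filter.atTop (𝓝 s)) (t : ℝ) :
    Filter.Tendsto (fun k => ∫⁻ ω, ‖‖discreteConv (σ k) g (fun s => Y s ω) t‖ -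
      ‖conv (fun s => Y s ω) g t‖‖ₑ ^ 2 ∂P) Filter.atTop (𝓝 0) := by
  obtain ⟨C, hC, hYC⟩ := hY.bounded
  have hZm : ∀ k, Measurable fun z : ℝ × Ω => Y (t - σ k z.1) z.2 - Y (t - z.1) z.2 := fun k =>
    (hY.measurable.comp ((measurable_const.sub ((σ k).measurable.comp measurable_fst)).prodMk
      measurable_snd)).sub
    (hY.measurable.comp ((measurable_const.sub measurable_fst).prodMk measurable_snd))
  have hbd : ∀ k s, ∫⁻ ω, ‖Y (t - σ k s) ω - Y (t - s) ω‖ₑ ^ 2 ∂P ≤ 2 * (C + C) := fun k s =>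
    lintegral_enorm_sub_sq_le (hY.measurable_apply _) (hYC _) (hYC _)
  have hle : ∀ k, ∫⁻ ω, ‖‖discreteConv (σ k) g (fun s => Y s ω) t‖ -
      ‖conv (fun s => Y s ω) g t‖‖ₑ ^ 2 ∂P ≤
      (∫⁻ s, ‖g s‖ₑ) * ∫⁻ s, ‖g s‖ₑ * ∫⁻ ω, ‖Y (t - σ k s) ω - Y (t - s) ω‖ₑ ^ 2 ∂P := by
    intro k
    refine le_trans (lintegral_mono_ae ?_) (lintegral_enorm_integral_smul_sq_le (P := P)
      (Z := fun s ω => Y (t - σ k s) ω - Y (t - s) ω) (hZm k) hg.aestronglyMeasurable)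
    filter_upwards [ae_integrable_smul (P := P) (Z := fun s ω => Y (t - s) ω)
        (hY.measurable.comp ((measurable_const.sub measurable_fst).prodMk measurable_snd)) hg hC
        fun s => hYC _,
      ae_integrable_smul (P := P) (Z := fun s ω => Y (t - σ k s) ω)
        (hY.measurable.comp ((measurable_const.sub ((σ k).measurable.comp measurable_fst)).prodMk
        measurable_snd)) hg hC fun s => hYC _] with ω h1 h2
    refine pow_le_pow_left₀ zero_le ?_ 2
    rw [discreteConv_eq_integral _ hg, conv_apply]
    simp only [sub_smul]
    rw [integral_sub h2 h1, enorm_le_iff_norm_le]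
    exact abs_norm_sub_norm_le _ _
  have hlim : Filter.Tendsto (fun k => ∫⁻ s, ‖g s‖ₑ *
      ∫⁻ ω, ‖Y (t - σ k s) ω - Y (t - s) ω‖ₑ ^ 2 ∂P) Filter.atTop (𝓝 (∫⁻ _ : ℝ, 0)) := by
    refine tendsto_lintegral_of_dominated_convergence' (fun s => ‖g s‖ₑ * (2 * (C + C)))
      (fun k => ?_) (fun k => ?_) ?_ ?_
    · exact hg.aestronglyMeasurable.enorm.mul
        ((hZm k).enorm.pow_const 2).lintegral_prod_right'.aemeasurable
    · exact Filter.Eventually.of_forall fun s => mul_le_mul_right (hbd k s) _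
    · have h1 : 2 * (C + C) ≠ ∞ := ENNReal.mul_ne_top ENNReal.ofNat_ne_top (by simp [hC])
      rw [lintegral_mul_const' _ _ h1]
      exact ENNReal.mul_ne_top hg.2.ne h1
    · refine Filter.Eventually.of_forall fun s => ?_
      have h0 : Filter.Tendsto (fun k => ∫⁻ ω, ‖Y (t - σ k s) ω - Y (t - s) ω‖ₑ ^ 2 ∂P)
          Filter.atTop (𝓝 0) := by
        rw [ENNReal.tendsto_nhds_zero]
        intro ε hε
        obtain ⟨δ, hδ, h⟩ := hY.uniformContinuous ε hε.ne'
        filter_upwards [Metric.tendsto_nhds.1 (hσ s) δ hδ] with k hk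
        refine h _ _ ?_
        rw [Real.dist_eq] at hk
        rwa [sub_sub_sub_cancel_left, abs_sub_comm]
      simpa using ENNReal.Tendsto.const_mul h0 (Or.inr enorm_ne_top)
  have h := ENNReal.Tendsto.const_mul (a := ∫⁻ s, ‖g s‖ₑ) hlim (Or.inr hg.2.ne)
  rw [lintegral_zero, mul_zero] at h
  exact tendsto_of_tendsto_of_tendsto_of_le_of_le tendsto_const_nhds h (fun _ => zero_le) hle

/-- Stationarity is inherited by the modulus of a convolution: discretized convolutions are
functions of finitely many values of the process, and laws pass to limits in mean square. -/
theorem isStationaryProcess_norm_conv [IsProbabilityMeasure P] (hY : IsRegularProcess P Y)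
    {g : ℝ → E} (hg : Integrable g) :
    IsStationaryProcess P (fun t ω => ‖conv (fun s => Y s ω) g t‖) := by
  intro m t h
  obtain ⟨σ, hσ⟩ : ∃ σ : ℕ → SimpleFunc ℝ ℝ,
      ∀ s, Filter.Tendsto (fun k => σ k s) Filter.atTop (𝓝 s) :=
    ⟨fun k => SimpleFunc.approxOn id measurable_id Set.univ 0 (Set.mem_univ _) k,
      fun s => SimpleFunc.tendsto_approxOn measurable_id (Set.mem_univ _) (by simp)⟩
  set V : ℝ → Ω → (Fin m → ℝ) := fun u ω i => ‖conv (fun s => Y s ω) g (t i + u)‖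
  set W : ℝ → ℕ → Ω → (Fin m → ℝ) := fun u k ω i =>
    ‖discreteConv (σ k) g (fun s => Y s ω) (t i + u)‖ with hW
  let Φ : ∀ k, (Fin m × (σ k).range → ℝ) → (Fin m → ℝ) := fun k y i =>
    ‖∑ v : (σ k).range, y (i, v) • ∫ s in (σ k) ⁻¹' {v.1}, g s‖
  have hΦ : ∀ k, Measurable (Φ k) := fun k => by
    refine Continuous.measurable (continuous_pi fun i => Continuous.norm ?_)
    exact continuous_finsetSum _ fun v _ => (continuous_apply _).smul continuous_const
  have hWΦ : ∀ u k, W u k = Φ k ∘ fun ω (p : Fin m × (σ k).range) => Y (t p.1 - p.2 + u) ω := by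
    intro u k
    ext ω i
    simp only [hW, Φ, Function.comp_apply, discreteConv]
    rw [← Finset.sum_coe_sort]
    congr 1
    refine Finset.sum_congr rfl fun v _ => ?_
    congr 2
    ring
  have hYm : ∀ u k, Measurable fun ω (p : Fin m × (σ k).range) => Y (t p.1 - p.2 + u) ω :=
    fun u k => measurable_pi_lambda _ fun p => hY.measurable_apply _
  have hWm : ∀ u k, Measurable (W u k) := fun u k => by
    rw [hWΦ]; exact (hΦ k).comp (hYm u k)
  have hVm : ∀ u, Measurable (V u) := fun u => measurable_pi_lambda _ fun i =>
    (measurable_norm_conv hY.measurable hg).comp (measurable_const.prodMk measurable_id)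
  have hlaw : ∀ k, P.map (W h k) = P.map (W 0 k) := by
    intro k
    rw [hWΦ, hWΦ, ← Measure.map_map (hΦ k) (hYm h k), ← Measure.map_map (hΦ k) (hYm 0 k),
      hY.map_eq (fun p : Fin m × (σ k).range => t p.1 - p.2) h,
      hY.map_eq (fun p : Fin m × (σ k).range => t p.1 - p.2) 0]
  have hconv : ∀ u, TendstoInMeasure P (W u) Filter.atTop (V u) := by
    intro u
    refine tendstoInMeasure_of_tendsto_eLpNorm (p := 2) two_ne_zero
      (fun k => (hWm u k).aestronglyMeasurable) (hVm u).aestronglyMeasurable ?_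
    have hsq : Filter.Tendsto (fun k => eLpNorm (W u k - V u) 2 P ^ 2) Filter.atTop (𝓝 0) := by
      have hsum := tendsto_finsetSum Finset.univ fun (i : Fin m) _ =>
        hY.tendsto_discreteConv hg hσ (t i + u)
      rw [Finset.sum_const_zero] at hsum
      refine tendsto_of_tendsto_of_tendsto_of_le_of_le tendsto_const_nhds hsum
        (fun _ => zero_le) (fun k => ?_)
      rw [← lintegral_enorm_sq_eq, ← lintegral_finsetSum]
      · refine lintegral_mono fun ω => ?_
        rcases isEmpty_or_nonempty (Fin m) with hm | hm
        · have : (W u k - V u) ω = 0 := Subsingleton.elim _ _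
          simp [this]
        · obtain ⟨i, hi⟩ := Finite.exists_max fun i => ‖(W u k - V u) ω i‖
          have hnorm : ‖(W u k - V u) ω‖ₑ ≤ ‖(W u k - V u) ω i‖ₑ := by
            rw [enorm_le_iff_norm_le]
            exact (pi_norm_le_iff_of_nonempty _).2 hi
          refine (pow_le_pow_left₀ zero_le hnorm 2).trans ?_
          exact Finset.single_le_sum (f := fun i : Fin m =>
            ‖‖discreteConv (σ k) g (fun s => Y s ω) (t i + u)‖ -
              ‖conv (fun s => Y s ω) g (t i + u)‖‖ₑ ^ 2) (fun _ _ => zero_le) (Finset.mem_univ i)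
      · intro i _
        exact (((measurable_pi_apply i).comp (hWm u k)).sub
          ((measurable_pi_apply i).comp (hVm u))).enorm.pow_const 2
    have := hsq.ennrpow_const (1 / 2 : ℝ)
    rw [ENNReal.zero_rpow_of_pos (by norm_num)] at this
    refine this.congr fun k => ?_
    rw [← ENNReal.rpow_natCast, ← ENNReal.rpow_mul]
    norm_num
  have hd0 := (hconv 0).tendstoInDistribution fun k => (hWm 0 k).aemeasurable
  have hdh := (hconv h).tendstoInDistribution fun k => (hWm h k).aemeasurable
  have hd0' : TendstoInDistribution (W 0) Filter.atTop (V h) (fun _ => P) P := by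
    exact ⟨hd0.forall_aemeasurable, hdh.aemeasurable_limit,
      hdh.tendsto.congr fun k => Subtype.ext (hlaw k)⟩
  have := tendstoInDistribution_unique _ hd0 hd0'
  simpa [V] using this.symm

/-- A layer of the cascade maps regular processes to regular processes. -/
theorem norm_conv [IsProbabilityMeasure P] (hY : IsRegularProcess P Y) {g : ℝ → E}
    (hg : Integrable g) : IsRegularProcess P (fun t ω => ‖conv (fun s => Y s ω) g t‖) := by
  obtain ⟨C, hC, hYC⟩ := hY.bounded
  have hgf : ∫⁻ s, ‖g s‖ₑ ≠ ∞ := hg.2.ne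
  refine ⟨measurable_norm_conv hY.measurable hg, ⟨(∫⁻ s, ‖g s‖ₑ) ^ 2 * C,
    ENNReal.mul_ne_top (by finiteness) hC, fun t => ?_⟩, fun ε hε => ?_,
    hY.isStationaryProcess_norm_conv hg⟩
  · simpa only [enorm_norm] using lintegral_conv_sq_le hY.measurable hg hC hYC t
  · obtain ⟨η, hη, hηε⟩ : ∃ η : ℝ≥0∞, η ≠ 0 ∧ (∫⁻ s, ‖g s‖ₑ) ^ 2 * η ≤ ε := by
      refine ⟨ε / ((∫⁻ s, ‖g s‖ₑ) ^ 2), ?_, ENNReal.mul_div_le⟩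
      simp only [ne_eq, ENNReal.div_eq_zero_iff, hε, false_or]
      finiteness
    obtain ⟨δ, hδ, h⟩ := hY.uniformContinuous (min η 1) (by simp [hη])
    refine ⟨δ, hδ, fun s t hst => ?_⟩
    refine (lintegral_norm_conv_sub_sq_le hY.measurable hY.measurable hC hYC hYC hg s t).trans ?_
    calc _ ≤ (∫⁻ s, ‖g s‖ₑ) * ∫⁻ s, ‖g s‖ₑ * min η 1 := by
          gcongr with u
          exact h _ _ (by simpa using hst)
      _ = (∫⁻ s, ‖g s‖ₑ) ^ 2 * min η 1 := by
          rw [lintegral_mul_const' _ _ (ne_top_of_le_ne_top ENNReal.one_ne_top (min_le_right _ _))]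
          ring
      _ ≤ _ := le_trans (by gcongr; exact min_le_left _ _) hηε

theorem scatU [IsProbabilityMeasure P] {ψ : ℝ → ℂ} (hψ : Integrable ψ) (p : List ℤ)
    (hY : IsRegularProcess P Y) : IsRegularProcess P (fun t ω => scatU ψ p (fun s => Y s ω) t) := by
  induction p generalizing Y with
  | nil => exact hY
  | cons j q ih => exact ih (hY.norm_conv (integrable_wavelet hψ j))

end IsRegularProcess

/-! ### Processes with integrable autocovariance -/

namespace IsAdmissibleProcess

variable {X : ℝ → Ω → ℝ}

/-- Stationarity of the two-point distributions. -/
theorem map_eq (hX : IsAdmissibleProcess P X) (s t : ℝ) :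
    P.map (fun ω => (X s ω, X t ω)) = P.map (fun ω => (X (s - t) ω, X 0 ω)) := by
  have h := hX.stationary 2 ![s - t, 0] t
  have hm : ∀ u : Fin 2 → ℝ, Measurable fun ω i => X (u i) ω := fun u =>
    measurable_pi_lambda _ fun i => hX.measurable.comp (measurable_const.prodMk measurable_id)
  have hr : Measurable fun y : Fin 2 → ℝ => (y 0, y 1) :=
    (measurable_pi_apply 0).prodMk (measurable_pi_apply 1)
  have h' := congrArg (fun μ => Measure.map (fun y : Fin 2 → ℝ => (y 0, y 1)) μ) h
  rw [Measure.map_map hr (hm fun i => (![s - t, 0] : Fin 2 → ℝ) i + t),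
    Measure.map_map hr (hm ![s - t, 0])] at h'
  simpa [Function.comp_def] using h'

theorem measurable_apply (hX : IsAdmissibleProcess P X) (t : ℝ) : Measurable (X t) :=
  hX.measurable.comp (measurable_const.prodMk measurable_id)

/-- Two-point expectations depend on the time difference only. -/
theorem integral_comp_eq (hX : IsAdmissibleProcess P X) {F : ℝ × ℝ → ℝ} (hF : Measurable F)
    (s t : ℝ) : ∫ ω, F (X s ω, X t ω) ∂P = ∫ ω, F (X (s - t) ω, X 0 ω) ∂P := by
  have hm : ∀ u v, AEMeasurable (fun ω => (X u ω, X v ω)) P := fun u v =>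
    ((hX.measurable_apply u).prodMk (hX.measurable_apply v)).aemeasurable
  rw [← integral_map (hm s t) hF.aestronglyMeasurable, hX.map_eq,
    integral_map (hm _ _) hF.aestronglyMeasurable]

theorem integral_eq (hX : IsAdmissibleProcess P X) (t : ℝ) : ∫ ω, X t ω ∂P = ∫ ω, X 0 ω ∂P := by
  simpa using hX.integral_comp_eq measurable_snd 0 t

theorem integral_sq_eq (hX : IsAdmissibleProcess P X) (t : ℝ) :
    ∫ ω, X t ω ^ 2 ∂P = ∫ ω, X 0 ω ^ 2 ∂P := by
  simpa using hX.integral_comp_eq (F := fun p => p.2 ^ 2) (by fun_prop) 0 t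

theorem lintegral_enorm_sq_apply (hX : IsAdmissibleProcess P X) (t : ℝ) :
    ∫⁻ ω, ‖X t ω‖ₑ ^ 2 ∂P = ENNReal.ofReal (∫ ω, X 0 ω ^ 2 ∂P) := by
  rw [lintegral_enorm_sq_eq_ofReal (hX.memLp_two t), hX.integral_sq_eq]

theorem integral_mul_eq [IsProbabilityMeasure P] (hX : IsAdmissibleProcess P X) (s t : ℝ) :
    ∫ ω, X s ω * X t ω ∂P = autocov P X (s - t) + (∫ ω, X 0 ω ∂P) ^ 2 := by
  rw [autocov, covariance_eq_sub (hX.memLp_two _) (hX.memLp_two _), hX.integral_eq (s - t)]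
  have := hX.integral_comp_eq (F := fun p => p.1 * p.2) (by fun_prop) s t
  simp only at this
  rw [this]
  simp only [Pi.mul_apply]
  ring

theorem integral_sub_sq_eq [IsProbabilityMeasure P] (hX : IsAdmissibleProcess P X) (s t : ℝ) :
    ∫ ω, (X s ω - X t ω) ^ 2 ∂P = 2 * (autocov P X 0 - autocov P X (s - t)) := by
  have e : ∀ ω, (X s ω - X t ω) ^ 2 = X s ω ^ 2 + X t ω ^ 2 - 2 * (X s ω * X t ω) := fun ω => by
    ring
  have hs := (hX.memLp_two s).integrable_sq
  have ht := (hX.memLp_two t).integrable_sq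
  have hadd : Integrable (fun ω => X s ω ^ 2 + X t ω ^ 2) P := hs.add ht
  have hst : Integrable (fun ω => X s ω * X t ω) P :=
    (hX.memLp_two s).integrable_mul (hX.memLp_two t)
  have h0 : ∀ u, ∫ ω, X u ω ^ 2 ∂P = autocov P X 0 + (∫ ω, X 0 ω ∂P) ^ 2 := fun u => by
    have := hX.integral_mul_eq u u
    simpa [sq] using this
  simp only [e]
  rw [integral_sub hadd (hst.const_mul 2), integral_add hs ht, integral_const_mul,
    h0, h0, hX.integral_mul_eq]
  ring

/-- Uniform continuity in mean square is continuity of the autocovariance at `0`. -/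
theorem isRegularProcess [IsProbabilityMeasure P] (hX : IsAdmissibleProcess P X) :
    IsRegularProcess P X := by
  refine ⟨hX.measurable, ⟨ENNReal.ofReal (∫ ω, X 0 ω ^ 2 ∂P), ENNReal.ofReal_ne_top, fun t => ?_⟩,
    fun ε hε => ?_, hX.stationary⟩
  · rw [lintegral_enorm_sq_eq_ofReal (hX.memLp_two t), hX.integral_sq_eq]
  · have hc : Filter.Tendsto (fun u => ENNReal.ofReal (2 * (autocov P X 0 - autocov P X u)))
        (𝓝 0) (𝓝 0) := by
      have := (ENNReal.continuous_ofReal.comp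
        (continuous_const.mul (continuous_const.sub hX.continuous_autocov))).tendsto (x := (0 : ℝ))
        (f := fun u => ENNReal.ofReal (2 * (autocov P X 0 - autocov P X u)))
      simpa using this
    obtain ⟨δ, hδ, h⟩ := Metric.eventually_nhds_iff.1
      (ENNReal.tendsto_nhds_zero.1 hc ε (pos_iff_ne_zero.2 hε))
    refine ⟨δ, hδ, fun s t hst => ?_⟩
    have := lintegral_enorm_sq_eq_ofReal ((hX.memLp_two s).sub (hX.memLp_two t))
    simp only [Pi.sub_apply] at this
    rw [this, hX.integral_sub_sq_eq]
    exact h (by simpa using hst)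

end IsAdmissibleProcess

end SecondOrder

/-! ### Local approximation of processes -/

theorem exists_tail_le {E : Type*} [NormedAddCommGroup E] {g : ℝ → E} (hg : Integrable g)
    {τ : ℝ≥0∞} (hτ : τ ≠ 0) :
    ∃ A : ℝ, ∫⁻ s, {s : ℝ | A < |s|}.indicator (fun s => ‖g s‖ₑ) s ≤ τ := by
  have hlim : Filter.Tendsto (fun n : ℕ => ∫⁻ s, {s : ℝ | (n : ℝ) < |s|}.indicator
      (fun s => ‖g s‖ₑ) s) Filter.atTop (𝓝 (∫⁻ _ : ℝ, 0)) := by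
    refine tendsto_lintegral_of_dominated_convergence' (fun s => ‖g s‖ₑ) (fun n => ?_) (fun n => ?_)
      hg.2.ne ?_
    · exact hg.aestronglyMeasurable.enorm.indicator
        (measurableSet_lt measurable_const measurable_norm)
    · exact Filter.Eventually.of_forall fun s => Set.indicator_le_self _ _ s
    · refine Filter.Eventually.of_forall fun s => ?_
      refine tendsto_const_nhds.congr' ?_
      filter_upwards [Filter.eventually_ge_atTop ⌈|s|⌉₊] with n hn
      rw [Set.indicator_of_notMem]
      simpa using Nat.ceil_le.1 hn
  rw [lintegral_zero] at hlim
  obtain ⟨n, hn⟩ := (ENNReal.tendsto_nhds_zero.1 hlim τ (pos_iff_ne_zero.2 hτ)).exists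
  exact ⟨n, hn⟩

section Window

variable {Ω : Type*} [MeasurableSpace Ω] {P : Measure Ω} {E : Type*} [NormedAddCommGroup E]
  [NormedSpace ℝ E]

/-- The family `Z N` of processes approximates `Y` in mean square on `[-N, N]`, away from the end
points and uniformly in `N`. -/
structure IsLocalApprox (P : Measure Ω) (Y : ℝ → Ω → ℝ) (Z : ℝ → ℝ → Ω → ℝ) : Prop where
  measurable : Measurable (fun z : ℝ × Ω => Y z.1 z.2)
  measurable_approx : ∀ N, Measurable (fun z : ℝ × Ω => Z N z.1 z.2)
  bounded : ∃ C : ℝ≥0∞, C ≠ ∞ ∧ (∀ t, ∫⁻ ω, ‖Y t ω‖ₑ ^ 2 ∂P ≤ C) ∧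
    ∀ N t, ∫⁻ ω, ‖Z N t ω‖ₑ ^ 2 ∂P ≤ C
  approx : ∀ ε : ℝ≥0∞, ε ≠ 0 → ∃ M : ℝ, ∀ N t, |t| ≤ N - M →
    ∫⁻ ω, ‖Y t ω - Z N t ω‖ₑ ^ 2 ∂P ≤ ε

namespace IsLocalApprox

variable {Y : ℝ → Ω → ℝ} {Z : ℝ → ℝ → Ω → ℝ}

/-- A layer of the cascade preserves local approximation: up to a small tail, the filter does not
see beyond the window. -/
theorem norm_conv [SFinite P] (h : IsLocalApprox P Y Z) {g : ℝ → E} (hg : Integrable g) :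
    IsLocalApprox P (fun t ω => ‖conv (fun s => Y s ω) g t‖)
      (fun N t ω => ‖conv (fun s => Z N s ω) g t‖) := by
  obtain ⟨C, hC, hYC, hZC⟩ := h.bounded
  have hgf : ∫⁻ s, ‖g s‖ₑ ≠ ∞ := hg.2.ne
  refine ⟨measurable_norm_conv h.measurable hg,
    fun N => measurable_norm_conv (h.measurable_approx N) hg,
    ⟨(∫⁻ s, ‖g s‖ₑ) ^ 2 * C, ENNReal.mul_ne_top (by finiteness) hC, fun t => ?_, fun N t => ?_⟩,
    fun ε hε => ?_⟩
  · simpa only [enorm_norm] using lintegral_conv_sq_le h.measurable hg hC hYC t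
  · simpa only [enorm_norm] using
      lintegral_conv_sq_le (h.measurable_approx N) hg hC (hZC N) t
  · set D : ℝ≥0∞ := 2 * (C + C)
    have hD : D ≠ ∞ := ENNReal.mul_ne_top ENNReal.ofNat_ne_top (by simp [hC])
    set G : ℝ≥0∞ := ∫⁻ s, ‖g s‖ₑ
    -- `η` makes each of the two contributions at most `ε / 2`
    obtain ⟨η, hη, hη1, hηG, hηD⟩ : ∃ η : ℝ≥0∞, η ≠ 0 ∧ η ≠ ∞ ∧ G * (G * η) ≤ ε / 2 ∧
        G * (η * D) ≤ ε / 2 := by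
      have hε2 : ε / 2 ≠ 0 := by simp [hε]
      refine ⟨min 1 (min (ε / 2 / (G * G)) (ε / 2 / (G * D))), ?_, ?_, ?_, ?_⟩
      · refine (lt_min one_pos (lt_min ?_ ?_)).ne'
        · exact ENNReal.div_pos hε2 (ENNReal.mul_ne_top hgf hgf)
        · exact ENNReal.div_pos hε2 (ENNReal.mul_ne_top hgf hD)
      · exact ne_top_of_le_ne_top ENNReal.one_ne_top (min_le_left _ _)
      · calc G * (G * _) ≤ G * (G * (ε / 2 / (G * G))) := by
              gcongr; exact (min_le_right _ _).trans (min_le_left _ _)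
          _ = (G * G) * (ε / 2 / (G * G)) := by ring
          _ ≤ _ := ENNReal.mul_div_le
      · calc G * (_ * D) ≤ G * (ε / 2 / (G * D) * D) := by
              gcongr; exact (min_le_right _ _).trans (min_le_right _ _)
          _ = (G * D) * (ε / 2 / (G * D)) := by ring
          _ ≤ _ := ENNReal.mul_div_le
    obtain ⟨M, hM⟩ := h.approx η hη
    obtain ⟨A, hA⟩ := exists_tail_le hg hη
    refine ⟨M + A, fun N t ht => ?_⟩
    refine (lintegral_norm_conv_sub_sq_le h.measurable (h.measurable_approx N) hC hYC (hZC N)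
      hg t t).trans ?_
    have hpt : ∀ s, ‖g s‖ₑ * ∫⁻ ω, ‖Y (t - s) ω - Z N (t - s) ω‖ₑ ^ 2 ∂P ≤
        ‖g s‖ₑ * η + {s : ℝ | A < |s|}.indicator (fun s => ‖g s‖ₑ) s * D := by
      intro s
      by_cases hs : A < |s|
      · rw [Set.indicator_of_mem (by exact hs)]
        refine le_trans ?_ le_add_self
        gcongr
        exact lintegral_enorm_sub_sq_le (h.measurable.comp (measurable_const.prodMk measurable_id))
          (hYC _) (hZC _ _)
      · refine le_trans ?_ le_self_add
        gcongr
        refine hM N (t - s) ?_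
        have := abs_sub t s
        linarith [not_lt.1 hs]
    calc _ ≤ G * ∫⁻ s, (‖g s‖ₑ * η + {s : ℝ | A < |s|}.indicator (fun s => ‖g s‖ₑ) s * D) := by
          gcongr with s; exact hpt s
      _ = G * (G * η + (∫⁻ s, {s : ℝ | A < |s|}.indicator (fun s => ‖g s‖ₑ) s) * D) := by
          rw [lintegral_add_left' (hg.aestronglyMeasurable.enorm.mul_const _),
            lintegral_mul_const' _ _ hη1, lintegral_mul_const' _ _ hD]
      _ ≤ G * (G * η) + G * (η * D) := by rw [mul_add]; gcongr
      _ ≤ ε / 2 + ε / 2 := add_le_add hηG hηD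
      _ = ε := ENNReal.add_halves ε

theorem scatU [SFinite P] {ψ : ℝ → ℂ} (hψ : Integrable ψ) (p : List ℤ)
    (h : IsLocalApprox P Y Z) : IsLocalApprox P (fun t ω => scatU ψ p (fun s => Y s ω) t)
      (fun N t ω => _root_.scatU ψ p (fun s => Z N s ω) t) := by
  induction p generalizing Y Z with
  | nil => exact h
  | cons j q ih => exact ih (h.norm_conv (integrable_wavelet hψ j))

end IsLocalApprox

/-- Young's inequality for the square of `y = z + (y - z)`. -/
theorem enorm_sq_le_add {θ : ℝ} (hθ : 0 < θ) (y z : ℝ) :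
    ‖y‖ₑ ^ 2 ≤ ENNReal.ofReal (1 + θ) * ‖z‖ₑ ^ 2 + ENNReal.ofReal (1 + θ⁻¹) * ‖y - z‖ₑ ^ 2 := by
  have e : ∀ x : ℝ, ‖x‖ₑ ^ 2 = ENNReal.ofReal (x ^ 2) := fun x => by
    rw [← ofReal_norm, ← ENNReal.ofReal_pow (norm_nonneg _), Real.norm_eq_abs, sq_abs]
  rw [e, e, e, ← ENNReal.ofReal_mul (by positivity), ← ENNReal.ofReal_mul (by positivity),
    ← ENNReal.ofReal_add (by positivity) (by positivity)]
  refine ENNReal.ofReal_le_ofReal ?_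
  have h := sq_nonneg (θ * z - (y - z))
  have h2 : 0 ≤ θ⁻¹ * (θ * z - (y - z)) ^ 2 := by positivity
  have h3 : θ⁻¹ * (θ * z - (y - z)) ^ 2 =
      θ * z ^ 2 - 2 * (z * (y - z)) + θ⁻¹ * (y - z) ^ 2 := by
    field_simp
    ring
  nlinarith

/-- Energy bounds for local approximations over `[-N, N]` pass to second moments that do not depend
on time, since the boundary effects are negligible compared to `N`. -/
theorem sum_lintegral_sq_le_of_isLocalApprox [SFinite P] {ι : Type*} [Fintype ι]
    {Y : ι → ℝ → Ω → ℝ} {Z : ι → ℝ → ℝ → Ω → ℝ} (h : ∀ i, IsLocalApprox P (Y i) (Z i))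
    (hY : ∀ i t, ∫⁻ ω, ‖Y i t ω‖ₑ ^ 2 ∂P = ∫⁻ ω, ‖Y i 0 ω‖ₑ ^ 2 ∂P) {b : ℝ} (hb : 0 ≤ b)
    (hZ : ∀ N, 0 ≤ N → ∑ i, ∫⁻ t, ∫⁻ ω, ‖Z i N t ω‖ₑ ^ 2 ∂P ≤ ENNReal.ofReal (2 * N * b)) :
    ∑ i, ∫⁻ ω, ‖Y i 0 ω‖ₑ ^ 2 ∂P ≤ ENNReal.ofReal b := by
  set S := ∑ i, ∫⁻ ω, ‖Y i 0 ω‖ₑ ^ 2 ∂P with hSdef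
  have hS : S ≠ ∞ := ENNReal.sum_ne_top.2 fun i _ => by
    obtain ⟨C, hC, hYC, -⟩ := (h i).bounded
    exact ne_top_of_le_ne_top hC (hYC 0)
  have key : ∀ θ : ℝ, 0 < θ → S.toReal ≤ (1 + θ) * b + θ := by
    intro θ hθ
    -- the tolerance for which the errors of all processes sum up to at most `θ`
    set ε : ℝ := θ / ((1 + θ⁻¹) * (Fintype.card ι + 1))
    have hε : 0 < ε := by positivity
    choose M hM using fun i => (h i).approx (ENNReal.ofReal ε) (by simpa using hε)
    set M' := ∑ i, |M i|
    have hMM' : ∀ i, M i ≤ M' := fun i =>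
      (le_abs_self _).trans (Finset.single_le_sum (f := fun i => |M i|)
        (fun _ _ => abs_nonneg _) (Finset.mem_univ i))
    have hM'0 : 0 ≤ M' := Finset.sum_nonneg fun _ _ => abs_nonneg _
    have hpt : ∀ N t, |t| ≤ N - M' →
        S ≤ ENNReal.ofReal (1 + θ) * ∑ i, ∫⁻ ω, ‖Z i N t ω‖ₑ ^ 2 ∂P + ENNReal.ofReal θ := by
      intro N t ht
      calc S = ∑ i, ∫⁻ ω, ‖Y i t ω‖ₑ ^ 2 ∂P := by simp only [hSdef, hY]
        _ ≤ ∑ i, (ENNReal.ofReal (1 + θ) * ∫⁻ ω, ‖Z i N t ω‖ₑ ^ 2 ∂P +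
            ENNReal.ofReal (1 + θ⁻¹) * ENNReal.ofReal ε) := by
          refine Finset.sum_le_sum fun i _ => ?_
          have hZm : Measurable (Z i N t) :=
            ((h i).measurable_approx N).comp (measurable_const.prodMk measurable_id)
          refine (lintegral_mono fun ω => enorm_sq_le_add hθ (Y i t ω) (Z i N t ω)).trans ?_
          rw [lintegral_add_left ((hZm.enorm.pow_const 2).const_mul _),
            lintegral_const_mul' _ _ ENNReal.ofReal_ne_top,
            lintegral_const_mul' _ _ ENNReal.ofReal_ne_top]
          gcongr
          exact hM i N t (ht.trans (by linarith [hMM' i]))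
        _ ≤ _ := by
          rw [Finset.sum_add_distrib, ← Finset.mul_sum]
          gcongr
          rw [Finset.sum_const, Finset.card_univ, nsmul_eq_mul,
            ← ENNReal.ofReal_mul (by positivity), ← ENNReal.ofReal_natCast,
            ← ENNReal.ofReal_mul (by positivity)]
          refine ENNReal.ofReal_le_ofReal ?_
          have : (1 + θ⁻¹) * ε * (Fintype.card ι + 1) = θ := by
            simp only [ε]; field_simp
          nlinarith [show 0 ≤ (1 + θ⁻¹) * ε by positivity]
    have hint : ∀ N, M' ≤ N → 2 * (N - M') * S.toReal ≤
        (1 + θ) * (2 * N * b) + 2 * (N - M') * θ := by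
      intro N hN
      have hN0 : 0 ≤ N := hM'0.trans hN
      have hL : 0 ≤ 2 * (N - M') := by linarith
      have hvol : volume (Set.Icc (-(N - M')) (N - M')) = ENNReal.ofReal (2 * (N - M')) := by
        rw [Real.volume_Icc]; congr 1; ring
      have h1 : S * ENNReal.ofReal (2 * (N - M')) ≤
          ENNReal.ofReal (1 + θ) * ENNReal.ofReal (2 * N * b) +
            ENNReal.ofReal θ * ENNReal.ofReal (2 * (N - M')) := by
        calc S * ENNReal.ofReal (2 * (N - M'))
            = ∫⁻ _ in Set.Icc (-(N - M')) (N - M'), S := by rw [setLIntegral_const, hvol]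
          _ ≤ ∫⁻ t in Set.Icc (-(N - M')) (N - M'),
              (ENNReal.ofReal (1 + θ) * ∑ i, ∫⁻ ω, ‖Z i N t ω‖ₑ ^ 2 ∂P + ENNReal.ofReal θ) := by
            refine setLIntegral_mono' measurableSet_Icc fun t ht => hpt N t ?_
            exact abs_le.2 ht
          _ = ENNReal.ofReal (1 + θ) * (∫⁻ t in Set.Icc (-(N - M')) (N - M'),
              ∑ i, ∫⁻ ω, ‖Z i N t ω‖ₑ ^ 2 ∂P) + ENNReal.ofReal θ *
                ENNReal.ofReal (2 * (N - M')) := by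
            rw [lintegral_add_right _ measurable_const,
              lintegral_const_mul' _ _ ENNReal.ofReal_ne_top, setLIntegral_const, hvol]
          _ ≤ _ := by
            gcongr
            refine (setLIntegral_le_lintegral _ _).trans ?_
            rw [lintegral_finsetSum]
            · exact hZ N hN0
            · intro i _
              exact (((h i).measurable_approx N).enorm.pow_const 2).lintegral_prod_right'
      rw [← ENNReal.ofReal_toReal hS, ← ENNReal.ofReal_mul ENNReal.toReal_nonneg,
        ← ENNReal.ofReal_mul (by positivity), ← ENNReal.ofReal_mul hθ.le,
        ← ENNReal.ofReal_add (by positivity) (by positivity),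
        ENNReal.ofReal_le_ofReal_iff (by positivity)] at h1
      linarith
    by_contra! hcon
    set d := S.toReal - ((1 + θ) * b + θ)
    have hd : 0 < d := by simp only [d]; linarith
    -- for large `N` the deficit `N d` exceeds the boundary terms
    set K := (M' + 1) * (S.toReal + 1) / d
    have hS0 : 0 ≤ S.toReal := ENNReal.toReal_nonneg
    have hK : 0 ≤ K := by positivity
    have h2 := hint (M' + K) (by linarith)
    have h3 : K * d = (M' + 1) * (S.toReal + 1) := by simp only [K]; field_simp
    have h4 : S.toReal = d + (1 + θ) * b + θ := by simp only [d]; ring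
    have h5 : K * d ≤ M' * ((1 + θ) * b) := by
      have : K * S.toReal = K * d + K * ((1 + θ) * b) + K * θ := by rw [h4]; ring
      nlinarith
    have h6 : M' * ((1 + θ) * b) ≤ M' * S.toReal := by gcongr; linarith
    nlinarith
  have : S.toReal ≤ b := by
    refine le_of_forall_pos_le_add fun η hη => ?_
    have := key (η / (b + 1)) (by positivity)
    have e : (1 + η / (b + 1)) * b + η / (b + 1) = b + η := by field_simp; ring
    linarith
  rw [← ENNReal.ofReal_toReal hS]
  exact ENNReal.ofReal_le_ofReal this

end Window

/-! ### Restriction to long time windows -/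

section Window

/-- The process `Y` cut off outside `[-N, N]`. -/
noncomputable def windowed {Ω : Type*} (Y : ℝ → Ω → ℝ) (N t : ℝ) (ω : Ω) : ℝ :=
  (Set.Icc (-N) N).indicator (fun s => Y s ω) t

theorem enorm_windowed_sq {Ω : Type*} (Y : ℝ → Ω → ℝ) (N t : ℝ) (ω : Ω) :
    ‖windowed Y N t ω‖ₑ ^ 2 = (Set.Icc (-N) N).indicator (fun s => ‖Y s ω‖ₑ ^ 2) t := by
  by_cases h : t ∈ Set.Icc (-N) N <;> simp [windowed, h]

variable {Ω : Type*} [MeasurableSpace Ω] {P : Measure Ω}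

theorem measurable_windowed {Y : ℝ → Ω → ℝ} (hY : Measurable (fun z : ℝ × Ω => Y z.1 z.2))
    (N : ℝ) : Measurable (fun z : ℝ × Ω => windowed Y N z.1 z.2) := by
  have : (fun z : ℝ × Ω => windowed Y N z.1 z.2) =
      (Prod.fst ⁻¹' Set.Icc (-N) N).indicator (fun z : ℝ × Ω => Y z.1 z.2) := by
    rfl
  rw [this]
  exact hY.indicator (measurable_fst measurableSet_Icc)

namespace IsRegularProcess

variable {Y : ℝ → Ω → ℝ}

theorem isLocalApprox_windowed (hY : IsRegularProcess P Y) :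
    IsLocalApprox P Y (windowed Y) := by
  obtain ⟨C, hC, hYC⟩ := hY.bounded
  refine ⟨hY.measurable, measurable_windowed hY.measurable, ⟨C, hC, hYC, fun N t => ?_⟩,
    fun ε hε => ⟨0, fun N t ht => ?_⟩⟩
  · refine (lintegral_mono fun ω => ?_).trans (hYC t)
    rw [enorm_windowed_sq]
    exact Set.indicator_le_self _ (fun s => ‖Y s ω‖ₑ ^ 2) t
  · have : t ∈ Set.Icc (-N) N := abs_le.1 (by simpa using ht)
    simp [windowed, this]

theorem lintegral_windowed_sq (hY : IsRegularProcess P Y) (N : ℝ) :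
    ∫⁻ t, ∫⁻ ω, ‖windowed Y N t ω‖ₑ ^ 2 ∂P =
      ENNReal.ofReal (2 * N) * ∫⁻ ω, ‖Y 0 ω‖ₑ ^ 2 ∂P := by
  have : ∀ t, ∫⁻ ω, ‖windowed Y N t ω‖ₑ ^ 2 ∂P =
      (Set.Icc (-N) N).indicator (fun _ => ∫⁻ ω, ‖Y 0 ω‖ₑ ^ 2 ∂P) t := by
    intro t
    by_cases h : t ∈ Set.Icc (-N) N
    · simp [windowed, h, hY.lintegral_sq_eq t]
    · simp [windowed, h]
  simp only [this]
  rw [lintegral_indicator measurableSet_Icc, setLIntegral_const, Real.volume_Icc, mul_comm]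
  congr 2
  ring

theorem ae_isSignal_windowed [SFinite P] (hY : IsRegularProcess P Y) (N : ℝ) :
    ∀ᵐ ω ∂P, IsSignal (fun t => windowed Y N t ω) := by
  obtain ⟨C, hC, hYC⟩ := hY.bounded
  have hm := measurable_windowed hY.measurable N
  have hfin : ∫⁻ ω, (∫⁻ t, ‖windowed Y N t ω‖ₑ ^ 2) ∂P ≠ ∞ := by
    rw [lintegral_lintegral_swap
      ((hm.comp measurable_swap).enorm.pow_const 2).aemeasurable, hY.lintegral_windowed_sq]
    exact ENNReal.mul_ne_top ENNReal.ofReal_ne_top (ne_top_of_le_ne_top hC (hYC 0))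
  filter_upwards [ae_lt_top (hm.enorm.pow_const 2).lintegral_prod_left' hfin] with ω hω
  have hmω : Measurable fun t => windowed Y N t ω :=
    hm.comp (measurable_id.prodMk measurable_const)
  have h2 : MemLp (fun t => windowed Y N t ω) 2 :=
    (memLp_two_iff_lintegral hmω.aestronglyMeasurable).2 hω
  refine ⟨hmω, ?_, h2⟩
  have e : (Set.Icc (-N) N).indicator (fun t => windowed Y N t ω) =
      fun t => windowed Y N t ω := by
    ext t; by_cases h : t ∈ Set.Icc (-N) N <;> simp [windowed, h]
  rw [← e, integrable_indicator_iff measurableSet_Icc]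
  exact (h2.restrict _).integrable one_le_two

/-- The energy inequality for signals, applied to the paths of the process restricted to long time
windows, becomes an inequality between second moments. -/
theorem sum_lintegral_scatU_sq_add_le [SFinite P] (hY : IsRegularProcess P Y) {ψ : ℝ → ℂ}
    (hψ : Integrable ψ) {J : ℤ} {n : ℕ} {x : ℝ} (hx : 0 < x)
    (h : ∀ f, IsSignal f → cascadeEnergy ψ J n f ≤ ∫⁻ ω, ‖fourierReal f ω‖ₑ ^ 2 *
        ENNReal.ofReal (1 - ‖fourierReal (gaussFilter x) ω‖ ^ 2))
    (hU : ∀ (p : List ℤ) t, ∫⁻ ω, ‖_root_.scatU ψ p (fun s => Y s ω) t‖ₑ ^ 2 ∂P =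
      ∫⁻ ω, ‖_root_.scatU ψ p (fun s => Y s ω) 0‖ₑ ^ 2 ∂P)
    (hχ : ∀ t, ∫⁻ ω, ‖conv (fun s => Y s ω) (gaussFilter x) t‖ₑ ^ 2 ∂P =
      ∫⁻ ω, ‖conv (fun s => Y s ω) (gaussFilter x) 0‖ₑ ^ 2 ∂P)
    (F : Finset (ScatPath J n)) :
    ∑ p ∈ F, ∫⁻ ω, ‖_root_.scatU ψ p.1 (fun s => Y s ω) 0‖ₑ ^ 2 ∂P +
      ∫⁻ ω, ‖conv (fun s => Y s ω) (gaussFilter x) 0‖ₑ ^ 2 ∂P ≤ ∫⁻ ω, ‖Y 0 ω‖ₑ ^ 2 ∂P := by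
  obtain ⟨C, hC, hYC⟩ := hY.bounded
  have hB : ∫⁻ ω, ‖Y 0 ω‖ₑ ^ 2 ∂P ≠ ∞ := ne_top_of_le_ne_top hC (hYC 0)
  set b := (∫⁻ ω, ‖Y 0 ω‖ₑ ^ 2 ∂P).toReal with hb
  have hloc := hY.isLocalApprox_windowed
  -- the low-pass filter is treated as one further channel
  let T : Option F → (ℝ → ℝ) → ℝ → ℝ
    | none => fun f t => ‖conv f (gaussFilter x) t‖
    | some p => fun f => _root_.scatU ψ p.1.1 f
  have hT : ∀ i, IsLocalApprox P (fun t ω => T i (fun s => Y s ω) t)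
      (fun N t ω => T i (fun s => windowed Y N s ω) t) := by
    rintro (_ | p)
    · exact hloc.norm_conv (integrable_gaussFilter hx)
    · exact hloc.scatU hψ _
  have hTf : ∀ f, IsSignal f → ∑ i, ∫⁻ t, ‖T i f t‖ₑ ^ 2 ≤ ∫⁻ t, ‖f t‖ₑ ^ 2 := by
    intro f hf
    refine le_trans ?_ (tsum_scatPath_add_gaussian_le hx hf (h f hf))
    rw [Fintype.sum_option, add_comm]
    simp only [T, enorm_norm]
    gcongr
    rw [Finset.sum_coe_sort F (fun p : ScatPath J n => ∫⁻ t, ‖_root_.scatU ψ p.1 f t‖ₑ ^ 2)]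
    exact ENNReal.sum_le_tsum F
  have key := sum_lintegral_sq_le_of_isLocalApprox (P := P) hT (b := b) ?_ ENNReal.toReal_nonneg ?_
  · rw [Fintype.sum_option, add_comm, hb, ENNReal.ofReal_toReal hB] at key
    simp only [T, enorm_norm] at key
    rwa [Finset.sum_coe_sort F (fun p : ScatPath J n =>
      ∫⁻ ω, ‖_root_.scatU ψ p.1 (fun s => Y s ω) 0‖ₑ ^ 2 ∂P)] at key
  · rintro (_ | p) t
    · simpa only [T, enorm_norm] using hχ t
    · exact hU _ t
  · intro N hN
    have hm := measurable_windowed hY.measurable N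
    have hTm : ∀ i, Measurable fun z : Ω × ℝ => ‖T i (fun s => windowed Y N s z.1) z.2‖ₑ ^ 2 :=
      fun i => (((hT i).measurable_approx N).comp measurable_swap).enorm.pow_const 2
    calc ∑ i, ∫⁻ t, ∫⁻ ω, ‖T i (fun s => windowed Y N s ω) t‖ₑ ^ 2 ∂P
        = ∑ i, ∫⁻ ω, (∫⁻ t, ‖T i (fun s => windowed Y N s ω) t‖ₑ ^ 2) ∂P :=
          Finset.sum_congr rfl fun i _ => (lintegral_lintegral_swap (hTm i).aemeasurable).symm
      _ = ∫⁻ ω, (∑ i, ∫⁻ t, ‖T i (fun s => windowed Y N s ω) t‖ₑ ^ 2) ∂P :=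
          (lintegral_finsetSum _ fun i _ => (hTm i).lintegral_prod_right').symm
      _ ≤ ∫⁻ ω, (∫⁻ t, ‖windowed Y N t ω‖ₑ ^ 2) ∂P := by
          refine lintegral_mono_ae ?_
          filter_upwards [hY.ae_isSignal_windowed N] with ω hω using hTf _ hω
      _ = ENNReal.ofReal (2 * N) * ∫⁻ ω, ‖Y 0 ω‖ₑ ^ 2 ∂P := by
          rw [lintegral_lintegral_swap ((hm.comp measurable_swap).enorm.pow_const 2).aemeasurable,
            hY.lintegral_windowed_sq]
      _ = ENNReal.ofReal (2 * N * b) := by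
          rw [ENNReal.ofReal_mul (p := 2 * N) (by positivity), hb, ENNReal.ofReal_toReal hB]
      _ ≤ _ := le_rfl

end IsRegularProcess

end Window

/-! ### The spectral density -/

section Spectral

variable {Ω : Type*} [MeasurableSpace Ω] {P : Measure Ω}

/-- Second moment of a weighted time integral of a process. -/
theorem integral_sq_integral_mul [SFinite P] {Z : ℝ → Ω → ℝ}
    (hZ : Measurable (fun z : ℝ × Ω => Z z.1 z.2)) {C : ℝ≥0∞} (hC : C ≠ ∞)
    (hZC : ∀ s, ∫⁻ ω, ‖Z s ω‖ₑ ^ 2 ∂P ≤ C) {g : ℝ → ℝ} (hg : Integrable g) :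
    ∫ ω, (∫ s, Z s ω * g s) ^ 2 ∂P =
      ∫ z : ℝ × ℝ, (∫ ω, Z z.1 ω * Z z.2 ω ∂P) * (g z.1 * g z.2) := by
  have hZs : ∀ s, Measurable (Z s) := fun s => hZ.comp (measurable_const.prodMk measurable_id)
  have hm1 : Measurable fun z : Ω × (ℝ × ℝ) => Z z.2.1 z.1 :=
    hZ.comp (measurable_snd.fst.prodMk measurable_fst)
  have hm2 : Measurable fun z : Ω × (ℝ × ℝ) => Z z.2.2 z.1 :=
    hZ.comp (measurable_snd.snd.prodMk measurable_fst)
  have hgg : Integrable (fun z : ℝ × ℝ => g z.1 * g z.2) := hg.mul_prod hg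
  have hCS : ∀ s t, ∫⁻ ω, ‖Z s ω * Z t ω‖ₑ ∂P ≤ C := by
    intro s t
    have hpt : ∀ ω, ‖Z s ω * Z t ω‖ₑ ≤ 2⁻¹ * (‖Z s ω‖ₑ ^ 2 + ‖Z t ω‖ₑ ^ 2) := by
      intro ω
      have e : ∀ x : ℝ, ‖x‖ₑ = ENNReal.ofReal |x| := fun x => Real.enorm_eq_ofReal_abs x
      have e2 : (2⁻¹ : ℝ≥0∞) = ENNReal.ofReal 2⁻¹ := by
        rw [ENNReal.ofReal_inv_of_pos two_pos]; simp
      rw [e, e, e, e2, ← ENNReal.ofReal_pow (abs_nonneg _), ← ENNReal.ofReal_pow (abs_nonneg _),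
        ← ENNReal.ofReal_add (by positivity) (by positivity),
        ← ENNReal.ofReal_mul (by positivity)]
      refine ENNReal.ofReal_le_ofReal ?_
      rw [abs_mul]
      nlinarith [sq_nonneg (|Z s ω| - |Z t ω|)]
    calc _ ≤ ∫⁻ ω, 2⁻¹ * (‖Z s ω‖ₑ ^ 2 + ‖Z t ω‖ₑ ^ 2) ∂P := lintegral_mono hpt
      _ = 2⁻¹ * (∫⁻ ω, ‖Z s ω‖ₑ ^ 2 ∂P + ∫⁻ ω, ‖Z t ω‖ₑ ^ 2 ∂P) := by
        rw [lintegral_const_mul' _ _ (by simp), lintegral_add_left ((hZs s).enorm.pow_const 2)]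
      _ ≤ 2⁻¹ * (C + C) := by gcongr <;> exact hZC _
      _ = C := by
        rw [← two_mul, ← mul_assoc, ENNReal.inv_mul_cancel (by simp) (by simp), one_mul]
  have hint : Integrable (fun z : Ω × (ℝ × ℝ) =>
      Z z.2.1 z.1 * Z z.2.2 z.1 * (g z.2.1 * g z.2.2)) (P.prod volume) := by
    have hms : AEStronglyMeasurable (fun z : Ω × (ℝ × ℝ) =>
        Z z.2.1 z.1 * Z z.2.2 z.1 * (g z.2.1 * g z.2.2)) (P.prod volume) :=
      (hm1.mul hm2).aestronglyMeasurable.mul (hgg.aestronglyMeasurable.comp_snd)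
    refine ⟨hms, ?_⟩
    rw [hasFiniteIntegral_iff_enorm, lintegral_prod_symm _ hms.enorm]
    calc _ ≤ ∫⁻ z : ℝ × ℝ, C * ‖g z.1 * g z.2‖ₑ := by
          refine lintegral_mono fun z => ?_
          simp only [enorm_mul (Z z.1 _ * Z z.2 _)]
          rw [lintegral_mul_const' _ _ enorm_ne_top]
          gcongr
          exact hCS _ _
      _ < ∞ := by
          rw [lintegral_const_mul' _ _ hC]
          exact ENNReal.mul_lt_top hC.lt_top hgg.2
  have hsq : ∀ ω, (∫ s, Z s ω * g s) ^ 2 =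
      ∫ z : ℝ × ℝ, Z z.1 ω * Z z.2 ω * (g z.1 * g z.2) := by
    intro ω
    rw [sq, ← integral_prod_mul]
    refine integral_congr_ae (Filter.Eventually.of_forall fun z => ?_)
    simp only
    ring
  simp only [hsq]
  rw [integral_integral_swap hint]
  refine integral_congr_ae (Filter.Eventually.of_forall fun z => ?_)
  simp only
  rw [integral_mul_const]

/-- A kernel that depends on the difference only is integrated against the autocorrelation of the
weight. -/
theorem integral_prod_comp_sub {F g : ℝ → ℝ} (hF : Measurable F) {B : ℝ} (hB : ∀ τ, |F τ| ≤ B)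
    (hg : Integrable g) :
    ∫ z : ℝ × ℝ, F (z.1 - z.2) * (g z.1 * g z.2) = ∫ τ, F τ * ∫ s, g (s + τ) * g s := by
  have hgg : Integrable (fun z : ℝ × ℝ => g z.1 * g z.2) := hg.mul_prod hg
  have hint : Integrable (fun z : ℝ × ℝ => F (z.1 - z.2) * (g z.1 * g z.2)) :=
    hgg.bdd_mul (hF.comp (measurable_fst.sub measurable_snd)).aestronglyMeasurable
      (Filter.Eventually.of_forall fun z => hB _)
  have hmp := measurePreserving_add_prod (volume : Measure ℝ) (volume : Measure ℝ)
  have hint' : Integrable (fun z : ℝ × ℝ => F (z.1 + z.2 - z.2) * (g (z.1 + z.2) * g z.2))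
      (volume.prod volume) := (hmp.integrable_comp hint.aestronglyMeasurable).2 hint
  calc ∫ z : ℝ × ℝ, F (z.1 - z.2) * (g z.1 * g z.2)
      = ∫ z, F (z.1 - z.2) * (g z.1 * g z.2) ∂(Measure.map (fun z : ℝ × ℝ => (z.1 + z.2, z.2))
          (volume.prod volume)) := by rw [hmp.map_eq]; rfl
    _ = ∫ z : ℝ × ℝ, F (z.1 + z.2 - z.2) * (g (z.1 + z.2) * g z.2) ∂(volume.prod volume) := by
        refine integral_map hmp.measurable.aemeasurable ?_
        rw [hmp.map_eq]
        exact hint.aestronglyMeasurable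
    _ = _ := by
        rw [integral_prod _ hint']
        refine integral_congr_ae (Filter.Eventually.of_forall fun τ => ?_)
        simp only [add_sub_cancel_right]
        rw [integral_const_mul]
        simp only [add_comm]

namespace IsAdmissibleProcess

variable {X : ℝ → Ω → ℝ} [IsProbabilityMeasure P]

theorem autocov_neg (hX : IsAdmissibleProcess P X) (τ : ℝ) :
    autocov P X (-τ) = autocov P X τ := by
  have h1 := hX.integral_mul_eq 0 τ
  have h2 := hX.integral_mul_eq τ 0
  simp only [mul_comm (X τ _)] at h2
  simp only [zero_sub, sub_zero] at h1 h2
  linarith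

theorem exists_abs_autocov_le (hX : IsAdmissibleProcess P X) :
    ∃ B, ∀ τ, |autocov P X τ| ≤ B := by
  refine ⟨∫ ω, X 0 ω ^ 2 ∂P + (∫ ω, X 0 ω ∂P) ^ 2, fun τ => ?_⟩
  have h1 := hX.integral_mul_eq τ 0
  have hi := hX.integral_sq_eq τ
  have hs := (hX.memLp_two τ).integrable_sq
  have ht := (hX.memLp_two 0).integrable_sq
  have hst : Integrable (fun ω => X τ ω * X 0 ω) P :=
    (hX.memLp_two τ).integrable_mul (hX.memLp_two 0)
  have hadd : Integrable (fun ω => (X τ ω ^ 2 + X 0 ω ^ 2) / 2) P := (hs.add ht).div_const 2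
  have e : ∫ ω, (X τ ω ^ 2 + X 0 ω ^ 2) / 2 ∂P = ∫ ω, X 0 ω ^ 2 ∂P := by
    rw [integral_div, integral_add hs ht, hi]; ring
  have h2 : ∫ ω, X τ ω * X 0 ω ∂P ≤ ∫ ω, X 0 ω ^ 2 ∂P := by
    rw [← e]
    exact integral_mono hst hadd fun ω => by
      simp only; nlinarith [sq_nonneg (X τ ω - X 0 ω)]
  have h3 : ∫ ω, -(X τ ω * X 0 ω) ∂P ≤ ∫ ω, X 0 ω ^ 2 ∂P := by
    rw [← e]
    exact integral_mono hst.neg hadd fun ω => by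
      simp only; nlinarith [sq_nonneg (X τ ω + X 0 ω)]
  rw [integral_neg] at h3
  rw [sub_zero] at h1
  rw [abs_le]
  constructor <;> nlinarith [sq_nonneg (∫ ω, X 0 ω ∂P)]

/-- Weighted time integrals of the centred process have nonnegative second moments, so the
autocovariance is positive definite. -/
theorem integral_autocov_mul_nonneg (hX : IsAdmissibleProcess P X) {g : ℝ → ℝ}
    (hg : Integrable g) : 0 ≤ ∫ z : ℝ × ℝ, autocov P X (z.1 - z.2) * (g z.1 * g z.2) := by
  set m := ∫ ω, X 0 ω ∂P with hm
  have hL : ∀ t, MemLp (fun ω => X t ω - m) 2 P := fun t =>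
    (hX.memLp_two t).sub (memLp_const m)
  have hmeas : Measurable (fun z : ℝ × Ω => X z.1 z.2 - m) := hX.measurable.sub measurable_const
  have hcov : ∀ s t, ∫ ω, (X s ω - m) * (X t ω - m) ∂P = autocov P X (s - t) := by
    intro s t
    have h1 := covariance_eq_sub (hX.memLp_two s) (hX.memLp_two t)
    have h2 := hX.integral_mul_eq s t
    simp only [covariance, Pi.mul_apply, hX.integral_eq s, hX.integral_eq t, ← hm] at h1 h2
    rw [h1, h2]
    ring
  have key := integral_sq_integral_mul (P := P) (Z := fun t ω => X t ω - m) hmeas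
    (C := ENNReal.ofReal (autocov P X 0)) ENNReal.ofReal_ne_top (fun s => ?_) hg
  · simp only [hcov] at key
    rw [← key]
    exact integral_nonneg fun ω => sq_nonneg _
  · rw [lintegral_enorm_sq_eq_ofReal (hL s)]
    simp only [sq, hcov, sub_self, le_refl]

/-- The second moment of a filtered process: the contributions of autocovariance and mean. -/
theorem integral_conv_sq (hX : IsAdmissibleProcess P X) {g : ℝ → ℝ} (hg : Integrable g) (t : ℝ) :
    ∫ ω, conv (fun s => X s ω) g t ^ 2 ∂P =
      (∫ τ, autocov P X τ * ∫ s, g (s + τ) * g s) + (∫ ω, X 0 ω ∂P) ^ 2 * (∫ s, g s) ^ 2 := by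
  obtain ⟨B, hB⟩ := hX.exists_abs_autocov_le
  have hgg : Integrable (fun z : ℝ × ℝ => g z.1 * g z.2) := hg.mul_prod hg
  have hm : Measurable (fun z : ℝ × Ω => X (t - z.1) z.2) :=
    hX.measurable.comp ((measurable_const.sub measurable_fst).prodMk measurable_snd)
  have hint : Integrable (fun z : ℝ × ℝ => autocov P X (z.1 - z.2) * (g z.1 * g z.2)) :=
    hgg.bdd_mul (hX.continuous_autocov.measurable.comp
      (measurable_fst.sub measurable_snd)).aestronglyMeasurable
      (Filter.Eventually.of_forall fun z => hB _)
  have h := integral_sq_integral_mul (P := P) (Z := fun s ω => X (t - s) ω) hm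
    (C := ENNReal.ofReal (∫ ω, X 0 ω ^ 2 ∂P)) ENNReal.ofReal_ne_top
    (fun s => (hX.lintegral_enorm_sq_apply _).le) hg
  simp only [conv_apply, smul_eq_mul]
  rw [h, ← integral_prod_comp_sub hX.continuous_autocov.measurable hB hg]
  have e : ∀ z : ℝ × ℝ, (∫ ω, X (t - z.1) ω * X (t - z.2) ω ∂P) * (g z.1 * g z.2) =
      autocov P X (z.1 - z.2) * (g z.1 * g z.2) + (∫ ω, X 0 ω ∂P) ^ 2 * (g z.1 * g z.2) := by
    intro z
    rw [hX.integral_mul_eq, sub_sub_sub_cancel_left, ← hX.autocov_neg, neg_sub]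
    ring
  simp only [e]
  rw [integral_add hint (hgg.const_mul _), integral_const_mul, sq (∫ s, g s),
    ← integral_prod_mul]
  rfl

/-- The spectral density, as a cosine integral. -/
theorem fourierReal_autocov_eq (hX : IsAdmissibleProcess P X) (ξ : ℝ) :
    fourierReal (autocov P X) ξ =
      ((∫ τ, autocov P X τ * Real.cos (2 * Real.pi * ξ * τ) : ℝ) : ℂ) := by
  have hodd : ∫ τ, autocov P X τ * Real.sin (2 * Real.pi * ξ * τ) = 0 := by
    have h := integral_neg_eq_self (fun τ => autocov P X τ * Real.sin (2 * Real.pi * ξ * τ)) volume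
    simp only [hX.autocov_neg, mul_neg, Real.sin_neg, integral_neg] at h
    linarith
  have hc : Integrable fun τ => autocov P X τ * Real.cos (2 * Real.pi * ξ * τ) :=
    hX.integrable_autocov.mul_bdd (c := 1) (by fun_prop)
      (Filter.Eventually.of_forall fun τ => Real.abs_cos_le_one _)
  have hs : Integrable fun τ => autocov P X τ * Real.sin (2 * Real.pi * ξ * τ) :=
    hX.integrable_autocov.mul_bdd (c := 1) (by fun_prop)
      (Filter.Eventually.of_forall fun τ => Real.abs_sin_le_one _)
  rw [fourierReal, Real.fourier_real_eq_integral_exp_smul]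
  have e : ∀ τ : ℝ, Complex.exp (↑(-2 * Real.pi * τ * ξ) * Complex.I) • (autocov P X τ : ℂ) =
      ((autocov P X τ * Real.cos (2 * Real.pi * ξ * τ) : ℝ) : ℂ) -
        ((autocov P X τ * Real.sin (2 * Real.pi * ξ * τ) : ℝ) : ℂ) * Complex.I := by
    intro τ
    have : -2 * Real.pi * τ * ξ = -(2 * Real.pi * ξ * τ) := by ring
    rw [this, Complex.exp_mul_I, ← Complex.ofReal_cos, ← Complex.ofReal_sin, Real.cos_neg,
      Real.sin_neg]
    simp only [smul_eq_mul]
    push_cast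
    ring
  simp only [e]
  rw [integral_sub hc.ofReal (hs.ofReal.mul_const _), integral_mul_const, integral_complex_ofReal,
    integral_complex_ofReal, hodd]
  simp

/-- The spectral density is nonnegative: it is the limit of the mean periodograms over long
intervals. -/
theorem integral_autocov_mul_cos_nonneg (hX : IsAdmissibleProcess P X) (ξ : ℝ) :
    0 ≤ ∫ τ, autocov P X τ * Real.cos (2 * Real.pi * ξ * τ) := by
  obtain ⟨B, hB⟩ := hX.exists_abs_autocov_le
  have htri : ∀ (c : ℝ) τ, ∫ s, (Set.Icc 0 c).indicator (fun _ => (1 : ℝ)) (s + τ) *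
      (Set.Icc 0 c).indicator (fun _ => (1 : ℝ)) s = max 0 (c - |τ|) := by
    intro c τ
    have h := integral_indicator_Icc_autocorrelation (c := c) (ω := -τ)
    rw [abs_neg] at h
    rw [← Complex.ofReal_inj, ← h, ← integral_complex_ofReal]
    refine integral_congr_ae (Filter.Eventually.of_forall fun s => ?_)
    simp only [Set.indicator_apply, sub_neg_eq_add]
    split_ifs <;> simp
  have hfin : ∀ n : ℕ, 0 ≤ ∫ τ, autocov P X τ * Real.cos (2 * Real.pi * ξ * τ) *
      (max 0 (n - |τ|) / n) := by
    intro n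
    set I : ℝ → ℝ := (Set.Icc 0 (n : ℝ)).indicator (fun _ => (1 : ℝ)) with hI
    have hII : Integrable I := (integrable_indicator_iff measurableSet_Icc).2 (by simp)
    have hcI : Integrable fun s => Real.cos (2 * Real.pi * ξ * s) * I s :=
      hII.bdd_mul (c := 1) (by fun_prop)
        (Filter.Eventually.of_forall fun τ => Real.abs_cos_le_one _)
    have hsI : Integrable fun s => Real.sin (2 * Real.pi * ξ * s) * I s :=
      hII.bdd_mul (c := 1) (by fun_prop)
        (Filter.Eventually.of_forall fun τ => Real.abs_sin_le_one _)
    have hbd : ∀ g : ℝ → ℝ, Integrable g → Integrable fun z : ℝ × ℝ =>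
        autocov P X (z.1 - z.2) * (g z.1 * g z.2) := fun g hg =>
      (hg.mul_prod hg).bdd_mul (hX.continuous_autocov.measurable.comp
        (measurable_fst.sub measurable_snd)).aestronglyMeasurable
        (Filter.Eventually.of_forall fun z => hB _)
    -- the weights `cos` and `sin` on `[0, n]` together give `cos (2 π ξ (s - t))`
    have h1 := add_nonneg (hX.integral_autocov_mul_nonneg hcI) (hX.integral_autocov_mul_nonneg hsI)
    rw [← integral_add (hbd _ hcI) (hbd _ hsI)] at h1
    have h2 := integral_prod_comp_sub
      (F := fun τ => autocov P X τ * Real.cos (2 * Real.pi * ξ * τ))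
      (hX.continuous_autocov.measurable.mul (by fun_prop)) (B := B) (fun τ => by
        rw [abs_mul]
        exact (mul_le_of_le_one_right (abs_nonneg _) (Real.abs_cos_le_one _)).trans (hB τ)) hII
    have h3 : ∫ z : ℝ × ℝ, (autocov P X (z.1 - z.2) *
          (Real.cos (2 * Real.pi * ξ * z.1) * I z.1 * (Real.cos (2 * Real.pi * ξ * z.2) * I z.2)) +
        autocov P X (z.1 - z.2) *
          (Real.sin (2 * Real.pi * ξ * z.1) * I z.1 * (Real.sin (2 * Real.pi * ξ * z.2) * I z.2))) =
        ∫ z : ℝ × ℝ, autocov P X (z.1 - z.2) * Real.cos (2 * Real.pi * ξ * (z.1 - z.2)) *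
          (I z.1 * I z.2) := by
      refine integral_congr_ae (Filter.Eventually.of_forall fun z => ?_)
      simp only
      rw [mul_sub, Real.cos_sub]
      ring
    rw [h3, h2] at h1
    simp only [hI, htri] at h1
    simp only [mul_div_assoc']
    rw [integral_div]
    positivity
  have hlim : Filter.Tendsto (fun n : ℕ => ∫ τ, autocov P X τ * Real.cos (2 * Real.pi * ξ * τ) *
      (max 0 (n - |τ|) / n)) Filter.atTop
      (𝓝 (∫ τ, autocov P X τ * Real.cos (2 * Real.pi * ξ * τ))) := by
    refine tendsto_integral_of_dominated_convergence (fun τ => |autocov P X τ|) (fun n => ?_)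
      hX.integrable_autocov.abs (fun n => ?_) ?_
    · exact ((hX.continuous_autocov.mul (by fun_prop)).mul (by fun_prop)).aestronglyMeasurable
    · refine Filter.Eventually.of_forall fun τ => ?_
      have hk : |max 0 ((n : ℝ) - |τ|) / n| ≤ 1 := by
        rw [abs_of_nonneg (by positivity)]
        refine div_le_one_of_le₀ (max_le (by positivity) ?_) (by positivity)
        linarith [abs_nonneg τ]
      rw [Real.norm_eq_abs, abs_mul, abs_mul]
      calc _ ≤ |autocov P X τ| * 1 * 1 := by gcongr; exact Real.abs_cos_le_one _
        _ = _ := by ring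
    · refine Filter.Eventually.of_forall fun τ => ?_
      have hk : Filter.Tendsto (fun n : ℕ => max 0 ((n : ℝ) - |τ|) / n) Filter.atTop (𝓝 1) := by
        have h0 : Filter.Tendsto (fun n : ℕ => 1 - |τ| / (n : ℝ)) Filter.atTop (𝓝 (1 - 0)) :=
          tendsto_const_nhds.sub (tendsto_const_div_atTop_nhds_zero_nat _)
        rw [sub_zero] at h0
        refine h0.congr' ?_
        filter_upwards [Filter.eventually_ge_atTop (⌈|τ|⌉₊ + 1)] with n hn
        have hn1 : |τ| ≤ n := (Nat.le_ceil _).trans (by exact_mod_cast (Nat.le_succ _).trans hn)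
        have hn0 : (n : ℝ) ≠ 0 := by
          have : 0 < n := by omega
          positivity
        rw [max_eq_right (by linarith), sub_div, div_self hn0]
      simpa using hk.const_mul (autocov P X τ * Real.cos (2 * Real.pi * ξ * τ))
  exact ge_of_tendsto' hlim hfin

end IsAdmissibleProcess

end Spectral

/-! ### The spectral identity for the low-pass filter -/

section Spectral

variable {Ω : Type*} [MeasurableSpace Ω] {P : Measure Ω}

theorem memLp_two_gaussFilter {a : ℝ} (ha : 0 < a) : MemLp (gaussFilter a) 2 := by
  rw [memLp_two_iff_integrable_sq (integrable_gaussFilter ha).aestronglyMeasurable]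
  have h : Integrable fun t : ℝ => Real.exp (-(2 * (Real.pi * a) ^ 2) * t ^ 2) :=
    integrable_exp_neg_mul_sq (by positivity)
  refine (h.const_mul ((√Real.pi * a) ^ 2)).congr (Filter.Eventually.of_forall fun t => ?_)
  simp only [gaussFilter]
  rw [mul_pow _ (Real.exp _), ← Real.exp_nat_mul]
  congr 2
  push_cast
  ring

theorem integral_gaussFilter {a : ℝ} (ha : 0 < a) : ∫ t, gaussFilter a t = 1 := by
  have h := fourierReal_gaussFilter ha 0
  rw [fourierReal, Real.fourier_real_eq] at h
  rw [← Complex.ofReal_inj, ← integral_complex_ofReal]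
  simpa using h

/-- Parseval's identity between an even function and the autocorrelation of a Gaussian. -/
theorem integral_fourierReal_mul_gaussian {R : ℝ → ℝ} (hR : Integrable R)
    (hneg : ∀ τ, R (-τ) = R τ) {a : ℝ} (ha : 0 < a) :
    ∫ ξ, fourierReal R ξ * ((‖fourierReal (gaussFilter a) ξ‖ ^ 2 : ℝ) : ℂ) =
      ((∫ τ, R τ * ∫ s, gaussFilter a (s + τ) * gaussFilter a s : ℝ) : ℂ) := by
  have h1 : Integrable fun t => (gaussFilter a t : ℂ) := (integrable_gaussFilter ha).ofReal
  have h2 : MemLp (fun t => (gaussFilter a t : ℂ)) 2 := (memLp_two_gaussFilter ha).ofReal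
  have hw : Integrable fun ξ => ((‖fourierReal (gaussFilter a) ξ‖ ^ 2 : ℝ) : ℂ) :=
    ((memLp_two_fourier h1 h2).integrable_norm_pow (by norm_num)).ofReal
  have hflip : ∫ ξ, fourierReal R ξ * ((‖fourierReal (gaussFilter a) ξ‖ ^ 2 : ℝ) : ℂ) =
      ∫ τ, (R τ : ℂ) * 𝓕 (fun ξ => ((‖fourierReal (gaussFilter a) ξ‖ ^ 2 : ℝ) : ℂ)) τ := by
    simpa using! (VectorFourier.integral_fourierIntegral_smul_eq_flip (L := innerₗ ℝ)
      Real.continuous_fourierChar continuous_inner (hR.ofReal (𝕜 := ℂ)) hw)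
  rw [hflip, ← integral_complex_ofReal,
    ← integral_neg_eq_self
      (fun τ => ((R τ * ∫ s, gaussFilter a (s + τ) * gaussFilter a s : ℝ) : ℂ))]
  refine integral_congr_ae (Filter.Eventually.of_forall fun τ => ?_)
  simp only [hneg, fourierReal]
  rw [fourier_norm_sq_fourier h1 h2, Complex.ofReal_mul, ← integral_complex_ofReal]
  simp [sub_eq_add_neg]

namespace IsAdmissibleProcess

variable {X : ℝ → Ω → ℝ} [IsProbabilityMeasure P]

theorem integral_sq_eq_autocov (hX : IsAdmissibleProcess P X) (t : ℝ) :
    ∫ ω, X t ω ^ 2 ∂P = autocov P X 0 + (∫ ω, X 0 ω ∂P) ^ 2 := by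
  have := hX.integral_mul_eq t t
  simpa [sq] using this

/-- Low-pass filtering by a Gaussian multiplies the spectral density by `|𝓕 χ|²` and keeps the
mean. -/
theorem integral_conv_gaussFilter_sq (hX : IsAdmissibleProcess P X) {a : ℝ} (ha : 0 < a) (t : ℝ) :
    ((∫ ω, conv (fun s => X s ω) (gaussFilter a) t ^ 2 ∂P : ℝ) : ℂ) =
      (∫ ξ, fourierReal (autocov P X) ξ * ((‖fourierReal (gaussFilter a) ξ‖ ^ 2 : ℝ) : ℂ)) +
        (((∫ ω, X 0 ω ∂P) ^ 2 : ℝ) : ℂ) := by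
  rw [hX.integral_conv_sq (integrable_gaussFilter ha), integral_gaussFilter ha,
    integral_fourierReal_mul_gaussian hX.integrable_autocov hX.autocov_neg ha]
  push_cast
  ring

theorem memLp_two_conv (hX : IsAdmissibleProcess P X) {g : ℝ → ℝ} (hg : Integrable g) (t : ℝ) :
    MemLp (fun ω => conv (fun s => X s ω) g t) 2 P := by
  obtain ⟨C, hC, h⟩ := hX.isRegularProcess.bounded
  have hm : StronglyMeasurable (fun ω => conv (fun s => X s ω) g t) :=
    (stronglyMeasurable_conv hX.measurable hg.aestronglyMeasurable).comp_measurable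
      (measurable_const.prodMk measurable_id)
  rw [memLp_two_iff_lintegral hm.aestronglyMeasurable]
  refine (lintegral_conv_sq_le hX.measurable hg hC h t).trans_lt ?_
  exact ENNReal.mul_lt_top (ENNReal.pow_lt_top hg.2) hC.lt_top

/-- The Gaussian filter is a contraction in mean square because it has integral `1`. -/
theorem integral_conv_gaussFilter_sq_le (hX : IsAdmissibleProcess P X) {a : ℝ} (ha : 0 < a)
    (t : ℝ) :
    ∫ ω, conv (fun s => X s ω) (gaussFilter a) t ^ 2 ∂P ≤ ∫ ω, X 0 ω ^ 2 ∂P := by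
  have hχ := integrable_gaussFilter ha
  have h := lintegral_conv_sq_le hX.measurable hχ
    (C := ENNReal.ofReal (∫ ω, X 0 ω ^ 2 ∂P)) ENNReal.ofReal_ne_top
    (fun s => (hX.lintegral_enorm_sq_apply s).le) t
  have h1 : ∫⁻ s, ‖gaussFilter a s‖ₑ = 1 := by
    rw [← ENNReal.ofReal_one, ← integral_gaussFilter ha,
      ofReal_integral_eq_lintegral_ofReal hχ (Filter.Eventually.of_forall (gaussFilter_nonneg ha))]
    exact lintegral_congr fun s => Real.enorm_of_nonneg (gaussFilter_nonneg ha s)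
  rw [lintegral_enorm_sq_eq_ofReal (hX.memLp_two_conv hχ t), h1, one_pow, one_mul] at h
  exact (ENNReal.ofReal_le_ofReal_iff (integral_nonneg fun ω => sq_nonneg _)).1 h

/-- The spectral density is integrable. Its integrals against the Gaussians `|𝓕 χ_n|²` are
bounded by the variance, and these Gaussians increase to `1`. -/
theorem integrable_fourierReal_autocov (hX : IsAdmissibleProcess P X) :
    Integrable (fourierReal (autocov P X)) := by
  set S : ℝ → ℝ := fun ξ => ∫ τ, autocov P X τ * Real.cos (2 * Real.pi * ξ * τ) with hS
  have hSc : fourierReal (autocov P X) = fun ξ => ((S ξ : ℝ) : ℂ) :=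
    funext hX.fourierReal_autocov_eq
  have hSre : S = fun ξ => (fourierReal (autocov P X) ξ).re := by rw [hSc]; rfl
  have hcont : Continuous S := by
    rw [hSre]; exact Complex.continuous_re.comp (continuous_fourierReal hX.integrable_autocov)
  have hS0 : ∀ ξ, 0 ≤ S ξ := hX.integral_autocov_mul_cos_nonneg
  let w : ℕ → ℝ → ℝ := fun n ξ => ‖fourierReal (gaussFilter (n + 1 : ℝ)) ξ‖ ^ 2
  have hw : ∀ n ξ, w n ξ = Real.exp (-(2 * ξ ^ 2 / (n + 1 : ℝ) ^ 2)) := fun n ξ =>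
    norm_fourierReal_gaussFilter_sq (by positivity) ξ
  have hwc : ∀ n, Continuous (w n) := fun n =>
    (continuous_fourierReal (integrable_gaussFilter (by positivity))).norm.pow 2
  obtain ⟨B, hB⟩ : ∃ B, ∀ ξ, ‖S ξ‖ ≤ B := by
    refine ⟨∫ τ, ‖autocov P X τ‖, fun ξ => (norm_integral_le_integral_norm _).trans ?_⟩
    refine integral_mono_of_nonneg (Filter.Eventually.of_forall fun _ => norm_nonneg _)
      hX.integrable_autocov.norm (Filter.Eventually.of_forall fun τ => ?_)
    simp only
    rw [norm_mul]
    exact mul_le_of_le_one_right (norm_nonneg _) (Real.abs_cos_le_one _)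
  have hwi : ∀ n, Integrable (w n) := fun n =>
    (memLp_two_fourier (integrable_gaussFilter (by positivity)).ofReal
      (memLp_two_gaussFilter (by positivity)).ofReal).integrable_norm_pow (by norm_num)
  have hSw : ∀ n, Integrable fun ξ => S ξ * w n ξ := fun n =>
    (hwi n).bdd_mul hcont.aestronglyMeasurable (Filter.Eventually.of_forall hB)
  have hle : ∀ n, ∫⁻ ξ, ENNReal.ofReal (S ξ * w n ξ) ≤ ENNReal.ofReal (autocov P X 0) := by
    intro n
    rw [← ofReal_integral_eq_lintegral_ofReal (hSw n)
      (Filter.Eventually.of_forall fun ξ => mul_nonneg (hS0 ξ) (by positivity))]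
    refine ENNReal.ofReal_le_ofReal ?_
    have ha : (0 : ℝ) < n + 1 := by positivity
    have h1 := hX.integral_conv_gaussFilter_sq ha 0
    have h2 := hX.integral_conv_gaussFilter_sq_le ha 0
    rw [hX.integral_sq_eq_autocov] at h2
    simp only [hSc, ← Complex.ofReal_mul, integral_complex_ofReal] at h1
    rw [← Complex.ofReal_add, Complex.ofReal_inj] at h1
    simp only [w]
    linarith
  have hfatou : ∫⁻ ξ, ENNReal.ofReal (S ξ) ≤ ENNReal.ofReal (autocov P X 0) := by
    have hlim : ∀ ξ, Filter.Tendsto (fun n => ENNReal.ofReal (S ξ * w n ξ)) Filter.atTop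
        (𝓝 (ENNReal.ofReal (S ξ))) := by
      intro ξ
      refine ENNReal.tendsto_ofReal ?_
      have h0 : Filter.Tendsto (fun n : ℕ => -(2 * ξ ^ 2 / (n + 1 : ℝ) ^ 2)) Filter.atTop
          (𝓝 0) := by
        have := (tendsto_one_div_add_atTop_nhds_zero_nat (𝕜 := ℝ)).pow 2 |>.const_mul (-(2 * ξ ^ 2))
        simp only [ne_eq, OfNat.ofNat_ne_zero, not_false_eq_true, zero_pow, mul_zero] at this
        refine this.congr fun n => ?_
        rw [one_div, inv_pow, div_eq_mul_inv, neg_mul]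
      have h1 := (Real.continuous_exp.tendsto 0).comp h0
      rw [Real.exp_zero] at h1
      have h2 := h1.const_mul (S ξ)
      rw [mul_one] at h2
      exact h2.congr fun n => by rw [hw]; rfl
    calc ∫⁻ ξ, ENNReal.ofReal (S ξ)
        = ∫⁻ ξ, Filter.liminf (fun n => ENNReal.ofReal (S ξ * w n ξ)) Filter.atTop :=
          lintegral_congr fun ξ => (hlim ξ).liminf_eq.symm
      _ ≤ Filter.liminf (fun n => ∫⁻ ξ, ENNReal.ofReal (S ξ * w n ξ)) Filter.atTop :=
          lintegral_liminf_le fun n => (hcont.mul (hwc n)).measurable.ennreal_ofReal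
      _ ≤ ENNReal.ofReal (autocov P X 0) := by
          refine Filter.liminf_le_of_frequently_le' (Filter.Frequently.of_forall hle)
  rw [hSc]
  refine Integrable.ofReal ⟨hcont.aestronglyMeasurable, ?_⟩
  rw [hasFiniteIntegral_iff_enorm]
  refine lt_of_le_of_lt (le_trans (le_of_eq (lintegral_congr fun ξ => ?_)) hfatou)
    ENNReal.ofReal_lt_top
  exact Real.enorm_of_nonneg (hS0 ξ)

/-- The total mass of the spectral density is the variance, by Fourier inversion at `0`. -/
theorem integral_fourierReal_autocov (hX : IsAdmissibleProcess P X) :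
    ∫ ξ, fourierReal (autocov P X) ξ = ((autocov P X 0 : ℝ) : ℂ) := by
  have h := MeasureTheory.Integrable.fourierInv_fourier_eq
    (f := fun τ => ((autocov P X τ : ℝ) : ℂ)) hX.integrable_autocov.ofReal
    hX.integrable_fourierReal_autocov (v := 0)
    (Complex.continuous_ofReal.comp hX.continuous_autocov).continuousAt
  rw [← h, Real.fourierInv_eq]
  simp [fourierReal]

theorem integrable_fourierReal_autocov_mul (hX : IsAdmissibleProcess P X) {a : ℝ} (ha : 0 < a) :
    Integrable (fun ξ => fourierReal (autocov P X) ξ *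
      ((‖fourierReal (gaussFilter a) ξ‖ ^ 2 : ℝ) : ℂ)) := by
  refine hX.integrable_fourierReal_autocov.mul_bdd (c := 1) ?_
    (Filter.Eventually.of_forall fun ξ => ?_)
  · exact (Complex.continuous_ofReal.comp
      ((continuous_fourierReal (integrable_gaussFilter ha)).norm.pow 2)).aestronglyMeasurable
  · rw [Complex.norm_real, Real.norm_of_nonneg (by positivity), norm_fourierReal_gaussFilter_sq ha,
      Real.exp_le_one_iff, neg_nonpos]
    positivity

theorem integrable_fourierReal_autocov_mul_compl (hX : IsAdmissibleProcess P X) {a : ℝ}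
    (ha : 0 < a) :
    Integrable (fun ξ => fourierReal (autocov P X) ξ *
      ((1 - ‖fourierReal (gaussFilter a) ξ‖ ^ 2 : ℝ) : ℂ)) := by
  refine (hX.integrable_fourierReal_autocov.sub
    (hX.integrable_fourierReal_autocov_mul ha)).congr (Filter.Eventually.of_forall fun ξ => ?_)
  simp only [Pi.sub_apply]
  push_cast
  ring

/-- The energy removed by the low-pass filter, in terms of the spectral density. -/
theorem integral_sq_sub_integral_conv_sq (hX : IsAdmissibleProcess P X) {a : ℝ} (ha : 0 < a)
    (t : ℝ) :
    ((∫ ω, X t ω ^ 2 ∂P - ∫ ω, conv (fun s => X s ω) (gaussFilter a) t ^ 2 ∂P : ℝ) : ℂ) =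
      ∫ ξ, fourierReal (autocov P X) ξ *
        ((1 - ‖fourierReal (gaussFilter a) ξ‖ ^ 2 : ℝ) : ℂ) := by
  have e : ∀ ξ, fourierReal (autocov P X) ξ *
      ((1 - ‖fourierReal (gaussFilter a) ξ‖ ^ 2 : ℝ) : ℂ) = fourierReal (autocov P X) ξ -
        fourierReal (autocov P X) ξ * ((‖fourierReal (gaussFilter a) ξ‖ ^ 2 : ℝ) : ℂ) := fun ξ => by
    push_cast
    ring
  simp only [e]
  rw [integral_sub hX.integrable_fourierReal_autocov (hX.integrable_fourierReal_autocov_mul ha),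
    hX.integral_fourierReal_autocov, Complex.ofReal_sub, hX.integral_conv_gaussFilter_sq ha,
    hX.integral_sq_eq_autocov]
  push_cast
  ring

end IsAdmissibleProcess

end Spectral

/-! ### The energy inequality for processes -/

/-- The energy inequality for finitely many paths, at an arbitrary time. -/
theorem IsAdmissibleProcess.sum_integral_scatU_sq_add_le {Ω : Type*} [MeasurableSpace Ω]
    {P : Measure Ω} [IsProbabilityMeasure P] {X : ℝ → Ω → ℝ} (hX : IsAdmissibleProcess P X)
    {ψ : ℝ → ℂ} (hψ : Integrable ψ) {J : ℤ} {n : ℕ} {x : ℝ} (hx : 0 < x)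
    (h : ∀ f, IsSignal f → cascadeEnergy ψ J n f ≤ ∫⁻ ω, ‖fourierReal f ω‖ₑ ^ 2 *
        ENNReal.ofReal (1 - ‖fourierReal (gaussFilter x) ω‖ ^ 2))
    (F : Finset (ScatPath J n)) (t : ℝ) :
    ∑ p ∈ F, ∫ ω, scatU ψ p.1 (fun s => X s ω) t ^ 2 ∂P +
      ∫ ω, conv (fun s => X s ω) (gaussFilter x) t ^ 2 ∂P ≤ ∫ ω, X t ω ^ 2 ∂P := by
  have hχ := integrable_gaussFilter hx
  have hreg := hX.isRegularProcess
  have hU : ∀ (p : List ℤ) u, ∫⁻ ω, ‖scatU ψ p (fun s => X s ω) u‖ₑ ^ 2 ∂P =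
      ∫⁻ ω, ‖scatU ψ p (fun s => X s ω) 0‖ₑ ^ 2 ∂P := fun p u =>
    (hreg.scatU hψ p).lintegral_sq_eq u
  have hC : ∀ u, ∫⁻ ω, ‖conv (fun s => X s ω) (gaussFilter x) u‖ₑ ^ 2 ∂P =
      ∫⁻ ω, ‖conv (fun s => X s ω) (gaussFilter x) 0‖ₑ ^ 2 ∂P := fun u => by
    simpa only [enorm_norm] using (hreg.norm_conv hχ).lintegral_sq_eq u
  have key := hreg.sum_lintegral_scatU_sq_add_le hψ hx h hU hC F
  rw [← hC t, ← hreg.lintegral_sq_eq t, lintegral_enorm_sq_eq_ofReal (hX.memLp_two t),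
    lintegral_enorm_sq_eq_ofReal (hX.memLp_two_conv hχ t)] at key
  simp only [← hU _ t, lintegral_enorm_sq_eq_ofReal ((hreg.scatU hψ _).memLp_two t)] at key
  rwa [← ENNReal.ofReal_sum_of_nonneg fun p _ => integral_nonneg fun ω => sq_nonneg _,
    ← ENNReal.ofReal_add (Finset.sum_nonneg fun p _ => integral_nonneg fun ω => sq_nonneg _)
      (integral_nonneg fun ω => sq_nonneg _),
    ENNReal.ofReal_le_ofReal_iff (integral_nonneg fun ω => sq_nonneg _)] at key

theorem mainTheorem2 (ψ : ℝ → ℂ) (hψ : IsMotherWavelet ψ)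
    (hLP : ∀ ω : ℝ, (1 / 2 : ℝ≥0∞) *
      ∑' j : ℤ, (‖𝓕 (wavelet ψ j) ω‖ₑ ^ 2 + ‖𝓕 (wavelet ψ j) (-ω)‖ₑ ^ 2) ≤ 1)
    (hneg : ∀ (j : ℤ) (ω : ℝ), 0 < ω → ‖𝓕 (wavelet ψ j) (-ω)‖ ≤ ‖𝓕 (wavelet ψ j) ω‖)
    (hstrict : ∀ ω : ℝ, 0 < ω → ∃ j : ℤ, ‖𝓕 (wavelet ψ j) (-ω)‖ < ‖𝓕 (wavelet ψ j) ω‖)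
    (hzero : ∃ ε : ℝ, 0 < ε ∧ 𝓕 ψ =O[𝓝 0] (fun ω : ℝ => |ω| ^ (1 + ε)))
    (J : ℤ) :
    ∃ r a : ℝ, 0 < r ∧ 1 < a ∧
      ∀ (Ω : Type*) [MeasurableSpace Ω] (P : Measure Ω) [IsProbabilityMeasure P]
        (X : ℝ → Ω → ℝ), IsAdmissibleProcess P X →
        -- every convolution below exists almost surely and all second moments are finite
        (∀ (p : List ℤ) (t : ℝ),
          MemLp (fun ω => scatU ψ p (fun s => X s ω) t) 2 P ∧
          ∀ j : ℤ, ∀ᵐ ω ∂P, ConvExistsAt (scatU ψ p (fun s => X s ω)) (wavelet ψ j) t) ∧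
        ∀ (n : ℕ), 2 ≤ n → ∀ t : ℝ,
          (∀ᵐ ω ∂P, ConvExistsAt (fun s => X s ω) (gaussFilter (r * a ^ n)) t) ∧
          MemLp (fun ω => conv (fun s => X s ω) (gaussFilter (r * a ^ n)) t) 2 P ∧
          Summable (fun p : ScatPath J n => ∫ ω, |scatU ψ p.1 (fun s => X s ω) t| ^ 2 ∂P) ∧
          ∑' p : ScatPath J n, ∫ ω, |scatU ψ p.1 (fun s => X s ω) t| ^ 2 ∂P ≤
            ∫ ω, |X t ω| ^ 2 ∂P
              - ∫ ω, |conv (fun s => X s ω) (gaussFilter (r * a ^ n)) t| ^ 2 ∂P ∧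
          Integrable (fun ξ : ℝ => fourierReal (autocov P X) ξ *
            ((1 - ‖fourierReal (gaussFilter (r * a ^ n)) ξ‖ ^ 2 : ℝ) : ℂ)) ∧
          ((∫ ω, |X t ω| ^ 2 ∂P
              - ∫ ω, |conv (fun s => X s ω) (gaussFilter (r * a ^ n)) t| ^ 2 ∂P : ℝ) : ℂ) =
            ∫ ξ : ℝ, fourierReal (autocov P X) ξ *
              ((1 - ‖fourierReal (gaussFilter (r * a ^ n)) ξ‖ ^ 2 : ℝ) : ℂ) := by
  obtain ⟨r, a, hr, ha, hE⟩ := exists_cascadeEnergy_le hψ.integrable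
    (isWaveletProfile_norm_sq_fourier hψ hLP hneg hstrict hzero) J
  refine ⟨r, a, hr, ha, ?_⟩
  intro Ω _ P _ X hX
  have hreg := hX.isRegularProcess
  refine ⟨fun p t => ⟨(hreg.scatU hψ.integrable p).memLp_two t, fun j =>
    (hreg.scatU hψ.integrable p).ae_convExistsAt (integrable_wavelet hψ.integrable j) t⟩,
    fun n hn t => ?_⟩
  have hx : 0 < r * a ^ n := by positivity
  have hχ := integrable_gaussFilter hx
  have hsum := fun F => hX.sum_integral_scatU_sq_add_le hψ.integrable hx (hE n hn) F t
  simp only [sq_abs]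
  have hle : ∀ F : Finset (ScatPath J n),
      ∑ p ∈ F, ∫ ω, scatU ψ p.1 (fun s => X s ω) t ^ 2 ∂P ≤ ∫ ω, X t ω ^ 2 ∂P -
        ∫ ω, conv (fun s => X s ω) (gaussFilter (r * a ^ n)) t ^ 2 ∂P := fun F => by
    linarith [hsum F]
  have hsm : Summable fun p : ScatPath J n => ∫ ω, scatU ψ p.1 (fun s => X s ω) t ^ 2 ∂P :=
    summable_of_sum_le (fun p => integral_nonneg fun ω => sq_nonneg _) hle
  exact ⟨hreg.ae_convExistsAt hχ t, hX.memLp_two_conv hχ t, hsm, hsm.tsum_le_of_sum_le hle,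
    hX.integrable_fourierReal_autocov_mul_compl hx, hX.integral_sq_sub_integral_conv_sq hx t⟩
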